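/- **Model.** All points lie in $\mathbb R^3$. The typical satellite is $\mathbf x_1=(0,0,R_{\sf s})$. For each type $o\in\{{\sf u_s},{\sf b},{\sf u_t}\}$ (satellite users, terrestrial base stations (BSs), terrestrial users) the transmitters form a homogeneous Poisson point process $\Phi_o$ of density $\lambda_o>0$ (with respect to surface area) on the sphere of radius $R_o$ about the origin, $0<R_o<R_{\sf s}$; the three processes are independent. Let $0<\theta_{\sf s}<\pi/2$ be the visible angle of the satellite, with $R_{\sf s}\sin\theta_{\sf s}\le R_o$ for all $o$. The visible cap $\mathcal A_{o|{\sf s}}$ is the set of points $\mathbf y$ with $\|\mathbf y\|=R_o$ from which $\mathbf x_1$ is seen at elevation $\ge0$ and for which the angle at $\mathbf x_1$ between $\mathbf y-\mathbf x_1$ and $-\mathbf x_1$ is at most $\theta_{\sf s}$. Put $$R_{\min}^{o|{\sf s}}=R_{\sf s}-R_o,\quad R_{\max}^{o|{\sf s}}=R_{\sf s}\cos\theta_{\sf s}-\sqrt{R_o^2-R_{\sf s}^2\sin^2\theta_{\sf s}},\quad \tilde\lambda_{o|{\sf s}}=\lambda_oR_o/R_{\sf s}.$$ The channel powers $H\ge0$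 of all transmitters to $\mathbf x_1$ are i.i.d., independent of the point processes, and Shadowed-Rician with integer parameter $m_{\sf s}=m\ge1$, $b>0$, $\Omega\ge0$: the density of $\sqrt H$ on $[0,\infty)$ is $$\Big(\tfrac{2bm}{2bm+\Omega}\Big)^m\tfrac xb e^{-x^2/(2b)}\,{}_1F_1\Big(m;1;\tfrac{\Omega x^2}{2b(2bm+\Omega)}\Big).$$ Let $P_o>0$ be the transmit powers, $\alpha_{\sf s}>0$ the path-loss exponent, $\sigma^2>0$ the noise power and $\kappa=(c_0/(4\pi f_c))^2$, with $c_0$ the speed of light and $f_c$ the carrier frequency. With positive antenna gains, the effective gains are $G_1=G_{\sf s}^{\sf main}G_{\sf u_s}^{\sf main}\kappa$ for the serving (nearest visible) satellite user $\mathbf u_1$, $G_{\sf u}=G_{\sf s}^{\sf side}G_{\sf u_s}^{\sf side}\kappa$ for all other satellite users, $G^{\sf u_t|s}=G_{\sf s}^{\sf side}G_{\sf u_t}^{\sf side}\kappa$ for terrestrial users, and $G_{\sf s}^{\sf side}G_{\sf b}(\psi)\kappa$ for a BS that sees the satellite at elevation $\psi$, where $G_{\sf b}(\psi)=G_{\sf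 b}^{\sf main}$ if $\psi\le\psi_1^{\sf th}$, $G_{\sf b_H}^{\sf side}$ if $\psi_1^{\sf th}<\psi\le\psi_2^{\sf th}$, $G_{\sf b_L}^{\sf side}$ if $\psi>\psi_2^{\sf th}$. Assume $$\psi_1^{\sf th}<\arccos\big(\tfrac{R_{\sf s}}{R_{\sf b}}\sin\theta_{\sf s}\big)\le\psi_2^{\sf th}\le\tfrac\pi2 .$$ Write $G^{\sf b_H|s}=G_{\sf s}^{\sf side}G_{\sf b_H}^{\sf side}\kappa$, $G^{\sf b_L|s}=G_{\sf s}^{\sf side}G_{\sf b_L}^{\sf side}\kappa$. Let $t={\sf b}$ when the spectrum is shared with a downlink terrestrial network ($o={\sf dn}$) and $t={\sf u_t}$ when it is shared with an uplink one ($o={\sf up}$). Let $I^o$ be the sum of the received powers $GPH\,\|\cdot-\mathbf x_1\|^{-\alpha_{\sf s}}$ over all visible satellite users other than $\mathbf u_1$ and over all visible terrestrial transmitters of type $t$, plus $\sigma^2$. The SINR is $\mathrm{SINR}^o_{\sf up}=G_1P_{\sf u_s}H_1\|\mathbf u_1-\mathbf x_1\|^{-\alpha_{\sf s}}/I^o$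 if some satellite user is visible and $0$ otherwise, and $R^o_{\sf up}=\mathbb E[\log_2(1+\mathrm{SINR}^o_{\sf up})]$. **Notation.** $\beta=\frac1{2b}$, $c=\frac{\Omega}{2b(2bm+\Omega)}$, $\zeta(z)=\big(\frac{2bm}{2bm+\Omega}\big)^m\frac{\beta(-1)^z(1-m)_zc^z}{(z!)^2}$ with the Pochhammer symbol $(x)_z$, and $$\ell(t)=1-\sum_{z=0}^{m-1}\frac{\zeta(z)\Gamma(z+1)}{(\beta-c+t)^{z+1}},\quad J(\lambda,g,r_1,r_2,s)=2\pi\lambda\int_{r_1}^{r_2}\ell\big(sgv^{-\alpha_{\sf s}}\big)v\,dv,$$ $R_\psi=\sqrt{R_{\sf s}^2-R_{\sf b}^2\cos^2\psi_2^{\sf th}}-R_{\sf b}\sin\psi_2^{\sf th}$, $$\mathcal L^{\sf dn}_r(s)=\exp\!\Big(-s\sigma^2-J(\tilde\lambda_{\sf u_s|s},G_{\sf u}P_{\sf u_s},r,R_{\max}^{\sf u_s|s},s)-J(\tilde\lambda_{\sf b|s},G^{\sf b_L|s}P_{\sf b},R_{\min}^{\sf b|s},R_\psi,s)-J(\tilde\lambda_{\sf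 b|s},G^{\sf b_H|s}P_{\sf b},R_\psi,R_{\max}^{\sf b|s},s)\Big),$$ $$\mathcal L^{\sf up}_r(s)=\exp\!\Big(-s\sigma^2-J(\tilde\lambda_{\sf u_s|s},G_{\sf u}P_{\sf u_s},r,R_{\max}^{\sf u_s|s},s)-J(\tilde\lambda_{\sf u_t|s},G^{\sf u_t|s}P_{\sf u_t},R_{\min}^{\sf u_t|s},R_{\max}^{\sf u_t|s},s)\Big),$$ $$p_{\rm vis}=1-e^{-\tilde\lambda_{\sf u_s|s}\pi((R_{\max}^{\sf u_s|s})^2-(R_{\min}^{\sf u_s|s})^2)},\qquad f(r)=\frac{2\tilde\lambda_{\sf u_s|s}\pi\,e^{\tilde\lambda_{\sf u_s|s}\pi(R_{\min}^{\sf u_s|s})^2}}{p_{\rm vis}}\,r\,e^{-\tilde\lambda_{\sf u_s|s}\pi r^2}.$$ **Theorem 1.** Let $o\in\{{\sf dn},{\sf up}\}$. Then $p_{\rm vis}$ is the probability that at least one satellite user is visible; given this event, the distance $\|\mathbf u_1-\mathbf x_1\|$ has density $f$ on $[R_{\min}^{\sf u_s|s},R_{\max}^{\sf u_s|s}]$;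 and, for every $s\ge0$, $\mathcal L^o_r(s)$ is the conditional expectation of $e^{-sI^o}$ given this event and $\|\mathbf u_1-\mathbf x_1\|=r$. Moreover $\log_2(1+\mathrm{SINR}^o_{\sf up})$ is integrable, the iterated integral below converges absolutely at each stage, and $$R_{\sf up}^o=p_{\rm vis}\int_0^\infty\!\!\int_{R_{\min}^{\sf u_s|s}}^{R_{\max}^{\sf u_s|s}}\Bigg[1-\sum_{z=0}^{m_{\sf s}-1}\frac{\zeta(z)\Gamma(z+1)}{(\beta-c)^{z+1}}\Bigg(1-\sum_{v=0}^{z}\frac{((\beta-c)\gamma r^{\alpha_{\sf s}})^v}{(G_1P_{\sf u_s})^v\,v!}(-1)^v\frac{d^v\mathcal L^o_r(s)}{ds^v}\Big|_{s=\frac{(\beta-c)\gamma r^{\alpha_{\sf s}}}{G_1P_{\sf u_s}}}\Bigg)\Bigg]f(r)\,\frac{\log_2e}{1+\gamma}\,dr\,d\gamma .$$ -/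

import Mathlib

open MeasureTheory ProbabilityTheory

noncomputable section

namespace SatUplink

/-- Euclidean three-space. -/
abbrev E3 : Type := EuclideanSpace ℝ (Fin 3)

/-! ### Poisson point processes on spheres -/

/-- Surface area on the sphere of radius `R` about the origin, as a measure on the whole space. -/
def sphereArea (R : ℝ) : Measure E3 :=
  ENNReal.ofReal (R ^ 2) •
    ((volume : Measure E3).toSphere.map (fun u : Metric.sphere (0 : E3) 1 => R • (u : E3)))

open Classical in
/-- The number of points `X 0, …, X (N - 1)` that lie in `A`. -/
def pointCount {Ω : Type*} (N : Ω → ℕ) (X : ℕ → Ω → E3) (A : Set E3) (ω : Ω) : ℕ :=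
  ((Finset.range (N ω)).filter (fun i => X i ω ∈ A)).card

/-- The random configuration `{X 0, …, X (N - 1)}` is a Poisson point process with (finite)
intensity measure `Λ`: counts are Poisson, and independent on disjoint sets. The enumeration of the
points is arbitrary. -/
structure IsPoissonProcess {Ω : Type*} [MeasurableSpace Ω] (P : Measure Ω)
    (N : Ω → ℕ) (X : ℕ → Ω → E3) (Λ : Measure E3) : Prop where
  measurable_num : Measurable N
  measurable_pos : ∀ i, Measurable (X i)
  count_law : ∀ A : Set E3, MeasurableSet A →
    P.map (pointCount N X A) = poissonMeasure (Λ A).toNNReal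
  count_indep : ∀ (n : ℕ) (A : Fin n → Set E3), (∀ j, MeasurableSet (A j)) →
    Pairwise (fun j k => Disjoint (A j) (A k)) →
    iIndepFun (fun j => pointCount N X (A j)) P

/-! ### Shadowed-Rician fading -/

/-- Kummer's confluent hypergeometric function of the first kind `₁F₁(a; b; x)`. -/
def kummer (a b x : ℝ) : ℝ :=
  ∑' n : ℕ, (ascPochhammer ℝ n).eval a / ((ascPochhammer ℝ n).eval b * (n.factorial : ℝ)) * x ^ n

/-- Density (on `x ≥ 0`) of the Shadowed-Rician channel amplitude, where `2b` is the average power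
of the scatter component, `Om` that of the line-of-sight component and `m` the Nakagami parameter. -/
def shadowedRicianPDF (m : ℕ) (b Om x : ℝ) : ℝ :=
  (2 * b * m / (2 * b * m + Om)) ^ m * (x / b) * Real.exp (-x ^ 2 / (2 * b)) *
    kummer m 1 (Om * x ^ 2 / (2 * b * (2 * b * m + Om)))

/-! ### Network parameters -/

/-- The transmitters seen by the typical satellite: satellite users, terrestrial base stations,
terrestrial users. -/
inductive Node where
  | satUser
  | bs
  | terUser

/-- The terrestrial network that shares the spectrum: downlink (base stations transmit) or uplink
(terrestrial users transmit). -/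
inductive Sharing where
  | dn
  | up

/-- The terrestrial transmitters in each sharing mode. -/
def Sharing.node : Sharing → Node
  | .dn => .bs
  | .up => .terUser

/-- System parameters. -/
structure Params where
  /-- radius of the sphere of satellites -/
  Rs : ℝ
  /-- visible angle of the typical satellite -/
  theta : ℝ
  /-- radii of the spheres of transmitters -/
  radius : Node → ℝ
  /-- densities of transmitters -/
  density : Node → ℝ
  /-- transmit powers -/
  power : Node → ℝ
  /-- antenna gains: satellite main and side lobe -/
  gSatMain : ℝ
  gSatSide : ℝ
  /-- satellite user main and side lobe -/
  gUserMain : ℝ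
  gUserSide : ℝ
  /-- terrestrial user side lobe -/
  gTerSide : ℝ
  /-- base station main lobe, high side-lobe level, low side-lobe level -/
  gBsMain : ℝ
  gBsHigh : ℝ
  gBsLow : ℝ
  /-- threshold elevation angles of the base station gain -/
  psi1 : ℝ
  psi2 : ℝ
  /-- speed of light and carrier frequency -/
  lightSpeed : ℝ
  fc : ℝ
  /-- path-loss exponent of satellite links -/
  alpha : ℝ
  /-- square root of the noise power -/
  sigma : ℝ
  /-- Shadowed-Rician parameters -/
  m : ℕ
  b : ℝ
  Om : ℝ

/-- Standing assumptions on the parameters. The visible angle is such that the rays bounding the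
visible cone meet the transmitter spheres. Every visible base station sees the satellite outside
its main lobe, and the elevation threshold between the two side-lobe levels is not below the
elevations that occur in the visible cap. -/
structure Params.Valid (p : Params) : Prop where
  theta_pos : 0 < p.theta
  theta_lt : p.theta < Real.pi / 2
  radius_pos : ∀ o, 0 < p.radius o
  radius_lt : ∀ o, p.radius o < p.Rs
  cone_meets : ∀ o, p.Rs * Real.sin p.theta ≤ p.radius o
  density_pos : ∀ o, 0 < p.density o
  power_pos : ∀ o, 0 < p.power o
  gSatMain_pos : 0 < p.gSatMain
  gSatSide_pos : 0 < p.gSatSide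
  gUserMain_pos : 0 < p.gUserMain
  gUserSide_pos : 0 < p.gUserSide
  gTerSide_pos : 0 < p.gTerSide
  gBsMain_pos : 0 < p.gBsMain
  gBsHigh_pos : 0 < p.gBsHigh
  gBsLow_pos : 0 < p.gBsLow
  psi1_lt : p.psi1 < Real.arccos (p.Rs / p.radius .bs * Real.sin p.theta)
  le_psi2 : Real.arccos (p.Rs / p.radius .bs * Real.sin p.theta) ≤ p.psi2
  psi2_le : p.psi2 ≤ Real.pi / 2
  lightSpeed_pos : 0 < p.lightSpeed
  fc_pos : 0 < p.fc
  alpha_pos : 0 < p.alpha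
  sigma_pos : 0 < p.sigma
  m_pos : 1 ≤ p.m
  b_pos : 0 < p.b
  Om_nonneg : 0 ≤ p.Om

/-! ### Geometry and gains -/

/-- The typical satellite. -/
def Params.sat (p : Params) : E3 := !₂[0, 0, p.Rs]

/-- The elevation angle at which `x` is seen from the point `y` of a sphere about the origin. -/
def elevation (y x : E3) : ℝ := Real.pi / 2 - InnerProductGeometry.angle y (x - y)

/-- The visible spherical cap: points of the transmitter sphere that see the typical satellite
above the horizon and lie within the visible angle about the direction from the satellite to the
centre of the Earth. -/
def Params.cap (p : Params) (o : Node) : Set E3 :=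
  {y | y ∈ Metric.sphere (0 : E3) (p.radius o) ∧ 0 ≤ elevation y p.sat ∧
    InnerProductGeometry.angle (y - p.sat) (-p.sat) ≤ p.theta}

/-- Free-space factor `(c / (4 π f_c))²`. -/
def Params.pathFactor (p : Params) : ℝ := (p.lightSpeed / (4 * Real.pi * p.fc)) ^ 2

/-- Effective gain of the serving satellite user. -/
def Params.gServing (p : Params) : ℝ := p.gSatMain * p.gUserMain * p.pathFactor

/-- Effective gain of the interfering satellite users. -/
def Params.gUser (p : Params) : ℝ := p.gSatSide * p.gUserSide * p.pathFactor

/-- Three-level base station gain towards elevation `ψ`. -/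
def Params.bsGain (p : Params) (ψ : ℝ) : ℝ :=
  if ψ ≤ p.psi1 then p.gBsMain else if ψ ≤ p.psi2 then p.gBsHigh else p.gBsLow

/-- Effective gain of an interferer of type `o` located at `y`. -/
def Params.gain (p : Params) : Node → E3 → ℝ
  | .satUser, _ => p.gUser
  | .bs, y => p.gSatSide * p.bsGain (elevation y p.sat) * p.pathFactor
  | .terUser, _ => p.gSatSide * p.gTerSide * p.pathFactor

/-! ### The random network -/

/-- The random data: number and positions of the transmitters of each type and the fading powers
of their channels to the typical satellite. -/
structure Network (Ω : Type*) where
  num : Node → Ω → ℕ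
  pos : Node → ℕ → Ω → E3
  fade : Node → ℕ → Ω → ℝ

/-- The transmitters of each type form a homogeneous Poisson process on their sphere, all fading
amplitudes are Shadowed-Rician, and everything is independent. -/
structure Network.IsModel {Ω : Type*} [MeasurableSpace Ω] (M : Network Ω) (p : Params)
    (P : Measure Ω) : Prop where
  poisson : ∀ o, IsPoissonProcess P (M.num o) (M.pos o)
    (ENNReal.ofReal (p.density o) • sphereArea (p.radius o))
  measurable_fade : ∀ o i, Measurable (M.fade o i)
  fade_law : ∀ o i, P.map (fun ω => √(M.fade o i ω)) =
    (volume.restrict (Set.Ici (0 : ℝ))).withDensity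
      (fun x => ENNReal.ofReal (shadowedRicianPDF p.m p.b p.Om x))
  indep_locations : iIndepFun (fun (o : Node) ω => (M.num o ω, fun i => M.pos o i ω)) P
  indep_fades : iIndepFun (fun (q : Node × ℕ) ω => M.fade q.1 q.2 ω) P
  indep_locations_fades : IndepFun
    (fun ω => fun o : Node => (M.num o ω, fun i => M.pos o i ω))
    (fun ω => fun q : Node × ℕ => M.fade q.1 q.2 ω) P

section
variable {Ω : Type*} (M : Network Ω) (p : Params)

open Classical in
/-- Indices of the visible transmitters of type `o`. -/
def Network.visible (o : Node) (ω : Ω) : Finset ℕ :=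
  (Finset.range (M.num o ω)).filter (fun i => M.pos o i ω ∈ p.cap o)

/-- Distance of a transmitter to the typical satellite. -/
def Network.distTo (o : Node) (i : ℕ) (ω : Ω) : ℝ := ‖M.pos o i ω - p.sat‖

/-- Index of the nearest visible satellite user (the least one in case of ties). -/
def Network.serving (ω : Ω) : ℕ :=
  sInf {i | i ∈ M.visible p .satUser ω ∧
    ∀ j ∈ M.visible p .satUser ω, M.distTo p .satUser i ω ≤ M.distTo p .satUser j ω}

/-- Distance of the nearest visible satellite user. -/
def Network.servingDist (ω : Ω) : ℝ := M.distTo p .satUser (M.serving p ω) ω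

/-- The event that at least one satellite user is visible. -/
def Network.visibleEvent : Set Ω := {ω | (M.visible p .satUser ω).Nonempty}

/-- Power received from an interferer. -/
def Network.interferer (o : Node) (i : ℕ) (ω : Ω) : ℝ :=
  p.gain o (M.pos o i ω) * p.power o * M.fade o i ω * M.distTo p o i ω ^ (-p.alpha)

/-- Aggregated interference plus noise power at the typical satellite. -/
def Network.interference (s : Sharing) (ω : Ω) : ℝ :=
  ∑ i ∈ (M.visible p .satUser ω).erase (M.serving p ω), M.interferer p .satUser i ω
    + ∑ i ∈ M.visible p s.node ω, M.interferer p s.node i ω + p.sigma ^ 2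

open Classical in
/-- Uplink SINR; there is no signal if no satellite user is visible. -/
def Network.sinr (s : Sharing) (ω : Ω) : ℝ :=
  if ω ∈ M.visibleEvent p then
    p.gServing * p.power .satUser * M.fade .satUser (M.serving p ω) ω *
      M.servingDist p ω ^ (-p.alpha) / M.interference p s ω
  else 0

/-- Ergodic spectral efficiency `E[log₂ (1 + SINR)]`. -/
def Network.spectralEfficiency [MeasurableSpace Ω] (P : Measure Ω) (s : Sharing) : ℝ :=
  ∫ ω, Real.logb 2 (1 + M.sinr p s ω) ∂P

end

/-! ### The quantities in the analytical expression -/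

section
variable (p : Params)

/-- Minimum distance of the visible cap. -/
def Params.rMin (o : Node) : ℝ := p.Rs - p.radius o

/-- Maximum distance of the visible cap. -/
def Params.rMax (o : Node) : ℝ :=
  p.Rs * Real.cos p.theta - √(p.radius o ^ 2 - p.Rs ^ 2 * Real.sin p.theta ^ 2)

/-- Distance at which a base station sees the satellite at elevation `psi2`. -/
def Params.rPsi : ℝ :=
  √(p.Rs ^ 2 - p.radius .bs ^ 2 * Real.cos p.psi2 ^ 2) - p.radius .bs * Real.sin p.psi2

/-- Density of the equivalent planar process. -/
def Params.planarDensity (o : Node) : ℝ := p.density o * (p.radius o / p.Rs)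

/-- `β = 1 / (2b)`. -/
def Params.beta : ℝ := 1 / (2 * p.b)

/-- `c = Ω / (2b (2bm + Ω))`. -/
def Params.cc : ℝ := p.Om / (2 * p.b * (2 * p.b * p.m + p.Om))

/-- `ζ(z) = (2bm / (2bm + Ω))^m β (-1)^z (1 - m)_z c^z / (z!)²`. -/
def Params.zeta (z : ℕ) : ℝ :=
  (2 * p.b * p.m / (2 * p.b * p.m + p.Om)) ^ p.m *
    (p.beta * (-1) ^ z * (ascPochhammer ℝ z).eval (1 - (p.m : ℝ)) * p.cc ^ z) /
      (z.factorial : ℝ) ^ 2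

/-- `1 - ∑_{z < m} ζ(z) Γ(z + 1) / (β - c + t)^(z + 1)`. -/
def Params.lossTerm (t : ℝ) : ℝ :=
  1 - ∑ z ∈ Finset.range p.m,
    p.zeta z * Real.Gamma ((z : ℝ) + 1) / (p.beta - p.cc + t) ^ (z + 1)

/-- Contribution of transmitters with planar density `l` and received-power factor `g` at distances
between `r₁` and `r₂` to minus the logarithm of the Laplace transform. -/
def Params.ringTerm (l g r₁ r₂ s : ℝ) : ℝ :=
  2 * Real.pi * l * ∫ v in r₁..r₂, p.lossTerm (s * g * v ^ (-p.alpha)) * v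

/-- The conditional Laplace transform at `s` of the aggregated interference plus noise power, given
that the nearest satellite user is at distance `r`. -/
def Params.laplace : Sharing → ℝ → ℝ → ℝ
  | .dn, r, s => Real.exp (-(s * p.sigma ^ 2)
      - p.ringTerm (p.planarDensity .satUser) (p.gUser * p.power .satUser) r (p.rMax .satUser) s
      - p.ringTerm (p.planarDensity .bs) (p.gSatSide * p.gBsLow * p.pathFactor * p.power .bs)
          (p.rMin .bs) p.rPsi s
      - p.ringTerm (p.planarDensity .bs) (p.gSatSide * p.gBsHigh * p.pathFactor * p.power .bs)
          p.rPsi (p.rMax .bs) s)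
  | .up, r, s => Real.exp (-(s * p.sigma ^ 2)
      - p.ringTerm (p.planarDensity .satUser) (p.gUser * p.power .satUser) r (p.rMax .satUser) s
      - p.ringTerm (p.planarDensity .terUser) (p.gSatSide * p.gTerSide * p.pathFactor * p.power .terUser)
          (p.rMin .terUser) (p.rMax .terUser) s)

/-- Probability that at least one satellite user is visible. -/
def Params.visibleProb : ℝ :=
  1 - Real.exp (-(p.planarDensity .satUser * Real.pi *
    (p.rMax .satUser ^ 2 - p.rMin .satUser ^ 2)))

/-- Conditional density of the distance of the nearest satellite user. -/
def Params.nearestPDF (r : ℝ) : ℝ :=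
  2 * p.planarDensity .satUser * Real.pi *
      Real.exp (p.planarDensity .satUser * Real.pi * p.rMin .satUser ^ 2) / p.visibleProb *
    (r * Real.exp (-(p.planarDensity .satUser * Real.pi * r ^ 2)))

/-- The point `(β - c) γ r^α / (G₁ P)` at which derivatives are evaluated. -/
def Params.sPoint (γ r : ℝ) : ℝ :=
  (p.beta - p.cc) * γ * r ^ p.alpha / (p.gServing * p.power .satUser)

/-- SINR coverage probability at level `γ`, given that the nearest satellite user is at
distance `r`. -/
def Params.coverage (o : Sharing) (γ r : ℝ) : ℝ :=
  1 - ∑ z ∈ Finset.range p.m,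
    p.zeta z * Real.Gamma ((z : ℝ) + 1) / (p.beta - p.cc) ^ (z + 1) *
      (1 - ∑ v ∈ Finset.range (z + 1),
        ((p.beta - p.cc) * γ * r ^ p.alpha) ^ v /
            ((p.gServing * p.power .satUser) ^ v * (v.factorial : ℝ)) *
          (-1) ^ v * iteratedDeriv v (fun s => p.laplace o r s) (p.sPoint γ r))

/-- Integrand of the double integral. -/
def Params.integrand (o : Sharing) (γ r : ℝ) : ℝ :=
  p.coverage o γ r * p.nearestPDF r * (Real.logb 2 (Real.exp 1) / (1 + γ))

end

end SatUplink

end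

/-!
The randomness is averaged out in three layers: the locations of the transmitters, the fading of the
interferers, and the fading of the serving satellite user.

*Poisson layer.* The generating functional of a Poisson process, `E ∏ k(X i) = exp (-∫ (1 - k) dΛ)`,
follows for simple functions from the counts being independent Poisson variables, and for general
`k` by approximation (`IsPoissonProcess.integral_prod`). By Archimedes' theorem the distance to the
satellite pushes surface area on the visible cap to a multiple of `v dv` on `[rMin, rMax]`
(`setIntegral_cap_radial`), so the processes look like planar ones of density `planarDensity`
(`IsModel.integral_prod_visible`). Applied to functions that vanish within distance `r`, the
functional gives the law of the distance `D` of the nearest satellite user, weighted with any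
multiplicative functional of all satellite users (`IsModel.map_servingDist_weighted`). Dividing by
the factor of the nearest user yields the generating functional of the others given `D`
(`IsModel.lintegral_prod_erase`).

*Fading layer.* Kummer's function `₁F₁(m; 1; ·)` is a polynomial times an exponential, so the
fading power has a density that is a mixture of gamma densities, with explicit tail `ccdf` and
Laplace transform `1 - lossTerm`. Locations and fading are independent, hence the fading may be
resampled for fixed locations (`IsModel.lintegral_resample`). Both layers together give
the Laplace transform of the interference `I` on `{D ∈ B}` (`IsModel.lintegral_exp_interference`).
The interference `I_r` that counts the satellite users beyond a deterministic distance `r` has the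
unconditional Laplace transform `laplace o r` (`IsModel.lintegral_exp_interferenceBeyond`). By
uniqueness of Laplace transforms, `I_r` is a version of `I` given `D = r`
(`IsModel.map_servingDist_interference`). This replaces a regular conditional distribution.

*SINR layer.* The fading of the serving user is independent of `D` and `I`, so `P (γ < SINR)` is the
mean of `ccdf` at a level proportional to `γ D ^ α I` on the event of visibility
(`IsModel.measure_lt_sinr`). The tail `ccdf` is a sum of terms `x ^ v exp (-a x)`, whose means under
`I_r` are derivatives of the Laplace transform; they add up to `coverage`
(`IsModel.coverage_eq`). The layer-cake formula applied to `log₂ (1 + ·)` then gives the spectral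
efficiency, and convergence holds because `D` and `I` are bounded below, which bounds the tail of
the SINR by an integrable fading tail (`IsModel.measureReal_lt_sinr_le`).
-/

namespace SatUplink

/-! ### The probability generating functional of a Poisson process -/

theorem measurable_comp_nat {Ω β : Type*} [MeasurableSpace Ω] [MeasurableSpace β] {N : Ω → ℕ}
    (hN : Measurable N) {F : ℕ → Ω → β} (hF : ∀ n, Measurable (F n)) :
    Measurable fun ω => F (N ω) ω :=
  (measurable_from_prod_countable_right (f := fun q : ℕ × Ω => F q.1 q.2) hF).comp
    (hN.prodMk measurable_id)

theorem measurable_pointCount {Ω : Type*} [MeasurableSpace Ω] {N : Ω → ℕ} {X : ℕ → Ω → E3}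
    (hN : Measurable N) (hX : ∀ i, Measurable (X i)) {A : Set E3} (hA : MeasurableSet A) :
    Measurable (pointCount N X A) := by
  classical
  have : pointCount N X A =
      fun ω => ∑ i ∈ Finset.range (N ω), A.indicator (fun _ => (1 : ℕ)) (X i ω) := by
    funext ω
    simp only [pointCount, Finset.card_filter]
    exact Finset.sum_congr (by rfl) fun i _ => by simp [Set.indicator_apply]
  rw [this]
  refine measurable_comp_nat (F := fun n ω => ∑ i ∈ Finset.range n,
    A.indicator (fun _ => (1 : ℕ)) (X i ω)) hN fun n => ?_
  exact Finset.measurable_sum _ fun i _ => (measurable_const.indicator hA).comp (hX i)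

theorem measurable_prod_range {Ω : Type*} [MeasurableSpace Ω] {N : Ω → ℕ} {f : ℕ → Ω → ℝ}
    (hN : Measurable N) (hf : ∀ i, Measurable (f i)) :
    Measurable fun ω => ∏ i ∈ Finset.range (N ω), f i ω :=
  measurable_comp_nat (F := fun n ω => ∏ i ∈ Finset.range n, f i ω) hN fun _ =>
    Finset.measurable_prod _ fun i _ => hf i

theorem measurable_sum_range {Ω : Type*} [MeasurableSpace Ω] {N : Ω → ℕ} {f : ℕ → Ω → ℝ}
    (hN : Measurable N) (hf : ∀ i, Measurable (f i)) :
    Measurable fun ω => ∑ i ∈ Finset.range (N ω), f i ω :=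
  measurable_comp_nat (F := fun n ω => ∑ i ∈ Finset.range n, f i ω) hN fun _ =>
    Finset.measurable_sum _ fun i _ => hf i

theorem integral_pow_poissonMeasure (r : NNReal) (a : ℝ) :
    ∫ n, a ^ n ∂(poissonMeasure r) = Real.exp (-(r * (1 - a))) := by
  rw [integral_poissonMeasure]
  have h : HasSum (fun n : ℕ => Real.exp (-r) * ((r * a) ^ n / n.factorial))
      (Real.exp (-r) * Real.exp (r * a)) := by
    have := (NormedSpace.expSeries_div_hasSum_exp (r * a : ℝ)).mul_left (Real.exp (-r))
    rwa [← Real.exp_eq_exp_ℝ] at this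
  rw [show -((r : ℝ) * (1 - a)) = -r + r * a by ring, Real.exp_add, ← h.tsum_eq]
  refine tsum_congr fun n => ?_
  simp only [smul_eq_mul, mul_pow]
  ring

section
variable {Ω : Type*} [MeasurableSpace Ω] {P : Measure Ω} {N : Ω → ℕ} {X : ℕ → Ω → E3}
  {Λ : Measure E3}

/-- For finitely many values `a`, the product is `∏ a ^ (number of points where k = a)`, a product
of independent functions of Poisson variables. -/
theorem IsPoissonProcess.integral_prod_simpleFunc [IsFiniteMeasure Λ]
    (h : IsPoissonProcess P N X Λ) (k : SimpleFunc E3 ℝ) :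
    ∫ ω, ∏ i ∈ Finset.range (N ω), k (X i ω) ∂P = Real.exp (-∫ y, (1 - k y) ∂Λ) := by
  classical
  let A : k.range → Set E3 := fun a => k ⁻¹' {(a : ℝ)}
  have hA : ∀ a, MeasurableSet (A a) := fun a => k.measurableSet_preimage _
  have hind : iIndepFun (fun a : k.range => pointCount N X (A a)) P := by
    let e := k.range.equivFin
    have h1 := h.count_indep _ (fun j => A (e.symm j)) (fun j => hA _) (by
      intro i j hij
      refine Disjoint.preimage _ (Set.disjoint_singleton.2 fun hh => hij ?_)
      exact e.symm.injective (Subtype.ext hh))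
    have h2 := h1.precomp e.injective
    simpa using h2
  have hm : ∀ a, Measurable (pointCount N X (A a)) := fun a =>
    measurable_pointCount h.measurable_num h.measurable_pos (hA a)
  have hprod : ∀ ω, ∏ i ∈ Finset.range (N ω), k (X i ω)
      = ∏ a : k.range, (a : ℝ) ^ pointCount N X (A a) ω := by
    intro ω
    rw [Finset.prod_coe_sort k.range (fun a => a ^ pointCount N X (k ⁻¹' {a}) ω),
      ← Finset.prod_fiberwise_of_maps_to (t := k.range) (g := fun i => k (X i ω))
        fun i _ => k.mem_range_self _]
    refine Finset.prod_congr rfl fun a _ => ?_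
    rw [Finset.prod_congr rfl fun i hi => (Finset.mem_filter.1 hi).2, Finset.prod_const]
    congr 2
  simp_rw [hprod]
  rw [hind.integral_fun_prod_comp (f := fun (a : k.range) n => (a : ℝ) ^ n) (fun a => (hm a).aemeasurable)
    fun a => Measurable.of_discrete.aestronglyMeasurable]
  have hone : ∀ a : k.range, ∫ ω, (a : ℝ) ^ pointCount N X (A a) ω ∂P
      = Real.exp (-(Λ.real (A a) * (1 - a))) := by
    intro a
    rw [← integral_map (f := fun n : ℕ => (a : ℝ) ^ n) (hm a).aemeasurable
      Measurable.of_discrete.aestronglyMeasurable, h.count_law _ (hA a),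
      integral_pow_poissonMeasure]
    rfl
  simp_rw [hone]
  rw [← Real.exp_sum, Finset.sum_neg_distrib]
  congr 2
  rw [Finset.sum_coe_sort k.range (fun a => Λ.real (k ⁻¹' {a}) * (1 - a))]
  have hk : Integrable k Λ := SimpleFunc.integrable_of_isFiniteMeasure k
  have h1 : ∫ y, k y ∂Λ = ∑ a ∈ k.range, Λ.real (k ⁻¹' {a}) * a := by
    rw [← SimpleFunc.integral_eq_integral _ hk, SimpleFunc.integral_eq]
    rfl
  have h2 : ∑ a ∈ k.range, Λ.real (k ⁻¹' {a}) = Λ.real Set.univ := by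
    rw [sum_measureReal_preimage_singleton _ fun a _ => k.measurableSet_preimage _]
    congr 1
    exact Set.eq_univ_of_forall fun y => k.mem_range_self y
  rw [integral_sub (integrable_const _) hk, h1]
  simp [mul_sub, h2]

/-- The probability generating functional of a Poisson process. -/
theorem IsPoissonProcess.integral_prod [IsProbabilityMeasure P] [IsFiniteMeasure Λ]
    (h : IsPoissonProcess P N X Λ) {k : E3 → ℝ} (hk : Measurable k)
    (hk01 : ∀ y, k y ∈ Set.Icc (0 : ℝ) 1) :
    ∫ ω, ∏ i ∈ Finset.range (N ω), k (X i ω) ∂P = Real.exp (-∫ y, (1 - k y) ∂Λ) := by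
  have h0 : (0 : ℝ) ∈ Set.Icc (0 : ℝ) 1 := by simp
  let kn : ℕ → SimpleFunc E3 ℝ := SimpleFunc.approxOn k hk (Set.Icc 0 1) 0 h0
  have hmem : ∀ n y, kn n y ∈ Set.Icc (0 : ℝ) 1 := fun n y => SimpleFunc.approxOn_mem hk h0 n y
  have hlim : ∀ y, Filter.Tendsto (fun n => kn n y) Filter.atTop (nhds (k y)) := fun y =>
    SimpleFunc.tendsto_approxOn hk h0 (subset_closure (hk01 y))
  refine tendsto_nhds_unique (f := fun n => ∫ ω, ∏ i ∈ Finset.range (N ω), kn n (X i ω) ∂P)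
    (l := Filter.atTop) ?_ ?_
  · refine tendsto_integral_of_dominated_convergence (fun _ => 1)
      (fun n => (measurable_prod_range h.measurable_num fun i =>
        (kn n).measurable.comp (h.measurable_pos i)).aestronglyMeasurable)
      (integrable_const _) (fun n => .of_forall fun ω => ?_) (.of_forall fun ω => ?_)
    · rw [Real.norm_of_nonneg (Finset.prod_nonneg fun i _ => (hmem n _).1)]
      exact Finset.prod_le_one (fun i _ => (hmem n _).1) fun i _ => (hmem n _).2
    · exact tendsto_finsetProd _ fun i _ => hlim _
  · simp_rw [h.integral_prod_simpleFunc]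
    refine (Real.continuous_exp.tendsto _).comp (Filter.Tendsto.neg ?_)
    refine tendsto_integral_of_dominated_convergence (fun _ => 1)
      (fun n => (measurable_const.sub (kn n).measurable).aestronglyMeasurable)
      (integrable_const _) (fun n => .of_forall fun y => ?_) (.of_forall fun y => ?_)
    · rw [Real.norm_of_nonneg (sub_nonneg.2 (hmem n y).2)]
      linarith [(hmem n y).1]
    · exact tendsto_const_nhds.sub (hlim y)

end

/-! ### Areas of spherical caps -/

theorem volume_disc_lt {a : ℝ} (ha : 0 ≤ a) :
    volume {w : Fin 2 → ℝ | w 0 ^ 2 + w 1 ^ 2 < a} = ENNReal.ofReal (Real.pi * a) := by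
  have h : {w : Fin 2 → ℝ | w 0 ^ 2 + w 1 ^ 2 < a}
      = (WithLp.toLp 2) ⁻¹' Metric.ball (0 : EuclideanSpace ℝ (Fin 2)) (√a) := by
    ext w
    simp only [Set.mem_ofPred_eq, Set.mem_preimage, mem_ball_zero_iff, EuclideanSpace.norm_eq,
      Fin.sum_univ_two, Real.norm_eq_abs, sq_abs]
    rw [Real.sqrt_lt_sqrt_iff (by positivity)]
  rw [h, (PiLp.volume_preserving_toLp (Fin 2)).measure_preimage
    Metric.isOpen_ball.measurableSet.nullMeasurableSet, EuclideanSpace.volume_ball_fin_two,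
    ← ENNReal.ofReal_pow (Real.sqrt_nonneg a), Real.sq_sqrt ha, mul_comm Real.pi,
    ENNReal.ofReal_mul ha]

theorem volume_disc_le {a : ℝ} (ha : 0 ≤ a) :
    volume {w : Fin 2 → ℝ | w 0 ^ 2 + w 1 ^ 2 ≤ a} = ENNReal.ofReal (Real.pi * a) := by
  have h : {w : Fin 2 → ℝ | w 0 ^ 2 + w 1 ^ 2 ≤ a}
      = (WithLp.toLp 2) ⁻¹' Metric.closedBall (0 : EuclideanSpace ℝ (Fin 2)) (√a) := by
    ext w
    simp only [Set.mem_ofPred_eq, Set.mem_preimage, mem_closedBall_zero_iff,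
      EuclideanSpace.norm_eq, Fin.sum_univ_two, Real.norm_eq_abs, sq_abs]
    rw [Real.sqrt_le_sqrt_iff ha]
  rw [h, (PiLp.volume_preserving_toLp (Fin 2)).measure_preimage
    Metric.isClosed_closedBall.measurableSet.nullMeasurableSet,
    EuclideanSpace.volume_closedBall_fin_two,
    ← ENNReal.ofReal_pow (Real.sqrt_nonneg a), Real.sq_sqrt ha, mul_comm Real.pi,
    ENNReal.ofReal_mul ha]

/-- The part of the open unit ball in a circular cone about the third axis; `κ` is the cosine of
the opening half-angle. -/
def sector (κ : ℝ) : Set E3 := {x | 0 < ‖x‖ ∧ ‖x‖ < 1 ∧ κ * ‖x‖ ≤ x 2}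

theorem measurableSet_sector (κ : ℝ) : MeasurableSet (sector κ) := by
  refine (measurableSet_lt measurable_const measurable_norm).inter
    ((measurableSet_lt measurable_norm measurable_const).inter
      (measurableSet_le (measurable_norm.const_mul κ) ?_))
  fun_prop

/-- The slice of the sector at height `z`. -/
theorem volume_sector_slice {κ : ℝ} (h0 : 0 < κ) (h1 : κ ≤ 1) (z : ℝ) :
    volume {w : Fin 2 → ℝ | (WithLp.toLp 2 ((Fin.last 2).insertNth z w : Fin 3 → ℝ)) ∈ sector κ}
      = (Set.Ioc 0 κ).indicator
          (fun z => ENNReal.ofReal (Real.pi * (z ^ 2 * ((κ ^ 2)⁻¹ - 1)))) z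
        + (Set.Ioo κ 1).indicator (fun z => ENNReal.ofReal (Real.pi * (1 - z ^ 2))) z := by
  have hκ : 0 < κ ^ 2 := by positivity
  have key : ∀ w : Fin 2 → ℝ,
      (WithLp.toLp 2 ((Fin.last 2).insertNth z w : Fin 3 → ℝ)) ∈ sector κ ↔
        0 < z ∧ w 0 ^ 2 + w 1 ^ 2 < 1 - z ^ 2 ∧
          w 0 ^ 2 + w 1 ^ 2 ≤ z ^ 2 * ((κ ^ 2)⁻¹ - 1) := by
    intro w
    set x : E3 := WithLp.toLp 2 ((Fin.last 2).insertNth z w : Fin 3 → ℝ) with hx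
    have hx0 : x 0 = w 0 := rfl
    have hx1 : x 1 = w 1 := rfl
    have hx2 : x 2 = z := rfl
    have hn : ‖x‖ ^ 2 = w 0 ^ 2 + w 1 ^ 2 + z ^ 2 := by
      rw [EuclideanSpace.real_norm_sq_eq, Fin.sum_univ_three, hx0, hx1, hx2]
    have hnn := norm_nonneg x
    simp only [sector, Set.mem_ofPred_eq, hx2]
    have e2 : z ^ 2 * ((κ ^ 2)⁻¹ - 1) = z ^ 2 / κ ^ 2 - z ^ 2 := by
      rw [mul_sub, mul_one, div_eq_mul_inv]
    have e1 : ‖x‖ < 1 ↔ w 0 ^ 2 + w 1 ^ 2 < 1 - z ^ 2 := by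
      rw [← sq_lt_one_iff₀ hnn, hn]; constructor <;> intro h <;> linarith
    rw [e1, e2, le_sub_iff_add_le, ← hn, le_div_iff₀ hκ]
    constructor
    · rintro ⟨ha, hb, hc⟩
      have hz : 0 < z := lt_of_lt_of_le (by positivity) hc
      refine ⟨hz, hb, ?_⟩
      calc ‖x‖ ^ 2 * κ ^ 2 = (κ * ‖x‖) ^ 2 := by ring
        _ ≤ z ^ 2 := by gcongr
    · rintro ⟨ha, hb, hc⟩
      refine ⟨?_, hb, ?_⟩
      · refine lt_of_le_of_ne hnn fun h => ?_
        rw [← h] at hn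
        nlinarith [sq_nonneg (w 0), sq_nonneg (w 1)]
      · refine le_of_sq_le_sq ?_ ha.le
        calc (κ * ‖x‖) ^ 2 = ‖x‖ ^ 2 * κ ^ 2 := by ring
          _ ≤ z ^ 2 := hc
  simp_rw [key]
  rcases le_or_gt z 0 with hz | hz
  · have : {w : Fin 2 → ℝ | 0 < z ∧ w 0 ^ 2 + w 1 ^ 2 < 1 - z ^ 2 ∧
          w 0 ^ 2 + w 1 ^ 2 ≤ z ^ 2 * ((κ ^ 2)⁻¹ - 1)} = ∅ := by
      ext w; simp [hz.not_gt]
    rw [this, measure_empty, Set.indicator_of_notMem, Set.indicator_of_notMem, add_zero]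
    · exact fun h => absurd (h0.trans h.1) hz.not_gt
    · exact fun h => absurd h.1 hz.not_gt
  have hinv : 1 ≤ (κ ^ 2)⁻¹ := (one_le_inv₀ hκ).2 (pow_le_one₀ h0.le h1)
  have hsplit : z ^ 2 * ((κ ^ 2)⁻¹ - 1) < 1 - z ^ 2 ↔ z < κ := by
    rw [← pow_lt_pow_iff_left₀ hz.le h0.le two_ne_zero, mul_sub, mul_one, ← div_eq_mul_inv,
      sub_lt_sub_iff_right, div_lt_one hκ]
  rcases lt_trichotomy z κ with hzκ | hzκ | hzκ
  · have : {w : Fin 2 → ℝ | 0 < z ∧ w 0 ^ 2 + w 1 ^ 2 < 1 - z ^ 2 ∧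
          w 0 ^ 2 + w 1 ^ 2 ≤ z ^ 2 * ((κ ^ 2)⁻¹ - 1)}
          = {w | w 0 ^ 2 + w 1 ^ 2 ≤ z ^ 2 * ((κ ^ 2)⁻¹ - 1)} := by
      ext w
      have := hsplit.2 hzκ
      simp only [Set.mem_ofPred_eq, hz, true_and]
      exact ⟨fun h => h.2, fun h => ⟨by linarith, h⟩⟩
    rw [this, volume_disc_le (mul_nonneg (sq_nonneg _) (sub_nonneg.2 hinv)),
      Set.indicator_of_mem (Set.mem_Ioc.2 ⟨hz, hzκ.le⟩),
      Set.indicator_of_notMem fun h => absurd h.1 hzκ.not_gt, add_zero]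
  · have e : z ^ 2 * ((κ ^ 2)⁻¹ - 1) = 1 - z ^ 2 := by
      rw [hzκ, mul_sub, mul_inv_cancel₀ hκ.ne', mul_one]
    have : {w : Fin 2 → ℝ | 0 < z ∧ w 0 ^ 2 + w 1 ^ 2 < 1 - z ^ 2 ∧
          w 0 ^ 2 + w 1 ^ 2 ≤ z ^ 2 * ((κ ^ 2)⁻¹ - 1)}
          = {w | w 0 ^ 2 + w 1 ^ 2 < z ^ 2 * ((κ ^ 2)⁻¹ - 1)} := by
      ext w
      simp only [Set.mem_ofPred_eq, hz, true_and, e]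
      exact ⟨fun h => h.1, fun h => ⟨h, h.le⟩⟩
    rw [this, volume_disc_lt (mul_nonneg (sq_nonneg _) (sub_nonneg.2 hinv)),
      Set.indicator_of_mem (Set.mem_Ioc.2 ⟨hz, hzκ.le⟩),
      Set.indicator_of_notMem fun h => absurd h.1 hzκ.not_gt, add_zero]
  · have hge : 1 - z ^ 2 ≤ z ^ 2 * ((κ ^ 2)⁻¹ - 1) := by
      rw [← not_lt, hsplit]; exact hzκ.not_gt
    have : {w : Fin 2 → ℝ | 0 < z ∧ w 0 ^ 2 + w 1 ^ 2 < 1 - z ^ 2 ∧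
          w 0 ^ 2 + w 1 ^ 2 ≤ z ^ 2 * ((κ ^ 2)⁻¹ - 1)}
          = {w | w 0 ^ 2 + w 1 ^ 2 < 1 - z ^ 2} := by
      ext w
      simp only [Set.mem_ofPred_eq, hz, true_and]
      exact ⟨fun h => h.1, fun h => ⟨h, by linarith⟩⟩
    rw [this, Set.indicator_of_notMem fun h => absurd h.2 hzκ.not_ge, zero_add]
    rcases lt_or_ge z 1 with hz1 | hz1
    · rw [Set.indicator_of_mem (Set.mem_Ioo.2 ⟨hzκ, hz1⟩), volume_disc_lt]
      nlinarith
    · rw [Set.indicator_of_notMem fun h => absurd h.2 hz1.not_gt]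
      convert measure_empty (μ := (volume : Measure (Fin 2 → ℝ)))
      ext w
      simp only [Set.mem_ofPred_eq, Set.mem_empty_iff_false, iff_false, not_lt]
      nlinarith [sq_nonneg (w 0), sq_nonneg (w 1)]

/-- Slicing gives a cone up to height `κ` and a cap of the ball above it. -/
theorem volume_sector {κ : ℝ} (h0 : 0 < κ) (h1 : κ ≤ 1) :
    volume (sector κ) = ENNReal.ofReal (2 * Real.pi / 3 * (1 - κ)) := by
  have hm := measurableSet_sector κ
  have hinv : 1 ≤ (κ ^ 2)⁻¹ := (one_le_inv₀ (by positivity)).2 (pow_le_one₀ h0.le h1)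
  have hm' : MeasurableSet ((WithLp.toLp 2 : (Fin 3 → ℝ) → E3) ⁻¹' sector κ) :=
    (PiLp.volume_preserving_toLp (Fin 3)).measurable hm
  have hmp := (volume_preserving_piFinSuccAbove (fun _ : Fin 3 => ℝ) (Fin.last 2)).symm
  rw [← (PiLp.volume_preserving_toLp (Fin 3)).measure_preimage hm.nullMeasurableSet,
    ← hmp.measure_preimage hm'.nullMeasurableSet, Measure.volume_eq_prod,
    Measure.prod_apply (hmp.measurable hm')]
  have hslice : ∀ z : ℝ, volume (Prod.mk z ⁻¹'
      ((MeasurableEquiv.piFinSuccAbove (fun _ : Fin 3 => ℝ) (Fin.last 2)).symm ⁻¹'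
        ((WithLp.toLp 2 : (Fin 3 → ℝ) → E3) ⁻¹' sector κ))) = _ :=
    fun z => volume_sector_slice h0 h1 z
  rw [lintegral_congr hslice, lintegral_add_left, lintegral_indicator measurableSet_Ioc,
    lintegral_indicator measurableSet_Ioo, restrict_Ioo_eq_restrict_Ioc]
  · rw [← ofReal_integral_eq_lintegral_ofReal, ← ofReal_integral_eq_lintegral_ofReal,
      ← intervalIntegral.integral_of_le h0.le, ← intervalIntegral.integral_of_le h1,
      ← ENNReal.ofReal_add]
    · congr 1
      simp
      field_simp
      ring
    · refine intervalIntegral.integral_nonneg h0.le fun z _ => ?_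
      exact mul_nonneg Real.pi_pos.le (mul_nonneg (sq_nonneg _) (sub_nonneg.2 hinv))
    · refine intervalIntegral.integral_nonneg h1 fun z hz => ?_
      have := hz.1; have := hz.2
      exact mul_nonneg Real.pi_pos.le (by nlinarith)
    · exact (Continuous.integrableOn_Icc (by fun_prop)).mono_set Set.Ioc_subset_Icc_self
    · refine (ae_restrict_iff' measurableSet_Ioc).2 (.of_forall fun z hz => ?_)
      have := hz.1; have := hz.2
      exact mul_nonneg Real.pi_pos.le (by nlinarith)
    · exact (Continuous.integrableOn_Icc (by fun_prop)).mono_set Set.Ioc_subset_Icc_self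
    · exact .of_forall fun z =>
        mul_nonneg Real.pi_pos.le (mul_nonneg (sq_nonneg _) (sub_nonneg.2 hinv))
  · exact Measurable.indicator (by fun_prop) measurableSet_Ioc

open scoped Pointwise in
/-- Archimedes' hat-box theorem for caps inside a hemisphere. -/
theorem toSphere_cap {κ : ℝ} (h0 : 0 < κ) (h1 : κ ≤ 1) :
    (volume : Measure E3).toSphere {u | κ ≤ (u : E3) 2}
      = ENNReal.ofReal (2 * Real.pi * (1 - κ)) := by
  have hm : MeasurableSet {u : Metric.sphere (0 : E3) 1 | κ ≤ (u : E3) 2} := by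
    refine measurableSet_le measurable_const ?_
    fun_prop
  have himg : Set.Ioo (0 : ℝ) 1 • (Subtype.val '' {u : Metric.sphere (0 : E3) 1 | κ ≤ (u : E3) 2})
      = sector κ := by
    ext x
    rw [Set.mem_smul]
    constructor
    · rintro ⟨t, ht, _, ⟨u, hu, rfl⟩, rfl⟩
      have hun : ‖(u : E3)‖ = 1 := mem_sphere_zero_iff_norm.1 u.2
      have hn : ‖t • (u : E3)‖ = t := by rw [norm_smul, hun, Real.norm_of_nonneg ht.1.le, mul_one]
      refine ⟨ht.1.trans_eq hn.symm, hn.trans_lt ht.2, ?_⟩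
      rw [hn, mul_comm]
      exact mul_le_mul_of_nonneg_left hu ht.1.le
    · rintro ⟨ha, hb, hc⟩
      refine ⟨‖x‖, ⟨ha, hb⟩, ‖x‖⁻¹ • x, ⟨⟨‖x‖⁻¹ • x, ?_⟩, ?_, rfl⟩, ?_⟩
      · rw [mem_sphere_zero_iff_norm, norm_smul, norm_inv, norm_norm, inv_mul_cancel₀ ha.ne']
      · change κ ≤ ‖x‖⁻¹ * x 2
        rwa [← div_eq_inv_mul, le_div_iff₀ ha]
      · rw [smul_smul, mul_inv_cancel₀ ha.ne', one_smul]
  rw [Measure.toSphere_apply' _ hm, himg, volume_sector h0 h1, finrank_euclideanSpace,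
    Fintype.card_fin, ← ENNReal.ofReal_natCast, ← ENNReal.ofReal_mul (by positivity)]
  congr 1
  push_cast
  ring

/-! ### Geometry of the visible caps -/

section Geometry
variable {p : Params} {o : Node} {y : E3}

theorem Params.Valid.Rs_pos (hp : p.Valid) : 0 < p.Rs :=
  (hp.radius_pos .satUser).trans (hp.radius_lt .satUser)

theorem Params.Valid.rMin_pos (hp : p.Valid) (o : Node) : 0 < p.rMin o :=
  sub_pos.2 (hp.radius_lt o)

theorem Params.Valid.sin_pos (hp : p.Valid) : 0 < Real.sin p.theta :=
  Real.sin_pos_of_pos_of_lt_pi hp.theta_pos (by linarith [hp.theta_lt, Real.pi_pos])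

theorem Params.Valid.cos_pos (hp : p.Valid) : 0 < Real.cos p.theta :=
  Real.cos_pos_of_mem_Ioo ⟨by linarith [hp.theta_pos, Real.pi_pos], hp.theta_lt⟩

/-- Half the chord that the bounding rays of the visible cone cut out of a transmitter sphere. -/
noncomputable def Params.halfChord (p : Params) (o : Node) : ℝ :=
  √(p.radius o ^ 2 - p.Rs ^ 2 * Real.sin p.theta ^ 2)

theorem Params.halfChord_nonneg (p : Params) (o : Node) : 0 ≤ p.halfChord o := Real.sqrt_nonneg _

theorem Params.Valid.halfChord_sq (hp : p.Valid) (o : Node) :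
    p.halfChord o ^ 2 = p.radius o ^ 2 - p.Rs ^ 2 * Real.sin p.theta ^ 2 := by
  refine Real.sq_sqrt (sub_nonneg.2 ?_)
  rw [← mul_pow]
  exact pow_le_pow_left₀ (mul_pos hp.Rs_pos hp.sin_pos).le (hp.cone_meets o) 2

theorem Params.rMax_eq (p : Params) (o : Node) :
    p.rMax o = p.Rs * Real.cos p.theta - p.halfChord o := rfl

/-- The tangent-secant theorem: the two intersection distances of a bounding ray with the sphere
multiply to the power of the satellite's position. -/
theorem Params.Valid.rMax_mul (hp : p.Valid) (o : Node) :
    p.rMax o * (p.rMax o + 2 * p.halfChord o) = p.Rs ^ 2 - p.radius o ^ 2 := by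
  have h := hp.halfChord_sq o
  have := Real.sin_sq_add_cos_sq p.theta
  rw [p.rMax_eq]
  have e : p.Rs ^ 2 * Real.sin p.theta ^ 2 = p.Rs ^ 2 - p.Rs ^ 2 * Real.cos p.theta ^ 2 := by
    rw [← mul_one_sub, ← this]; ring
  linear_combination -h + e

theorem Params.Valid.rMin_lt_rMax (hp : p.Valid) (o : Node) : p.rMin o < p.rMax o := by
  have hR := hp.radius_pos o
  have hlt := hp.radius_lt o
  have hs := hp.Rs_pos
  have hc1 : Real.cos p.theta < 1 := by
    have := Real.sin_sq_add_cos_sq p.theta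
    nlinarith [hp.sin_pos, hp.cos_pos]
  have hq := p.halfChord_nonneg o
  have hmul := hp.rMax_mul o
  have hsum : p.rMax o + p.halfChord o = p.Rs * Real.cos p.theta := by rw [p.rMax_eq]; ring
  by_contra hle
  rw [not_lt, Params.rMin] at hle
  have hpos : 0 < p.Rs ^ 2 - p.radius o ^ 2 := by nlinarith
  have hmax : 0 < p.rMax o := by
    by_contra hneg
    nlinarith [mul_pos hs hp.cos_pos]
  have h2 : p.Rs + p.radius o ≤ p.rMax o + 2 * p.halfChord o := by
    by_contra hlt'
    nlinarith
  nlinarith [mul_pos hs (sub_pos.2 hc1)]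

theorem Params.Valid.rMax_pos (hp : p.Valid) (o : Node) : 0 < p.rMax o :=
  (hp.rMin_pos o).trans (hp.rMin_lt_rMax o)

theorem Params.Valid.norm_sat (hp : p.Valid) : ‖p.sat‖ = p.Rs := by
  rw [← sq_eq_sq₀ (norm_nonneg _) hp.Rs_pos.le, EuclideanSpace.real_norm_sq_eq,
    Fin.sum_univ_three]
  simp [Params.sat]

theorem norm_sub_sat_sq (hp : p.Valid) (hy : ‖y‖ = p.radius o) :
    ‖y - p.sat‖ ^ 2 = p.radius o ^ 2 + p.Rs ^ 2 - 2 * inner ℝ y p.sat := by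
  rw [norm_sub_sq_real, hy, hp.norm_sat]; ring

theorem rMin_le_norm_sub_sat (hp : p.Valid) (hy : ‖y‖ = p.radius o) :
    p.rMin o ≤ ‖y - p.sat‖ := by
  have := norm_sub_norm_le p.sat y
  rwa [hp.norm_sat, hy, norm_sub_rev] at this

theorem cos_nadirAngle (hp : p.Valid) (hy : ‖y‖ = p.radius o) :
    Real.cos (InnerProductGeometry.angle (y - p.sat) (-p.sat)) =
      (p.Rs ^ 2 + ‖y - p.sat‖ ^ 2 - p.radius o ^ 2) / (2 * ‖y - p.sat‖ * p.Rs) := by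
  have hd := (hp.rMin_pos o).trans_le (rMin_le_norm_sub_sat hp hy)
  have hs := hp.Rs_pos
  rw [InnerProductGeometry.cos_angle, norm_neg, hp.norm_sat, inner_neg_right, inner_sub_left,
    real_inner_self_eq_norm_sq, hp.norm_sat, div_eq_div_iff (by positivity) (by positivity),
    norm_sub_sat_sq hp hy]
  ring

theorem sin_elevation (hp : p.Valid) (hy : ‖y‖ = p.radius o) :
    Real.sin (elevation y p.sat) =
      (p.Rs ^ 2 - p.radius o ^ 2 - ‖y - p.sat‖ ^ 2) / (2 * p.radius o * ‖y - p.sat‖) := by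
  have hd := (hp.rMin_pos o).trans_le (rMin_le_norm_sub_sat hp hy)
  have hR := hp.radius_pos o
  rw [elevation, Real.sin_pi_div_two_sub, InnerProductGeometry.cos_angle, inner_sub_right,
    real_inner_self_eq_norm_sq, norm_sub_rev p.sat y, hy,
    div_eq_div_iff (by positivity) (by positivity), norm_sub_sat_sq hp hy]
  ring

theorem elevation_mem (y x : E3) : elevation y x ∈ Set.Icc (-(Real.pi / 2)) (Real.pi / 2) := by
  have h1 := InnerProductGeometry.angle_nonneg y (x - y)
  have h2 := InnerProductGeometry.angle_le_pi y (x - y)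
  constructor <;> simp only [elevation] <;> linarith

/-- The visible cap consists of the points of the sphere at distance at most `rMax`. Those within
the visible cone lie before the first or beyond the second intersection of a bounding ray with the
sphere, and the elevation condition excludes the latter. -/
theorem mem_cap_iff (hp : p.Valid) :
    y ∈ p.cap o ↔ ‖y‖ = p.radius o ∧ ‖y - p.sat‖ ≤ p.rMax o := by
  simp only [Params.cap, Set.mem_ofPred_eq, mem_sphere_zero_iff_norm]
  refine and_congr_right fun hy => ?_
  have hd := (hp.rMin_pos o).trans_le (rMin_le_norm_sub_sat hp hy)
  set d := ‖y - p.sat‖ with hd_def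
  have hR := hp.radius_pos o
  have hs := hp.Rs_pos
  have hq := p.halfChord_nonneg o
  have hmul := hp.rMax_mul o
  have hsum : p.Rs * Real.cos p.theta = p.rMax o + p.halfChord o := by rw [p.rMax_eq]; ring
  have hel : 0 ≤ elevation y p.sat ↔ d ^ 2 ≤ p.Rs ^ 2 - p.radius o ^ 2 := by
    rw [← Real.strictMonoOn_sin.le_iff_le ⟨by linarith [Real.pi_pos], by linarith [Real.pi_pos]⟩
      (elevation_mem _ _), Real.sin_zero, sin_elevation hp hy, ← hd_def,
      le_div_iff₀ (by positivity), zero_mul, sub_nonneg]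
  have hang : InnerProductGeometry.angle (y - p.sat) (-p.sat) ≤ p.theta ↔
      p.halfChord o ^ 2 ≤ (d - p.Rs * Real.cos p.theta) ^ 2 := by
    rw [← Real.strictAntiOn_cos.le_iff_ge (a := p.theta)
      ⟨hp.theta_pos.le, by linarith [hp.theta_lt, Real.pi_pos]⟩
      ⟨InnerProductGeometry.angle_nonneg _ _, InnerProductGeometry.angle_le_pi _ _⟩,
      cos_nadirAngle hp hy, ← hd_def, le_div_iff₀ (by positivity), hsum]
    have e : Real.cos p.theta * (2 * d * p.Rs) = 2 * d * (p.rMax o + p.halfChord o) := by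
      rw [← hsum]; ring
    rw [e]
    constructor <;> intro h <;> nlinarith
  rw [hel, hang, hsum]
  constructor
  · rintro ⟨h1, h2⟩
    by_contra hlt
    rw [not_le] at hlt
    rcases le_or_gt (p.rMax o + 2 * p.halfChord o) d with h3 | h3
    · nlinarith [hp.rMax_pos o]
    · nlinarith
  · intro h
    constructor
    · nlinarith [hp.rMax_pos o]
    · nlinarith

theorem measurableSet_cap (hp : p.Valid) (o : Node) : MeasurableSet (p.cap o) := by
  have : p.cap o = {y | ‖y‖ = p.radius o} ∩ {y | ‖y - p.sat‖ ≤ p.rMax o} := by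
    ext y; exact mem_cap_iff hp
  rw [this]
  exact (measurableSet_eq_fun measurable_norm measurable_const).inter
    (measurableSet_le (by fun_prop) measurable_const)

theorem dist_mem_of_mem_cap (hp : p.Valid) (hy : y ∈ p.cap o) :
    ‖y - p.sat‖ ∈ Set.Icc (p.rMin o) (p.rMax o) :=
  ⟨rMin_le_norm_sub_sat hp ((mem_cap_iff hp).1 hy).1, ((mem_cap_iff hp).1 hy).2⟩

/-! ### Elevations of the visible base stations -/

theorem Params.Valid.psi2_nonneg (hp : p.Valid) : 0 ≤ p.psi2 :=
  (Real.arccos_nonneg _).trans hp.le_psi2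

/-- The sine of the elevation at which the rim of the visible cap sees the satellite. -/
theorem Params.Valid.sin_coneElevation (hp : p.Valid) :
    p.radius .bs * Real.sin (Real.arccos (p.Rs / p.radius .bs * Real.sin p.theta)) =
      p.halfChord .bs := by
  have hR := hp.radius_pos .bs
  rw [Real.sin_arccos, Params.halfChord, ← Real.sqrt_sq hR.le, ← Real.sqrt_mul (sq_nonneg _),
    Real.sqrt_sq hR.le]
  congr 1
  field_simp

theorem Params.Valid.halfChord_le_sin_psi2 (hp : p.Valid) :
    p.halfChord .bs ≤ p.radius .bs * Real.sin p.psi2 := by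
  rw [← hp.sin_coneElevation]
  refine mul_le_mul_of_nonneg_left ?_ (hp.radius_pos .bs).le
  refine Real.sin_le_sin_of_le_of_le_pi_div_two ?_ hp.psi2_le hp.le_psi2
  linarith [Real.arccos_nonneg (p.Rs / p.radius .bs * Real.sin p.theta), Real.pi_pos]

theorem Params.rPsi_arg (p : Params) :
    p.Rs ^ 2 - p.radius .bs ^ 2 * Real.cos p.psi2 ^ 2 =
      p.Rs ^ 2 - p.radius .bs ^ 2 + (p.radius .bs * Real.sin p.psi2) ^ 2 := by
  rw [Real.cos_sq']; ring

theorem Params.Valid.sin_psi2_nonneg (hp : p.Valid) : 0 ≤ p.radius .bs * Real.sin p.psi2 :=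
  (p.halfChord_nonneg _).trans hp.halfChord_le_sin_psi2

theorem Params.Valid.rMin_le_rPsi (hp : p.Valid) : p.rMin .bs ≤ p.rPsi := by
  have hR := hp.radius_pos .bs
  have hlt := hp.radius_lt .bs
  have h1 := Real.sin_le_one p.psi2
  have h0 := hp.sin_psi2_nonneg
  rw [Params.rMin, Params.rPsi, le_sub_iff_add_le, p.rPsi_arg]
  refine Real.le_sqrt_of_sq_le ?_
  nlinarith [mul_nonneg (sub_pos.2 hlt).le (mul_nonneg hR.le (sub_nonneg.2 h1))]

theorem Params.Valid.rPsi_le_rMax (hp : p.Valid) : p.rPsi ≤ p.rMax .bs := by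
  have h0 := hp.sin_psi2_nonneg
  have hm := hp.rMax_pos .bs
  have hmul := hp.rMax_mul .bs
  have hle := hp.halfChord_le_sin_psi2
  rw [Params.rPsi, sub_le_iff_le_add, p.rPsi_arg]
  refine Real.sqrt_le_iff.2 ⟨by positivity, ?_⟩
  nlinarith

theorem elevation_le_psi2_iff (hp : p.Valid) (hy : y ∈ p.cap .bs) :
    elevation y p.sat ≤ p.psi2 ↔ p.rPsi ≤ ‖y - p.sat‖ := by
  have hyn := ((mem_cap_iff hp).1 hy).1
  have hd := (hp.rMin_pos .bs).trans_le (rMin_le_norm_sub_sat hp hyn)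
  have hR := hp.radius_pos .bs
  have h0 := hp.sin_psi2_nonneg
  rw [← Real.strictMonoOn_sin.le_iff_le (elevation_mem _ _)
    ⟨by linarith [hp.psi2_nonneg, Real.pi_pos], hp.psi2_le⟩, sin_elevation hp hyn,
    div_le_iff₀ (by positivity), Params.rPsi,
    sub_le_iff_le_add (c := p.radius .bs * Real.sin p.psi2), Real.sqrt_le_left (by positivity),
    p.rPsi_arg]
  constructor <;> intro h <;> nlinarith

/-- Elevations in the visible cap are smallest at its rim. -/
theorem psi1_lt_elevation (hp : p.Valid) (hy : y ∈ p.cap .bs) : p.psi1 < elevation y p.sat := by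
  refine hp.psi1_lt.trans_le ?_
  obtain ⟨hyn, hmax⟩ := (mem_cap_iff hp).1 hy
  have hd := (hp.rMin_pos .bs).trans_le (rMin_le_norm_sub_sat hp hyn)
  have hR := hp.radius_pos .bs
  have hs := hp.Rs_pos
  have hq := p.halfChord_nonneg .bs
  have hmul := hp.rMax_mul .bs
  have harc : Real.arccos (p.Rs / p.radius .bs * Real.sin p.theta) ≤ Real.pi / 2 :=
    Real.arccos_le_pi_div_two.2 (mul_nonneg (by positivity) hp.sin_pos.le)
  have harc0 := Real.arccos_nonneg (p.Rs / p.radius .bs * Real.sin p.theta)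
  rw [← Real.strictMonoOn_sin.le_iff_le ⟨by linarith [Real.pi_pos], harc⟩ (elevation_mem _ _),
    sin_elevation hp hyn, le_div_iff₀ (by positivity)]
  have e := hp.sin_coneElevation
  calc Real.sin (Real.arccos (p.Rs / p.radius .bs * Real.sin p.theta)) *
        (2 * p.radius .bs * ‖y - p.sat‖) = 2 * p.halfChord .bs * ‖y - p.sat‖ := by rw [← e]; ring
    _ ≤ _ := by nlinarith

/-- Visible base stations are seen through a side lobe, whose level depends on the distance. -/
theorem bsGain_of_mem_cap (hp : p.Valid) (hy : y ∈ p.cap .bs) :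
    p.bsGain (elevation y p.sat) = if ‖y - p.sat‖ < p.rPsi then p.gBsLow else p.gBsHigh := by
  rw [Params.bsGain, if_neg (psi1_lt_elevation hp hy).not_ge]
  by_cases h : p.rPsi ≤ ‖y - p.sat‖
  · rw [if_pos ((elevation_le_psi2_iff hp hy).2 h), if_neg h.not_gt]
  · rw [if_neg (mt (elevation_le_psi2_iff hp hy).1 h), if_pos (not_le.1 h)]

end Geometry

/-! ### The image of the transmitter intensity under the distance to the satellite -/

/-- A finite measure on `[a, b]` with a continuously differentiable distribution function. -/
theorem eq_withDensity_of_Iic {μ : Measure ℝ} [IsFiniteMeasure μ] {a b : ℝ} (hab : a ≤ b)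
    {F f : ℝ → ℝ} (hF : ∀ x ∈ Set.Icc a b, HasDerivAt F (f x) x)
    (hf : ContinuousOn f (Set.Icc a b)) (hf0 : ∀ x ∈ Set.Icc a b, 0 ≤ f x)
    (hμ : ∀ r ∈ Set.Icc a b, μ (Set.Iic r) = ENNReal.ofReal (F r - F a))
    (hout : μ (Set.Icc a b)ᶜ = 0) :
    μ = (volume.restrict (Set.Icc a b)).withDensity (fun x => ENNReal.ofReal (f x)) := by
  have hval : ∀ r ∈ Set.Icc a b,
      ∫⁻ x in Set.Icc a r, ENNReal.ofReal (f x) = ENNReal.ofReal (F r - F a) := by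
    intro r hr
    have hsub : Set.Icc a r ⊆ Set.Icc a b := Set.Icc_subset_Icc_right hr.2
    rw [← ofReal_integral_eq_lintegral_ofReal (hf.mono hsub).integrableOn_Icc
      ((ae_restrict_iff' measurableSet_Icc).2 (.of_forall fun x hx => hf0 x (hsub hx))),
      integral_Icc_eq_integral_Ioc, ← intervalIntegral.integral_of_le hr.1,
      intervalIntegral.integral_eq_sub_of_hasDerivAt]
    · rw [Set.uIcc_of_le hr.1]
      exact fun x hx => hF x (hsub hx)
    · refine ContinuousOn.intervalIntegrable ?_
      rw [Set.uIcc_of_le hr.1]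
      exact hf.mono hsub
  refine Measure.ext_of_Iic _ _ fun r => ?_
  rw [withDensity_apply _ measurableSet_Iic, Measure.restrict_restrict measurableSet_Iic]
  rcases lt_or_ge r a with hra | hra
  · have : Set.Iic r ∩ Set.Icc a b = ∅ := by
      ext x; simp only [Set.mem_inter_iff, Set.mem_Iic, Set.mem_Icc, Set.mem_empty_iff_false,
        iff_false]; rintro ⟨h1, h2, -⟩; linarith
    rw [this, Measure.restrict_empty, lintegral_zero_measure]
    refine measure_mono_null (s := Set.Iic r) (fun x hx => ?_) hout
    exact fun hx' => absurd (hx'.1.trans hx) hra.not_ge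
  · rcases le_or_gt r b with hrb | hrb
    · have : Set.Iic r ∩ Set.Icc a b = Set.Icc a r := by
        ext x; simp only [Set.mem_inter_iff, Set.mem_Iic, Set.mem_Icc]
        exact ⟨fun h => ⟨h.2.1, h.1⟩, fun h => ⟨h.2, h.1, h.2.trans hrb⟩⟩
      rw [this, hμ r ⟨hra, hrb⟩, hval r ⟨hra, hrb⟩]
    · have : Set.Iic r ∩ Set.Icc a b = Set.Icc a b :=
        Set.inter_eq_right.2 fun x hx => hx.2.trans hrb.le
      rw [this, hval b ⟨hab, le_rfl⟩, ← hμ b ⟨hab, le_rfl⟩]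
      refine le_antisymm ?_ (measure_mono (Set.Iic_subset_Iic.2 hrb.le))
      refine (measure_mono (t := Set.Iic b ∪ (Set.Icc a b)ᶜ) fun x _ => ?_).trans
        ((measure_union_le _ _).trans_eq (by rw [hout, add_zero]))
      rcases le_or_gt x b with h | h
      · exact Or.inl h
      · exact Or.inr fun h' => absurd h'.2 h.not_ge

/-- Intensity measure of the transmitters of type `o`. -/
noncomputable def Params.intensity (p : Params) (o : Node) : Measure E3 :=
  ENNReal.ofReal (p.density o) • sphereArea (p.radius o)

theorem measurable_smul_coe (R : ℝ) :
    Measurable fun u : Metric.sphere (0 : E3) 1 => R • (u : E3) :=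
  measurable_subtype_coe.const_smul R

instance (R : ℝ) : IsFiniteMeasure (sphereArea R) := by
  unfold sphereArea
  exact Measure.smul_finite _ ENNReal.ofReal_ne_top

instance (p : Params) (o : Node) : IsFiniteMeasure (p.intensity o) := by
  unfold Params.intensity
  exact Measure.smul_finite _ ENNReal.ofReal_ne_top

section
variable {p : Params}

theorem Params.Valid.planarDensity_pos (hp : p.Valid) (o : Node) : 0 < p.planarDensity o :=
  mul_pos (hp.density_pos o) (div_pos (hp.radius_pos o) hp.Rs_pos)

theorem measurable_norm_sub_sat (p : Params) : Measurable fun y : E3 => ‖y - p.sat‖ := by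
  fun_prop

/-- The points of the cap within distance `r` form a cap themselves, whose area is proportional to
`r ^ 2 - rMin ^ 2`. -/
theorem intensity_dist_le (hp : p.Valid) {o : Node} {r : ℝ}
    (hr : r ∈ Set.Icc (p.rMin o) (p.rMax o)) :
    p.intensity o {y | y ∈ p.cap o ∧ ‖y - p.sat‖ ≤ r} =
      ENNReal.ofReal (Real.pi * p.planarDensity o * (r ^ 2 - p.rMin o ^ 2)) := by
  have hR := hp.radius_pos o
  have hs := hp.Rs_pos
  have hlt := hp.radius_lt o
  have hr0 := (hp.rMin_pos o).trans_le hr.1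
  have hm : MeasurableSet {y | y ∈ p.cap o ∧ ‖y - p.sat‖ ≤ r} :=
    (measurableSet_cap hp o).inter (measurableSet_le (measurable_norm_sub_sat p) measurable_const)
  -- the law of cosines: `κ` is the cosine of the polar angle of the points at distance `r`
  set κ := (p.radius o ^ 2 + p.Rs ^ 2 - r ^ 2) / (2 * p.radius o * p.Rs) with hκ
  have hpre : (fun u : Metric.sphere (0 : E3) 1 => p.radius o • (u : E3)) ⁻¹'
      {y | y ∈ p.cap o ∧ ‖y - p.sat‖ ≤ r} = {u : Metric.sphere (0 : E3) 1 | κ ≤ (u : E3) 2} := by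
    ext u
    have hu : ‖p.radius o • (u : E3)‖ = p.radius o := by
      rw [norm_smul, mem_sphere_zero_iff_norm.1 u.2, mul_one, Real.norm_of_nonneg hR.le]
    have hin : inner ℝ (p.radius o • (u : E3)) p.sat = p.radius o * p.Rs * (u : E3) 2 := by
      rw [real_inner_smul_left, PiLp.inner_apply, Fin.sum_univ_three]
      simp [Params.sat]
      ring
    simp only [Set.mem_preimage, Set.mem_ofPred_eq, mem_cap_iff hp, hu, true_and]
    rw [and_iff_right_of_imp fun h : ‖p.radius o • (u : E3) - p.sat‖ ≤ r => h.trans hr.2,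
      ← sq_le_sq₀ (norm_nonneg _) hr0.le,
      norm_sub_sat_sq hp hu, hin, hκ, div_le_iff₀ (by positivity)]
    constructor <;> intro h <;> linarith
  -- the visible cap lies inside a hemisphere
  have h0 : 0 < κ := by
    refine div_pos ?_ (by positivity)
    have := hp.rMax_mul o
    nlinarith [p.halfChord_nonneg o, hp.rMax_pos o, mul_self_le_mul_self hr0.le hr.2]
  have hrm : p.rMin o ^ 2 ≤ r ^ 2 := pow_le_pow_left₀ (hp.rMin_pos o).le hr.1 2
  have h1 : κ ≤ 1 := by
    rw [hκ, div_le_one (by positivity)]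
    simp only [Params.rMin] at hrm
    nlinarith
  rw [Params.intensity, Measure.smul_apply, sphereArea, Measure.smul_apply,
    Measure.map_apply (measurable_smul_coe _) hm, hpre, toSphere_cap h0 h1, smul_eq_mul,
    smul_eq_mul, ← ENNReal.ofReal_mul (by positivity),
    ← ENNReal.ofReal_mul (hp.density_pos o).le]
  congr 1
  rw [Params.planarDensity, Params.rMin, hκ]
  field_simp
  ring

theorem map_dist_intensity (hp : p.Valid) (o : Node) :
    ((p.intensity o).restrict (p.cap o)).map (fun y => ‖y - p.sat‖) =
      (volume.restrict (Set.Icc (p.rMin o) (p.rMax o))).withDensity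
        (fun v => ENNReal.ofReal (2 * Real.pi * p.planarDensity o * v)) := by
  have hl := hp.planarDensity_pos o
  have hmd := measurable_norm_sub_sat p
  refine eq_withDensity_of_Iic (hp.rMin_lt_rMax o).le
    (F := fun v => Real.pi * p.planarDensity o * v ^ 2) (fun v _ => ?_) (by fun_prop)
    (fun v hv => ?_) (fun r hr => ?_) ?_
  · have := (hasDerivAt_pow 2 v).const_mul (Real.pi * p.planarDensity o)
    convert! this using 1
    norm_num
    ring
  · have := (hp.rMin_pos o).le.trans hv.1
    positivity
  · rw [Measure.map_apply hmd measurableSet_Iic,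
      Measure.restrict_apply (hmd measurableSet_Iic), ← mul_sub, ← intensity_dist_le hp hr]
    congr 1
    ext y
    exact and_comm
  · rw [Measure.map_apply hmd measurableSet_Icc.compl,
      Measure.restrict_apply (hmd measurableSet_Icc.compl)]
    convert measure_empty (μ := p.intensity o)
    ext y
    simp only [Set.mem_inter_iff, Set.mem_preimage, Set.mem_compl_iff, Set.mem_empty_iff_false,
      iff_false, not_and]
    intro h1 h2
    exact h1 (dist_mem_of_mem_cap hp h2)

theorem setIntegral_cap_radial (hp : p.Valid) (o : Node) {g : ℝ → ℝ} (hg : Measurable g) :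
    ∫ y in p.cap o, g ‖y - p.sat‖ ∂(p.intensity o) =
      2 * Real.pi * p.planarDensity o * ∫ v in (p.rMin o)..(p.rMax o), g v * v := by
  have hl := hp.planarDensity_pos o
  rw [← integral_map (measurable_norm_sub_sat p).aemeasurable hg.aestronglyMeasurable,
    map_dist_intensity hp o, integral_withDensity_eq_integral_toReal_smul (by fun_prop)
      (.of_forall fun _ => ENNReal.ofReal_lt_top), integral_Icc_eq_integral_Ioc,
    ← intervalIntegral.integral_of_le (hp.rMin_lt_rMax o).le,
    ← intervalIntegral.integral_const_mul]
  refine intervalIntegral.integral_congr fun v hv => ?_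
  rw [Set.uIcc_of_le (hp.rMin_lt_rMax o).le] at hv
  have := (hp.rMin_pos o).le.trans hv.1
  simp only [smul_eq_mul]
  rw [ENNReal.toReal_ofReal (by positivity)]
  ring

end

/-! ### Shadowed-Rician fading powers -/

/-- Kummer's transformation for integer parameters: `₁F₁(k + 1; 1; x)` is `exp x` times a
polynomial of degree `k`. The coefficients agree by Vandermonde's identity. -/
theorem kummer_succ_one (k : ℕ) (x : ℝ) :
    kummer ((k + 1 : ℕ) : ℝ) 1 x =
      Real.exp x * ∑ z ∈ Finset.range (k + 1), (k.choose z : ℝ) * x ^ z / z.factorial := by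
  have hfin : ∑ z ∈ Finset.range (k + 1), (k.choose z : ℝ) * x ^ z / z.factorial
      = ∑' z : ℕ, (k.choose z : ℝ) * x ^ z / z.factorial := by
    rw [tsum_eq_sum]
    intro z hz
    rw [Nat.choose_eq_zero_of_lt (by simpa using hz)]
    simp
  have hexp : Real.exp x = ∑' n : ℕ, x ^ n / (n.factorial : ℝ) := by
    rw [Real.exp_eq_exp_ℝ, NormedSpace.exp_eq_tsum_div]
  have hs1 : Summable fun z : ℕ => ‖(k.choose z : ℝ) * x ^ z / z.factorial‖ := by
    refine summable_of_ne_finset_zero (s := Finset.range (k + 1)) fun z hz => ?_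
    rw [Nat.choose_eq_zero_of_lt (by simpa using hz)]
    simp
  have hs2 : Summable fun n : ℕ => ‖x ^ n / (n.factorial : ℝ)‖ :=
    NormedSpace.norm_expSeries_div_summable x
  rw [hfin, hexp, mul_comm, tsum_mul_tsum_eq_tsum_sum_antidiagonal_of_summable_norm hs1 hs2, kummer]
  refine tsum_congr fun n => ?_
  have hn : (n.factorial : ℝ) ≠ 0 := by positivity
  have hasc : (ascPochhammer ℝ n).eval ((k + 1 : ℕ) : ℝ) = n.factorial * ((k + n).choose n : ℝ) := by
    rw [← ascPochhammer_eval_cast, ascPochhammer_nat_eq_ascFactorial,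
      Nat.ascFactorial_eq_factorial_mul_choose, Nat.cast_mul]
  rw [hasc, ascPochhammer_eval_one, Nat.add_choose_eq, Nat.cast_sum, mul_div_mul_left _ _ hn,
    Finset.sum_div, Finset.sum_mul]
  refine Finset.sum_congr rfl fun ij hij => ?_
  obtain ⟨i, j⟩ := ij
  have hij' : i + j = n := Finset.HasAntidiagonal.mem_antidiagonal.1 hij
  subst hij'
  have hc : ((i + j).choose j : ℝ) * i.factorial * j.factorial = (i + j).factorial := by
    exact_mod_cast Nat.add_choose_mul_factorial_mul_factorial i j
  have hi : (i.factorial : ℝ) ≠ 0 := by positivity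
  have hj : (j.factorial : ℝ) ≠ 0 := by positivity
  simp only
  have hch : ((i + j).choose j : ℝ) ≠ 0 := fun h => hn (by rw [← hc, h]; simp)
  rw [← hc]
  push_cast
  field_simp
  rw [pow_add]
  ring

/-- The tail integral `∫_x^∞ h ^ z * exp (-a h) dh` in closed form. -/
noncomputable def gammaTail (a : ℝ) (z : ℕ) (x : ℝ) : ℝ :=
  z.factorial / a ^ (z + 1) *
    (Real.exp (-(a * x)) * ∑ v ∈ Finset.range (z + 1), (a * x) ^ v / v.factorial)

theorem hasDerivAt_gammaTail {a : ℝ} (ha : 0 < a) (z : ℕ) (x : ℝ) :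
    HasDerivAt (gammaTail a z) (-(x ^ z * Real.exp (-(a * x)))) x := by
  have hE : HasDerivAt (fun x : ℝ => Real.exp (-(a * x))) (-a * Real.exp (-(a * x))) x := by
    have := (((hasDerivAt_id x).const_mul a).fun_neg).exp
    convert! this using 1
    simp [mul_comm]
  have key : ∀ z : ℕ, HasDerivAt
      (fun x : ℝ => Real.exp (-(a * x)) * ∑ v ∈ Finset.range (z + 1), (a * x) ^ v / v.factorial)
      (-(a * ((a * x) ^ z / z.factorial) * Real.exp (-(a * x)))) x := by
    intro z
    induction z with
    | zero => simpa using hE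
    | succ z ih =>
      have hp : HasDerivAt (fun x : ℝ => (a * x) ^ (z + 1) / ((z + 1).factorial : ℝ))
          (a * ((a * x) ^ z / z.factorial)) x := by
        have := (((hasDerivAt_id x).const_mul a).fun_pow (z + 1)).div_const ((z + 1).factorial : ℝ)
        convert! this using 1
        have h1 : ((z + 1).factorial : ℝ) = (z + 1) * z.factorial := by
          rw [Nat.factorial_succ]; push_cast; ring
        have h2 : (z.factorial : ℝ) ≠ 0 := by positivity
        have h3 : (z + 1 : ℝ) ≠ 0 := by positivity
        rw [h1]
        simp only [id, mul_one, Nat.cast_add, Nat.cast_one, Nat.add_sub_cancel]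
        field_simp
      have := ih.fun_add (hE.fun_mul hp)
      convert! this using 1
      · funext y
        rw [Finset.sum_range_succ _ (z + 1), mul_add]
      · ring
  have := (key z).const_mul ((z.factorial : ℝ) / a ^ (z + 1))
  convert! this using 1
  have h2 : (z.factorial : ℝ) ≠ 0 := by positivity
  field_simp
  ring

theorem tendsto_gammaTail {a : ℝ} (ha : 0 < a) (z : ℕ) :
    Filter.Tendsto (gammaTail a z) Filter.atTop (nhds 0) := by
  have h1 : ∀ v : ℕ, Filter.Tendsto (fun x : ℝ => (a * x) ^ v * Real.exp (-(a * x)) / v.factorial)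
      Filter.atTop (nhds 0) := by
    intro v
    have := (Real.tendsto_pow_mul_exp_neg_atTop_nhds_zero v).comp
      (Filter.tendsto_id.const_mul_atTop ha)
    simpa using this.div_const (v.factorial : ℝ)
  have h2 := (tendsto_finsetSum (Finset.range (z + 1)) fun v _ => h1 v).const_mul
    ((z.factorial : ℝ) / a ^ (z + 1))
  simp only [Finset.sum_const_zero, mul_zero] at h2
  refine h2.congr fun x => ?_
  rw [gammaTail, Finset.mul_sum _ _ (Real.exp (-(a * x)))]
  congr 1
  exact Finset.sum_congr rfl fun v _ => by ring

theorem gammaTail_zero (a : ℝ) (z : ℕ) : gammaTail a z 0 = z.factorial / a ^ (z + 1) := by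
  rw [gammaTail, Finset.sum_range_succ']
  simp

theorem integrableOn_pow_mul_exp {a x : ℝ} (ha : 0 < a) (hx : 0 ≤ x) (z : ℕ) :
    IntegrableOn (fun h : ℝ => h ^ z * Real.exp (-(a * h))) (Set.Ioi x) := by
  refine integrableOn_Ioi_deriv_of_nonneg' (g := fun y => -gammaTail a z y)
    (fun y _ => by simpa using (hasDerivAt_gammaTail ha z y).fun_neg) (fun y hy => ?_)
    (tendsto_gammaTail ha z).neg
  have : 0 < y := lt_of_le_of_lt hx hy
  positivity

theorem integral_pow_mul_exp {a x : ℝ} (ha : 0 < a) (hx : 0 ≤ x) (z : ℕ) :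
    ∫ h in Set.Ioi x, h ^ z * Real.exp (-(a * h)) = gammaTail a z x := by
  rw [integral_Ioi_of_hasDerivAt_of_nonneg' (g := fun y => -gammaTail a z y)
    (fun y _ => by simpa using (hasDerivAt_gammaTail ha z y).fun_neg) (fun y hy => ?_)
    (tendsto_gammaTail ha z).neg]
  · simp
  have : 0 < y := lt_of_le_of_lt hx hy
  positivity

section
variable {p : Params}

/-- The exponential rate `β - c` of the fading power. -/
noncomputable def Params.rate (p : Params) : ℝ := p.beta - p.cc

theorem Params.Valid.m_pos' (hp : p.Valid) : (0 : ℝ) < p.m :=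
  Nat.cast_pos.2 (Nat.lt_of_lt_of_le Nat.zero_lt_one hp.m_pos)

theorem Params.Valid.rate_pos (hp : p.Valid) : 0 < p.rate := by
  have hb := hp.b_pos
  have hm := hp.m_pos'
  have hO := hp.Om_nonneg
  have hden : 0 < 2 * p.b * p.m + p.Om := by positivity
  have : p.rate = p.m / (2 * p.b * p.m + p.Om) := by
    rw [Params.rate, Params.beta, Params.cc]
    field_simp
    ring
  rw [this]
  positivity

theorem Params.Valid.cc_nonneg (hp : p.Valid) : 0 ≤ p.cc := by
  have hb := hp.b_pos
  have hm := hp.m_pos'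
  have hO := hp.Om_nonneg
  unfold Params.cc
  positivity

/-- The signs of `(-1) ^ z` and of `(1 - m)_z` cancel. -/
theorem Params.Valid.zeta_eq (hp : p.Valid) (z : ℕ) :
    p.zeta z = (2 * p.b * p.m / (2 * p.b * p.m + p.Om)) ^ p.m * p.beta *
      ((p.m - 1).choose z * p.cc ^ z / z.factorial) := by
  have h : (ascPochhammer ℝ z).eval (1 - (p.m : ℝ)) =
      (-1) ^ z * (z.factorial * ((p.m - 1).choose z : ℝ)) := by
    have e : 1 - (p.m : ℝ) = -((p.m - 1 : ℕ) : ℝ) := by rw [Nat.cast_sub hp.m_pos]; simp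
    rw [e, ascPochhammer_eval_neg_eq_descPochhammer, descPochhammer_eval_eq_descFactorial,
      Nat.descFactorial_eq_factorial_mul_choose, Nat.cast_mul]
  have h2 : (z.factorial : ℝ) ≠ 0 := by positivity
  have h3 : ((-1 : ℝ) ^ z) * (-1) ^ z = 1 := by rw [← mul_pow]; simp
  rw [Params.zeta, h]
  field_simp
  linear_combination ((2 * p.b * p.m / (2 * p.b * p.m + p.Om)) ^ p.m * p.beta *
      ((p.m - 1).choose z * p.cc ^ z)) * h3

theorem Params.Valid.zeta_nonneg (hp : p.Valid) (z : ℕ) : 0 ≤ p.zeta z := by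
  have hb := hp.b_pos
  have hm := hp.m_pos'
  have hO := hp.Om_nonneg
  have hc := hp.cc_nonneg
  rw [hp.zeta_eq, Params.beta]
  positivity

/-- Density of the fading power: a finite mixture of gamma densities. -/
noncomputable def Params.fadePDF (p : Params) (h : ℝ) : ℝ :=
  ∑ z ∈ Finset.range p.m, p.zeta z * (h ^ z * Real.exp (-(p.rate * h)))

theorem Params.Valid.fadePDF_nonneg (hp : p.Valid) {h : ℝ} (hh : 0 ≤ h) : 0 ≤ p.fadePDF h :=
  Finset.sum_nonneg fun z _ => mul_nonneg (hp.zeta_nonneg z) (by positivity)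

theorem Params.continuous_fadePDF (p : Params) : Continuous p.fadePDF := by
  unfold Params.fadePDF
  fun_prop

theorem shadowedRicianPDF_eq (hp : p.Valid) (x : ℝ) :
    shadowedRicianPDF p.m p.b p.Om x = 2 * x * p.fadePDF (x ^ 2) := by
  obtain ⟨k, hk⟩ : ∃ k, p.m = k + 1 := ⟨p.m - 1, (Nat.sub_add_cancel hp.m_pos).symm⟩
  have hb := hp.b_pos
  have harg : p.Om * x ^ 2 / (2 * p.b * (2 * p.b * p.m + p.Om)) = p.cc * x ^ 2 := by
    rw [Params.cc]; ring
  have hexp : Real.exp (-x ^ 2 / (2 * p.b)) * Real.exp (p.cc * x ^ 2)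
      = Real.exp (-(p.rate * x ^ 2)) := by
    rw [← Real.exp_add]
    congr 1
    rw [Params.rate, Params.beta]
    ring
  have hk' : p.m - 1 = k := by omega
  rw [shadowedRicianPDF, harg, Params.fadePDF]
  simp_rw [hp.zeta_eq, hk']
  rw [hk, kummer_succ_one, ← hk]
  rw [show ∀ A B C D E : ℝ, A * B * C * (D * E) = A * B * (C * D) * E by intros; ring, hexp,
    Finset.mul_sum, Finset.mul_sum]
  refine Finset.sum_congr rfl fun z _ => ?_
  rw [Params.beta]
  field_simp
  ring

/-- The complementary distribution function of the fading power. -/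
noncomputable def Params.ccdf (p : Params) (x : ℝ) : ℝ :=
  ∑ z ∈ Finset.range p.m, p.zeta z * gammaTail p.rate z x

theorem Params.continuous_ccdf (p : Params) : Continuous p.ccdf := by
  unfold Params.ccdf gammaTail
  fun_prop

theorem integrableOn_fadePDF (hp : p.Valid) {x : ℝ} (hx : 0 ≤ x) :
    IntegrableOn p.fadePDF (Set.Ioi x) :=
  integrable_finsetSum _ fun z _ => (integrableOn_pow_mul_exp hp.rate_pos hx z).const_mul _

theorem integral_fadePDF (hp : p.Valid) {x : ℝ} (hx : 0 ≤ x) :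
    ∫ h in Set.Ioi x, p.fadePDF h = p.ccdf x := by
  simp_rw [Params.fadePDF]
  rw [integral_finsetSum _ fun z _ => (integrableOn_pow_mul_exp hp.rate_pos hx z).const_mul _]
  exact Finset.sum_congr rfl fun z _ => by
    rw [integral_const_mul, integral_pow_mul_exp hp.rate_pos hx]

theorem integrableOn_ccdf (hp : p.Valid) : IntegrableOn p.ccdf (Set.Ioi 0) := by
  refine integrable_finsetSum _ fun z _ => ?_
  unfold gammaTail
  simp_rw [Finset.mul_sum]
  refine integrable_finsetSum _ fun v _ => Integrable.const_mul (Integrable.const_mul ?_ _) _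
  have := (integrableOn_pow_mul_exp hp.rate_pos le_rfl v).const_mul
    (p.rate ^ v / (v.factorial : ℝ))
  refine this.congr (.of_forall fun x => ?_)
  simp only
  ring

section Law
variable {Ω : Type*} [MeasurableSpace Ω] {P : Measure Ω} {H : Ω → ℝ}

/-- The law of the fading power from that of the amplitude, by the substitution `h = x ^ 2`. The
square root is `0` at negative numbers, where the given law of the amplitude has no mass. -/
theorem map_eq_of_map_sqrt (hp : p.Valid) (hH : Measurable H)
    (hlaw : P.map (fun ω => √(H ω)) = (volume.restrict (Set.Ici (0 : ℝ))).withDensity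
      (fun x => ENNReal.ofReal (shadowedRicianPDF p.m p.b p.Om x))) :
    P.map H = (volume.restrict (Set.Ioi (0 : ℝ))).withDensity
      (fun h => ENNReal.ofReal (p.fadePDF h)) := by
  have hsq : Measurable fun ω => √(H ω) := hH.sqrt
  have hpos : ∀ᵐ ω ∂P, 0 < H ω := by
    have h0 : P.map (fun ω => √(H ω)) (Set.Iic 0) = 0 := by
      rw [hlaw, withDensity_apply _ measurableSet_Iic, Measure.restrict_restrict measurableSet_Iic,
        Set.Iic_inter_Ici, Set.Icc_self, Measure.restrict_singleton]
      simp
    rw [Measure.map_apply hsq measurableSet_Iic] at h0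
    refine (measure_eq_zero_iff_ae_notMem.1 h0).mono fun ω hω => ?_
    simpa using hω
  have hae : H =ᵐ[P] fun ω => (√(H ω)) ^ 2 := hpos.mono fun ω hω => (Real.sq_sqrt hω.le).symm
  have hmap : P.map H = (P.map fun ω => √(H ω)).map (fun x => x ^ 2) := by
    rw [Measure.map_map (by fun_prop) hsq]
    exact Measure.map_congr hae
  ext A hA
  have hA2 : MeasurableSet ((fun x : ℝ => x ^ 2) ⁻¹' A) := hA.preimage (by fun_prop)
  rw [hmap, hlaw, Measure.map_apply (by fun_prop) hA, withDensity_apply _ hA2,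
    withDensity_apply _ hA, ← restrict_Ioi_eq_restrict_Ici, ← lintegral_indicator hA,
    ← lintegral_indicator hA2]
  have himg : (fun x : ℝ => x ^ 2) '' Set.Ioi 0 = Set.Ioi 0 := by
    ext y
    constructor
    · rintro ⟨x, hx, rfl⟩
      exact pow_pos (Set.mem_Ioi.1 hx) 2
    · intro hy
      exact ⟨√y, Real.sqrt_pos.2 hy, Real.sq_sqrt (le_of_lt hy)⟩
  have hcov := lintegral_image_eq_lintegral_abs_deriv_mul (f := fun x : ℝ => x ^ 2)
    (f' := fun x => 2 * x) (s := Set.Ioi 0) measurableSet_Ioi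
    (fun x _ => by simpa using (hasDerivAt_pow 2 x).hasDerivWithinAt)
    (fun x hx y hy hxy => (pow_left_inj₀ (le_of_lt hx) (le_of_lt hy) two_ne_zero).1 hxy)
    (A.indicator fun h => ENNReal.ofReal (p.fadePDF h))
  rw [himg] at hcov
  rw [hcov]
  refine setLIntegral_congr_fun measurableSet_Ioi fun x hx => ?_
  have hx0 : (0 : ℝ) < x := hx
  by_cases hxA : x ^ 2 ∈ A
  · rw [Set.indicator_of_mem (show x ∈ (fun x : ℝ => x ^ 2) ⁻¹' A from hxA),
      Set.indicator_of_mem hxA, shadowedRicianPDF_eq hp, abs_of_pos (by positivity),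
      ENNReal.ofReal_mul (by positivity)]
  · rw [Set.indicator_of_notMem (show x ∉ (fun x : ℝ => x ^ 2) ⁻¹' A from hxA),
      Set.indicator_of_notMem hxA, mul_zero]

theorem ae_pos_of_map_eq (hH : Measurable H)
    (hlaw : P.map H = (volume.restrict (Set.Ioi (0 : ℝ))).withDensity
      (fun h => ENNReal.ofReal (p.fadePDF h))) : ∀ᵐ ω ∂P, 0 < H ω := by
  have h0 : P.map H (Set.Iic 0) = 0 := by
    rw [hlaw, withDensity_apply _ measurableSet_Iic, Measure.restrict_restrict measurableSet_Iic,
      Set.Iic_inter_Ioi, Set.Ioc_self, Measure.restrict_empty, lintegral_zero_measure]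
  rw [Measure.map_apply hH measurableSet_Iic] at h0
  refine (measure_eq_zero_iff_ae_notMem.1 h0).mono fun ω hω => ?_
  simpa using hω

theorem measure_lt_of_map_eq (hp : p.Valid) (hH : Measurable H)
    (hlaw : P.map H = (volume.restrict (Set.Ioi (0 : ℝ))).withDensity
      (fun h => ENNReal.ofReal (p.fadePDF h)))
    {x : ℝ} (hx : 0 ≤ x) :
    P {ω | x < H ω} = ENNReal.ofReal (p.ccdf x) := by
  have h : P {ω | x < H ω} = P.map H (Set.Ioi x) := (Measure.map_apply hH measurableSet_Ioi).symm
  rw [h, hlaw, withDensity_apply _ measurableSet_Ioi, Measure.restrict_restrict measurableSet_Ioi,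
    Set.inter_eq_left.2 (Set.Ioi_subset_Ioi hx), ← integral_fadePDF hp hx,
    ofReal_integral_eq_lintegral_ofReal (integrableOn_fadePDF hp hx)]
  exact (ae_restrict_iff' measurableSet_Ioi).2
    (.of_forall fun h hh => hp.fadePDF_nonneg (hx.trans (le_of_lt hh)))

theorem ccdf_zero_of_map_eq [IsProbabilityMeasure P] (hp : p.Valid) (hH : Measurable H)
    (hlaw : P.map H = (volume.restrict (Set.Ioi (0 : ℝ))).withDensity
      (fun h => ENNReal.ofReal (p.fadePDF h))) : p.ccdf 0 = 1 := by
  have h := measure_lt_of_map_eq hp hH hlaw le_rfl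
  have h1 : P {ω | 0 < H ω} = 1 := by
    exact (mem_ae_iff_prob_eq_one (measurableSet_lt measurable_const hH)).1
      (ae_pos_of_map_eq hH hlaw)
  rw [h1] at h
  exact (ENNReal.ofReal_eq_one.1 h.symm)

theorem integral_exp_of_map_eq (hp : p.Valid) (hH : Measurable H)
    (hlaw : P.map H = (volume.restrict (Set.Ioi (0 : ℝ))).withDensity
      (fun h => ENNReal.ofReal (p.fadePDF h)))
    {t : ℝ} (ht : 0 ≤ t) :
    ∫ ω, Real.exp (-(t * H ω)) ∂P = 1 - p.lossTerm t := by
  have ha := hp.rate_pos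
  rw [← integral_map (f := fun h => Real.exp (-(t * h))) hH.aemeasurable
    (by fun_prop), hlaw, integral_withDensity_eq_integral_toReal_smul
      (p.continuous_fadePDF.measurable.ennreal_ofReal) (.of_forall fun _ => ENNReal.ofReal_lt_top)]
  have h1 : ∀ h ∈ Set.Ioi (0 : ℝ), (ENNReal.ofReal (p.fadePDF h)).toReal • Real.exp (-(t * h)) =
      ∑ z ∈ Finset.range p.m, p.zeta z * (h ^ z * Real.exp (-((p.rate + t) * h))) := by
    intro h hh
    rw [ENNReal.toReal_ofReal (hp.fadePDF_nonneg (le_of_lt hh)), Params.fadePDF, smul_eq_mul,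
      Finset.sum_mul]
    refine Finset.sum_congr rfl fun z _ => ?_
    rw [add_mul, neg_add, Real.exp_add]
    ring
  rw [setIntegral_congr_fun measurableSet_Ioi h1, integral_finsetSum _ fun z _ =>
    (integrableOn_pow_mul_exp (by positivity) le_rfl z).const_mul _, Params.lossTerm, sub_sub_cancel]
  refine Finset.sum_congr rfl fun z _ => ?_
  rw [integral_const_mul, integral_pow_mul_exp (by positivity) le_rfl, gammaTail_zero,
    Real.Gamma_nat_eq_factorial, Params.rate, mul_div_assoc]

end Law

end

/-! ### Measurability and resampling of the fading -/

/-- All the data of the network are measurable. -/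
structure Network.IsMeasurable {Ω : Type*} [MeasurableSpace Ω] (M : Network Ω) : Prop where
  num : ∀ o, Measurable (M.num o)
  pos : ∀ o i, Measurable (M.pos o i)
  fade : ∀ o i, Measurable (M.fade o i)

/-- Aggregated interference plus noise when the interfering satellite users are those with indices
in `A`. -/
noncomputable def Network.interferenceOf {Ω : Type*} (M : Network Ω) (p : Params) (s : Sharing)
    (A : Finset ℕ) (ω : Ω) : ℝ :=
  ∑ i ∈ A, M.interferer p .satUser i ω
    + ∑ i ∈ M.visible p s.node ω, M.interferer p s.node i ω + p.sigma ^ 2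

/-- Visible satellite users at distance more than `r`. -/
noncomputable def Network.beyond {Ω : Type*} (M : Network Ω) (p : Params) (r : ℝ) (ω : Ω) :
    Finset ℕ :=
  (M.visible p .satUser ω).filter fun i => r < M.distTo p .satUser i ω

section
variable {Ω : Type*} {M : Network Ω} {p : Params}

theorem Network.mem_visible {o : Node} {i : ℕ} {ω : Ω} :
    i ∈ M.visible p o ω ↔ i < M.num o ω ∧ M.pos o i ω ∈ p.cap o := by
  simp [Network.visible]

theorem Network.visible_subset (M : Network Ω) (p : Params) (o : Node) (ω : Ω) :
    M.visible p o ω ⊆ Finset.range (M.num o ω) :=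
  fun _ hi => Finset.mem_range.2 (Network.mem_visible.1 hi).1

theorem Network.mem_beyond {r : ℝ} {i : ℕ} {ω : Ω} :
    i ∈ M.beyond p r ω ↔ i ∈ M.visible p .satUser ω ∧ r < M.distTo p .satUser i ω :=
  Finset.mem_filter

theorem Network.distTo_mem (hp : p.Valid) {o : Node} {i : ℕ} {ω : Ω} (h : i ∈ M.visible p o ω) :
    M.distTo p o i ω ∈ Set.Icc (p.rMin o) (p.rMax o) :=
  dist_mem_of_mem_cap hp (Network.mem_visible.1 h).2

theorem Network.serving_spec {ω : Ω} (h : ω ∈ M.visibleEvent p) :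
    M.serving p ω ∈ M.visible p .satUser ω ∧ ∀ j ∈ M.visible p .satUser ω,
      M.servingDist p ω ≤ M.distTo p .satUser j ω := by
  have hne : {i | i ∈ M.visible p .satUser ω ∧
      ∀ j ∈ M.visible p .satUser ω, M.distTo p .satUser i ω ≤ M.distTo p .satUser j ω}.Nonempty := by
    obtain ⟨i, hi, hmin⟩ := Finset.exists_min_image (M.visible p .satUser ω)
      (fun i => M.distTo p .satUser i ω) h
    exact ⟨i, hi, hmin⟩
  exact Nat.sInf_mem hne

theorem Network.servingDist_mem (hp : p.Valid) {ω : Ω} (h : ω ∈ M.visibleEvent p) :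
    M.servingDist p ω ∈ Set.Icc (p.rMin .satUser) (p.rMax .satUser) :=
  Network.distTo_mem hp (Network.serving_spec h).1

theorem Network.lt_servingDist_iff {ω : Ω} (h : ω ∈ M.visibleEvent p) {r : ℝ} :
    r < M.servingDist p ω ↔ ∀ i ∈ M.visible p .satUser ω, r < M.distTo p .satUser i ω :=
  ⟨fun hr i hi => hr.trans_le ((Network.serving_spec h).2 i hi),
    fun hr => hr _ (Network.serving_spec h).1⟩

end

theorem measurable_sInf_nat {Ω : Type*} [MeasurableSpace Ω] {S : Ω → Set ℕ}
    (hS : ∀ i, MeasurableSet {ω | i ∈ S ω}) : Measurable fun ω => sInf (S ω) := by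
  refine measurable_of_Iic fun k => ?_
  have : (fun ω => sInf (S ω)) ⁻¹' Set.Iic k =
      (⋃ i ∈ Finset.range (k + 1), {ω | i ∈ S ω}) ∪ (⋂ i, {ω | i ∈ S ω}ᶜ) := by
    ext ω
    simp only [Set.mem_preimage, Set.mem_Iic, Set.mem_union, Set.mem_iUnion, Finset.mem_range,
      Set.mem_ofPred_eq, Set.mem_iInter, Set.mem_compl_iff, exists_prop]
    constructor
    · intro h
      by_cases hne : (S ω).Nonempty
      · exact Or.inl ⟨_, Nat.lt_succ_of_le h, Nat.sInf_mem hne⟩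
      · exact Or.inr fun i hi => hne ⟨i, hi⟩
    · rintro (⟨i, hi, hiS⟩ | h)
      · exact (Nat.sInf_le hiS).trans (Nat.le_of_lt_succ hi)
      · rw [Set.eq_empty_of_forall_notMem h]
        simp
  rw [this]
  exact (Finset.measurableSet_biUnion _ fun i _ => hS i).union
    (MeasurableSet.iInter fun i => (hS i).compl)

section
variable {Ω : Type*} [MeasurableSpace Ω] {M : Network Ω} {p : Params}

theorem Network.IsMeasurable.distTo (hM : M.IsMeasurable) (o : Node) (i : ℕ) :
    Measurable (M.distTo p o i) :=
  (measurable_norm_sub_sat p).comp (hM.pos o i)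

theorem Network.IsMeasurable.measurableSet_mem_visible (hM : M.IsMeasurable) (hp : p.Valid)
    (o : Node) (i : ℕ) : MeasurableSet {ω | i ∈ M.visible p o ω} := by
  have : {ω | i ∈ M.visible p o ω} = {ω | i < M.num o ω} ∩ M.pos o i ⁻¹' p.cap o := by
    ext ω; exact Network.mem_visible
  rw [this]
  exact (measurableSet_lt measurable_const (hM.num o)).inter
    (hM.pos o i (measurableSet_cap hp o))

theorem Network.IsMeasurable.visibleEvent (hM : M.IsMeasurable) (hp : p.Valid) :
    MeasurableSet (M.visibleEvent p) := by
  have : M.visibleEvent p = ⋃ i, {ω | i ∈ M.visible p .satUser ω} := by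
    ext ω
    simp only [Network.visibleEvent, Set.mem_iUnion]
    rfl
  rw [this]
  exact MeasurableSet.iUnion fun i => hM.measurableSet_mem_visible hp _ i

theorem Network.IsMeasurable.serving (hM : M.IsMeasurable) (hp : p.Valid) :
    Measurable (M.serving p) := by
  refine measurable_sInf_nat fun i => ?_
  have : {ω | i ∈ {i | i ∈ M.visible p .satUser ω ∧
      ∀ j ∈ M.visible p .satUser ω, M.distTo p .satUser i ω ≤ M.distTo p .satUser j ω}} =
      {ω | i ∈ M.visible p .satUser ω} ∩ ⋂ j, ({ω | j ∈ M.visible p .satUser ω}ᶜ ∪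
        {ω | M.distTo p .satUser i ω ≤ M.distTo p .satUser j ω}) := by
    ext ω
    simp only [Set.mem_ofPred_eq, Set.mem_inter_iff, Set.mem_iInter, Set.mem_union,
      Set.mem_compl_iff, imp_iff_not_or]
  rw [this]
  exact (hM.measurableSet_mem_visible hp _ i).inter (MeasurableSet.iInter fun j =>
    (hM.measurableSet_mem_visible hp _ j).compl.union
      (measurableSet_le (hM.distTo _ i) (hM.distTo _ j)))

theorem Network.IsMeasurable.servingDist (hM : M.IsMeasurable) (hp : p.Valid) :
    Measurable (M.servingDist p) :=
  measurable_comp_nat (F := fun n ω => M.distTo p .satUser n ω) (hM.serving hp)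
    fun n => hM.distTo _ n

theorem measurable_sum_of_mem {f : ℕ → Ω → ℝ} (hf : ∀ i, Measurable (f i)) {N : Ω → ℕ}
    (hN : Measurable N) {A : Ω → Finset ℕ} (hA : ∀ i, MeasurableSet {ω | i ∈ A ω})
    (hsub : ∀ ω, A ω ⊆ Finset.range (N ω)) :
    Measurable fun ω => ∑ i ∈ A ω, f i ω := by
  classical
  have : (fun ω => ∑ i ∈ A ω, f i ω) =
      fun ω => ∑ i ∈ Finset.range (N ω), {ω | i ∈ A ω}.indicator (f i) ω := by
    funext ω
    rw [← Finset.sum_subset (hsub ω)]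
    · exact Finset.sum_congr rfl fun i hi => (Set.indicator_of_mem (s := {ω | i ∈ A ω}) hi _).symm
    · exact fun i _ hi => Set.indicator_of_notMem (s := {ω | i ∈ A ω}) hi _
  rw [this]
  exact measurable_sum_range hN fun i => (hf i).indicator (hA i)

theorem measurable_prod_of_mem {f : ℕ → Ω → ℝ} (hf : ∀ i, Measurable (f i)) {N : Ω → ℕ}
    (hN : Measurable N) {A : Ω → Finset ℕ} (hA : ∀ i, MeasurableSet {ω | i ∈ A ω})
    (hsub : ∀ ω, A ω ⊆ Finset.range (N ω)) :
    Measurable fun ω => ∏ i ∈ A ω, f i ω := by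
  classical
  have : (fun ω => ∏ i ∈ A ω, f i ω) =
      fun ω => ∏ i ∈ Finset.range (N ω), if i ∈ A ω then f i ω else 1 := by
    funext ω
    rw [← Finset.prod_subset (hsub ω)]
    · exact Finset.prod_congr rfl fun i hi => (if_pos hi).symm
    · exact fun i _ hi => if_neg hi
  rw [this]
  exact measurable_prod_range hN fun i => Measurable.ite (hA i) (hf i) measurable_const

theorem Params.measurable_gain (p : Params) (o : Node) : Measurable (p.gain o) := by
  cases o
  · exact measurable_const
  · refine ((measurable_const.mul ?_).mul measurable_const)
    have hel : Measurable fun y : E3 => elevation y p.sat := by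
      unfold elevation InnerProductGeometry.angle
      refine measurable_const.sub (Real.continuous_arccos.measurable.comp ?_)
      fun_prop
    unfold Params.bsGain
    exact Measurable.ite (measurableSet_le hel measurable_const) measurable_const
      (Measurable.ite (measurableSet_le hel measurable_const) measurable_const measurable_const)
  · exact measurable_const

theorem Network.IsMeasurable.interferer (hM : M.IsMeasurable) (o : Node) (i : ℕ) :
    Measurable (M.interferer p o i) :=
  ((((p.measurable_gain o).comp (hM.pos o i)).mul_const _).mul (hM.fade o i)).mul
    ((hM.distTo o i).pow_const _)

theorem Network.IsMeasurable.interferenceOf (hM : M.IsMeasurable) (hp : p.Valid) (s : Sharing)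
    {A : Ω → Finset ℕ} (hA : ∀ i, MeasurableSet {ω | i ∈ A ω})
    (hsub : ∀ ω, A ω ⊆ M.visible p .satUser ω) :
    Measurable fun ω => M.interferenceOf p s (A ω) ω :=
  ((measurable_sum_of_mem (fun i => hM.interferer _ i) (hM.num _) hA
      fun ω => (hsub ω).trans (M.visible_subset p _ ω)).add
    (measurable_sum_of_mem (fun i => hM.interferer _ i) (hM.num _)
      (fun i => hM.measurableSet_mem_visible hp _ i) fun ω => M.visible_subset p _ ω)).add_const _

theorem Network.IsMeasurable.measurableSet_mem_erase (hM : M.IsMeasurable) (hp : p.Valid)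
    (i : ℕ) : MeasurableSet {ω | i ∈ (M.visible p .satUser ω).erase (M.serving p ω)} := by
  have : {ω | i ∈ (M.visible p .satUser ω).erase (M.serving p ω)} =
      (M.serving p ⁻¹' {i})ᶜ ∩ {ω | i ∈ M.visible p .satUser ω} := by
    ext ω
    simp [Finset.mem_erase, eq_comm]
  rw [this]
  exact (hM.serving hp (measurableSet_singleton i)).compl.inter
    (hM.measurableSet_mem_visible hp _ i)

theorem Network.IsMeasurable.interference (hM : M.IsMeasurable) (hp : p.Valid) (s : Sharing) :
    Measurable (M.interference p s) :=
  hM.interferenceOf hp s (fun i => hM.measurableSet_mem_erase hp i) fun _ => Finset.erase_subset _ _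

/-- Joint measurability of the interference from beyond a variable distance. -/
theorem Network.IsMeasurable.interferenceOf_beyond (hM : M.IsMeasurable) (hp : p.Valid)
    (s : Sharing) :
    Measurable fun q : ℝ × Ω => M.interferenceOf p s (M.beyond p q.1 q.2) q.2 := by
  refine ((measurable_sum_of_mem (f := fun i (q : ℝ × Ω) => M.interferer p .satUser i q.2)
    (fun i => (hM.interferer _ i).comp measurable_snd) ((hM.num .satUser).comp measurable_snd)
    (A := fun q => M.beyond p q.1 q.2) (fun i => ?_)
      fun q => (Finset.filter_subset _ _).trans (M.visible_subset p _ q.2)).add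
    ((measurable_sum_of_mem (fun i => hM.interferer _ i) (hM.num _)
      (fun i => hM.measurableSet_mem_visible hp _ i)
        fun ω => M.visible_subset p _ ω).comp measurable_snd)).add_const _
  have : {q : ℝ × Ω | i ∈ M.beyond p q.1 q.2} =
      Prod.snd ⁻¹' {ω | i ∈ M.visible p .satUser ω} ∩
        {q : ℝ × Ω | q.1 < M.distTo p .satUser i q.2} := by
    ext q
    exact Network.mem_beyond
  rw [this]
  exact (measurable_snd (hM.measurableSet_mem_visible hp _ i)).inter
    (measurableSet_lt measurable_fst ((hM.distTo _ i).comp measurable_snd))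

theorem Network.IsMeasurable.sinr (hM : M.IsMeasurable) (hp : p.Valid) (s : Sharing) :
    Measurable (M.sinr p s) := by
  refine Measurable.ite (hM.visibleEvent hp) ?_ measurable_const
  refine ((measurable_const.mul ?_).mul ((hM.servingDist hp).pow_const _)).div
    (hM.interference hp s)
  exact measurable_comp_nat (F := fun n ω => M.fade .satUser n ω) (hM.serving hp)
    fun n => hM.fade _ n

theorem Network.IsModel.isMeasurable {P : Measure Ω} (hM : M.IsModel p P) : M.IsMeasurable :=
  ⟨fun o => (hM.poisson o).measurable_num, fun o => (hM.poisson o).measurable_pos,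
    hM.measurable_fade⟩

end

/-- Locations and fading powers, as points of a space of configurations. -/
abbrev Config : Type := (Node → ℕ × (ℕ → E3)) × (Node × ℕ → ℝ)

/-- The network whose sample space is the space of configurations. -/
def canonicalNetwork : Network Config where
  num o c := (c.1 o).1
  pos o i c := (c.1 o).2 i
  fade o i c := c.2 (o, i)

theorem isMeasurable_canonicalNetwork : canonicalNetwork.IsMeasurable where
  num o := ((measurable_pi_apply o).comp measurable_fst).fst
  pos o i := (measurable_pi_apply i).comp ((measurable_pi_apply o).comp measurable_fst).snd
  fade o i := (measurable_pi_apply (o, i)).comp measurable_snd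

/-- The configuration of a network. -/
def Network.config {Ω : Type*} (M : Network Ω) (ω : Ω) : Config :=
  (fun o => (M.num o ω, fun i => M.pos o i ω), fun q => M.fade q.1 q.2 ω)

/-- The network with the locations of one sample and the fading of another. -/
def Network.resample {Ω : Type*} (M : Network Ω) : Network (Ω × Ω) where
  num o q := M.num o q.1
  pos o i q := M.pos o i q.1
  fade o i q := M.fade o i q.2

section
variable {Ω : Type*} [MeasurableSpace Ω] {M : Network Ω} {p : Params} {P : Measure Ω}

theorem Network.IsMeasurable.config (hM : M.IsMeasurable) : Measurable M.config :=
  (measurable_pi_lambda _ fun o => (hM.num o).prodMk (measurable_pi_lambda _ fun i => hM.pos o i)).prodMk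
    (measurable_pi_lambda _ fun q => hM.fade q.1 q.2)

theorem Network.IsMeasurable.resample (hM : M.IsMeasurable) : M.resample.IsMeasurable :=
  ⟨fun o => (hM.num o).comp measurable_fst, fun o i => (hM.pos o i).comp measurable_fst,
    fun o i => (hM.fade o i).comp measurable_snd⟩

/-- Since locations and fading are independent, resampling the fading does not change the law of
the configuration. -/
theorem Network.IsModel.map_config_resample [IsProbabilityMeasure P] (hM : M.IsModel p P) :
    (P.prod P).map M.resample.config = P.map M.config := by
  have hMm := hM.isMeasurable
  have h1 : Measurable fun ω => fun o : Node => (M.num o ω, fun i => M.pos o i ω) :=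
    hMm.config.fst
  have h2 : Measurable fun ω => fun q : Node × ℕ => M.fade q.1 q.2 ω := hMm.config.snd
  have h := (indepFun_iff_map_prod_eq_prod_map_map h1.aemeasurable h2.aemeasurable).1
    hM.indep_locations_fades
  rw [Measure.map_prod_map _ _ h1 h2] at h
  exact h.symm

theorem Network.IsModel.lintegral_resample [IsProbabilityMeasure P] (hM : M.IsModel p P)
    {F : Config → ENNReal} (hF : Measurable F) :
    ∫⁻ ω, F (M.config ω) ∂P = ∫⁻ ω, ∫⁻ ω', F (M.resample.config (ω, ω')) ∂P ∂P := by
  have hR := hM.isMeasurable.resample.config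
  rw [← lintegral_map hF hM.isMeasurable.config, ← hM.map_config_resample, lintegral_map hF hR]
  exact lintegral_prod _ (hF.comp hR).aemeasurable

end

/-! ### The nearest visible satellite user -/

theorem Network.prod_visible_mem {Ω : Type*} {M : Network Ω} {p : Params} (hp : p.Valid)
    {o : Node} {g : ℝ → ℝ}
    (hg01 : ∀ v ∈ Set.Icc (p.rMin o) (p.rMax o), g v ∈ Set.Icc (0 : ℝ) 1) (ω : Ω) :
    ∏ i ∈ M.visible p o ω, g (M.distTo p o i ω) ∈ Set.Icc (0 : ℝ) 1 :=
  ⟨Finset.prod_nonneg fun _ hi => (hg01 _ (Network.distTo_mem hp hi)).1,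
    Finset.prod_le_one (fun _ hi => (hg01 _ (Network.distTo_mem hp hi)).1)
      fun _ hi => (hg01 _ (Network.distTo_mem hp hi)).2⟩

section
variable {Ω : Type*} [MeasurableSpace Ω] {M : Network Ω} {p : Params} {P : Measure Ω}
  [IsProbabilityMeasure P]

/-- The generating functional of the visible transmitters on radial functions. -/
theorem Network.IsModel.integral_prod_visible (hM : M.IsModel p P) (hp : p.Valid) (o : Node)
    {g : ℝ → ℝ} (hg : Measurable g)
    (hg01 : ∀ v ∈ Set.Icc (p.rMin o) (p.rMax o), g v ∈ Set.Icc (0 : ℝ) 1) :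
    ∫ ω, ∏ i ∈ M.visible p o ω, g (M.distTo p o i ω) ∂P =
      Real.exp (-(2 * Real.pi * p.planarDensity o *
        ∫ v in (p.rMin o)..(p.rMax o), (1 - g v) * v)) := by
  classical
  let k : E3 → ℝ := fun y => if y ∈ p.cap o then g ‖y - p.sat‖ else 1
  have hcap := measurableSet_cap hp o
  have hk : Measurable k :=
    Measurable.ite hcap (hg.comp (measurable_norm_sub_sat p)) measurable_const
  have hk01 : ∀ y, k y ∈ Set.Icc (0 : ℝ) 1 := by
    intro y
    by_cases hy : y ∈ p.cap o
    · simp only [k, if_pos hy]; exact hg01 _ (dist_mem_of_mem_cap hp hy)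
    · simp [k, if_neg hy]
  have h := (hM.poisson o).integral_prod (Λ := p.intensity o) hk hk01
  have h1 : ∀ ω, ∏ i ∈ M.visible p o ω, g (M.distTo p o i ω) =
      ∏ i ∈ Finset.range (M.num o ω), k (M.pos o i ω) := by
    intro ω
    rw [Network.visible, Finset.prod_filter]
    exact Finset.prod_congr rfl fun i _ => by simp only [k]; rfl
  have h2 : ∫ y, (1 - k y) ∂(p.intensity o) =
      2 * Real.pi * p.planarDensity o * ∫ v in (p.rMin o)..(p.rMax o), (1 - g v) * v := by
    rw [← setIntegral_cap_radial hp o (g := fun v => 1 - g v) (measurable_const.sub hg),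
      ← integral_indicator hcap]
    refine integral_congr_ae (.of_forall fun y => ?_)
    by_cases hy : y ∈ p.cap o
    · simp [k, hy]
    · simp [k, hy]
  simp_rw [h1]
  rw [h, h2]

theorem Network.IsMeasurable.prod_visible (hM : M.IsMeasurable) (hp : p.Valid) (o : Node)
    {g : ℝ → ℝ} (hg : Measurable g) :
    Measurable fun ω => ∏ i ∈ M.visible p o ω, g (M.distTo p o i ω) :=
  measurable_prod_of_mem (fun i => hg.comp (hM.distTo o i)) (hM.num o)
    (fun i => hM.measurableSet_mem_visible hp o i) fun ω => M.visible_subset p o ω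

theorem integrable_of_mem_Icc {f : Ω → ℝ} (hf : Measurable f) (h : ∀ ω, f ω ∈ Set.Icc (0 : ℝ) 1) :
    Integrable f P :=
  Integrable.of_bound hf.aestronglyMeasurable 1 (.of_forall fun ω => by
    rw [Real.norm_of_nonneg (h ω).1]; exact (h ω).2)

/-- Unnormalised density of the distance of the nearest visible satellite user. -/
noncomputable def Params.nearestWeight (p : Params) (r : ℝ) : ℝ :=
  2 * Real.pi * p.planarDensity .satUser * r *
    Real.exp (-(Real.pi * p.planarDensity .satUser * (r ^ 2 - p.rMin .satUser ^ 2)))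

theorem Params.continuous_nearestWeight (p : Params) : Continuous p.nearestWeight := by
  unfold Params.nearestWeight
  fun_prop

theorem Params.Valid.nearestWeight_nonneg (hp : p.Valid) {r : ℝ} (hr : 0 ≤ r) :
    0 ≤ p.nearestWeight r := by
  have := hp.planarDensity_pos .satUser
  unfold Params.nearestWeight
  positivity

/-- The law of the distance of the nearest visible satellite user, weighted with a multiplicative
functional of all visible satellite users. Both the weighted mass of `{r < D}` and the total
weighted mass are values of the generating functional, since restricting to `{r < D}` amounts to
multiplying by indicators. -/
theorem Network.IsModel.map_servingDist_weighted (hM : M.IsModel p P) (hp : p.Valid)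
    {h : ℝ → ℝ} (hm : Measurable h) (hc : ContinuousOn h (Set.Ioi 0))
    (h01 : ∀ v, 0 < v → h v ∈ Set.Ioc (0 : ℝ) 1) :
    ((P.restrict (M.visibleEvent p)).withDensity fun ω => ENNReal.ofReal
        (∏ i ∈ M.visible p .satUser ω, h (M.distTo p .satUser i ω))).map (M.servingDist p) =
      (volume.restrict (Set.Icc (p.rMin .satUser) (p.rMax .satUser))).withDensity fun r =>
        ENNReal.ofReal (p.nearestWeight r * h r *
          Real.exp (-(2 * Real.pi * p.planarDensity .satUser *
            ∫ v in r..(p.rMax .satUser), (1 - h v) * v))) := by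
  classical
  have hMm := hM.isMeasurable
  have hV := hMm.visibleEvent hp
  have hD := hMm.servingDist hp
  have hlt := hp.rMin_lt_rMax .satUser
  have hmin := hp.rMin_pos .satUser
  set a := p.rMin .satUser with ha
  set b := p.rMax .satUser with hb
  set l := p.planarDensity .satUser with hl
  set T : Ω → ℝ := fun ω => ∏ i ∈ M.visible p .satUser ω, h (M.distTo p .satUser i ω) with hT
  have hicc : ∀ v ∈ Set.Icc a b, h v ∈ Set.Icc (0 : ℝ) 1 := fun v hv =>
    Set.Ioc_subset_Icc_self (h01 v (hmin.trans_le hv.1))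
  have hTm : Measurable T := hMm.prod_visible hp _ hm
  have hT01 : ∀ ω, T ω ∈ Set.Icc (0 : ℝ) 1 := Network.prod_visible_mem hp hicc
  have hgcont : ContinuousOn (fun v => (1 - h v) * v) (Set.Ioi 0) :=
    (continuousOn_const.sub hc).mul continuousOn_id
  have hIcc0 : ∀ {x y : ℝ}, 0 < x → 0 < y → Set.uIcc x y ⊆ Set.Ioi 0 := fun hx hy z hz =>
    lt_of_lt_of_le (lt_min hx hy) hz.1
  have hii : ∀ {x y : ℝ}, 0 < x → 0 < y →
      IntervalIntegrable (fun v => (1 - h v) * v) volume x y := fun hx hy =>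
    (hgcont.mono (hIcc0 hx hy)).intervalIntegrable
  have hfin : IsFiniteMeasure ((P.restrict (M.visibleEvent p)).withDensity
      fun ω => ENNReal.ofReal (T ω)) := by
    refine isFiniteMeasure_withDensity_ofReal (Integrable.hasFiniteIntegral ?_)
    exact (integrable_of_mem_Icc hTm hT01).restrict
  -- the exponent of the weighted tail of `D`
  set A : ℝ → ℝ := fun r =>
    Real.pi * l * (r ^ 2 - a ^ 2) + 2 * Real.pi * l * ∫ v in r..b, (1 - h v) * v with hA
  have htail : ∀ r ∈ Set.Icc a b, ∫ ω, ∏ i ∈ M.visible p .satUser ω,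
      (Set.Ioi r).indicator h (M.distTo p .satUser i ω) ∂P = Real.exp (-A r) := by
    intro r hr
    have hr0 := hmin.trans_le hr.1
    rw [hM.integral_prod_visible hp _ (hm.indicator measurableSet_Ioi) fun v hv => by
      by_cases hvr : v ∈ Set.Ioi r
      · rw [Set.indicator_of_mem hvr]; exact hicc v hv
      · rw [Set.indicator_of_notMem hvr]; simp]
    congr 2
    have e1 : ∫ v in a..r, (1 - (Set.Ioi r).indicator h v) * v = (r ^ 2 - a ^ 2) / 2 := by
      rw [← integral_id]
      refine intervalIntegral.integral_congr fun v hv => ?_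
      rw [Set.uIcc_of_le hr.1] at hv
      have : v ∉ Set.Ioi r := not_lt.2 hv.2
      simp [Set.indicator_of_notMem this]
    have e2 : ∫ v in r..b, (1 - (Set.Ioi r).indicator h v) * v = ∫ v in r..b, (1 - h v) * v := by
      refine intervalIntegral.integral_congr_ae (.of_forall fun v hv => ?_)
      rw [Set.uIoc_of_le hr.2] at hv
      rw [Set.indicator_of_mem (show v ∈ Set.Ioi r from hv.1)]
    have i1 : IntervalIntegrable (fun v => (1 - (Set.Ioi r).indicator h v) * v) volume a r := by
      refine (intervalIntegral.intervalIntegrable_id).congr fun v hv => ?_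
      rw [Set.uIoc_of_le hr.1] at hv
      have : v ∉ Set.Ioi r := not_lt.2 hv.2
      simp [Set.indicator_of_notMem this]
    have i2 : IntervalIntegrable (fun v => (1 - (Set.Ioi r).indicator h v) * v) volume r b := by
      refine (hii hr0 (hr0.trans_le hr.2)).congr fun v hv => ?_
      rw [Set.uIoc_of_le hr.2] at hv
      rw [Set.indicator_of_mem (show v ∈ Set.Ioi r from hv.1)]
    rw [← intervalIntegral.integral_add_adjacent_intervals i1 i2, e1, e2, hA]
    ring
  have htot : ∫ ω, T ω ∂P = Real.exp (-A a) := by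
    rw [hM.integral_prod_visible hp _ hm hicc]
    simp [hA, ha, hb, hl]
  have d1 : ∀ r ∈ Set.Icc a b,
      HasDerivAt (fun r => ∫ v in r..b, (1 - h v) * v) (-((1 - h r) * r)) r := by
    intro r hr
    have hr0 := hmin.trans_le hr.1
    refine intervalIntegral.integral_hasDerivAt_left (hii hr0 (hr0.trans_le hr.2)) ?_
      (hgcont.continuousAt (Ioi_mem_nhds hr0))
    exact hgcont.stronglyMeasurableAtFilter isOpen_Ioi r hr0
  have hderiv : ∀ r ∈ Set.Icc a b, HasDerivAt (fun r => -Real.exp (-A r))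
      (p.nearestWeight r * h r *
        Real.exp (-(2 * Real.pi * l * ∫ v in r..b, (1 - h v) * v))) r := by
    intro r hr
    have hr0 := hmin.trans_le hr.1
    have d2 : HasDerivAt A (2 * Real.pi * l * r * h r) r := by
      have := (((hasDerivAt_pow 2 r).sub_const (a ^ 2)).const_mul (Real.pi * l)).fun_add
        ((d1 r hr).const_mul (2 * Real.pi * l))
      convert! this using 1
      norm_num
      ring
    have := d2.fun_neg.exp.fun_neg
    convert! this using 1
    rw [Params.nearestWeight, ← hl, ← ha, hA]
    simp only
    rw [neg_add, Real.exp_add]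
    ring
  refine eq_withDensity_of_Iic hlt.le hderiv ?_ ?_ ?_ ?_
  · refine (p.continuous_nearestWeight.continuousOn.mul
      (hc.mono fun v hv => hmin.trans_le hv.1)).mul ?_
    refine Real.continuous_exp.comp_continuousOn (ContinuousOn.neg (continuousOn_const.mul ?_))
    exact fun r hr => (d1 r hr).continuousAt.continuousWithinAt
  · intro r hr
    have hr0 := hmin.trans_le hr.1
    exact mul_nonneg (mul_nonneg (hp.nearestWeight_nonneg hr0.le) (hicc r hr).1) (Real.exp_pos _).le
  · intro r hr
    rw [Measure.map_apply hD measurableSet_Iic, withDensity_apply _ (hD measurableSet_Iic),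
      Measure.restrict_restrict (hD measurableSet_Iic), neg_sub_neg, ← htot, ← htail r hr,
      ← integral_sub (integrable_of_mem_Icc hTm hT01)
        (integrable_of_mem_Icc (hMm.prod_visible hp _ (hm.indicator measurableSet_Ioi)) ?_),
      ← ofReal_integral_eq_lintegral_ofReal (integrable_of_mem_Icc hTm hT01).restrict
        (.of_forall fun ω => (hT01 ω).1),
      ← integral_indicator ((hD measurableSet_Iic).inter hV)]
    · congr 2
      funext ω
      by_cases hω : ω ∈ M.visibleEvent p
      · by_cases hr' : r < M.servingDist p ω
        · have hn : ω ∉ M.servingDist p ⁻¹' Set.Iic r ∩ M.visibleEvent p :=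
            fun hh => absurd hh.1 (not_le.2 hr')
          rw [Set.indicator_of_notMem hn, eq_comm, sub_eq_zero]
          refine Finset.prod_congr rfl fun i hi => ?_
          refine (Set.indicator_of_mem ?_ _).symm
          exact (Network.lt_servingDist_iff hω).1 hr' i hi
        · have hn : ω ∈ M.servingDist p ⁻¹' Set.Iic r ∩ M.visibleEvent p := ⟨not_lt.1 hr', hω⟩
          rw [Set.indicator_of_mem hn,
            Finset.prod_eq_zero (Network.serving_spec hω).1, sub_zero]
          exact Set.indicator_of_notMem hr' _
      · have he : M.visible p .satUser ω = ∅ := Finset.not_nonempty_iff_eq_empty.1 hω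
        rw [Set.indicator_of_notMem fun hh : ω ∈ _ ∩ M.visibleEvent p => hω hh.2]
        simp [hT, he]
    · refine Network.prod_visible_mem hp fun v hv => ?_
      by_cases hvr : v ∈ Set.Ioi r
      · rw [Set.indicator_of_mem hvr]; exact hicc v hv
      · rw [Set.indicator_of_notMem hvr]; simp
  · rw [Measure.map_apply hD measurableSet_Icc.compl]
    refine withDensity_absolutelyContinuous _ _ ?_
    rw [Measure.restrict_apply (hD measurableSet_Icc.compl)]
    convert measure_empty (μ := P)
    ext ω
    simp only [Set.mem_inter_iff, Set.mem_preimage, Set.mem_compl_iff, Set.mem_empty_iff_false,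
      iff_false, not_and]
    exact fun h1 h2 => h1 (Network.servingDist_mem hp h2)

end

theorem measurable_intervalIntegral_left {f : ℝ → ℝ} (hf : Measurable f) (b : ℝ) :
    Measurable fun r => ∫ v in r..b, f v := by
  have h : ∀ s : Set (ℝ × ℝ), MeasurableSet s →
      Measurable fun r => ∫ v in Prod.mk r ⁻¹' s, f v := by
    intro s hs
    have : (fun r => ∫ v in Prod.mk r ⁻¹' s, f v) =
        fun r => ∫ v, s.indicator (fun q : ℝ × ℝ => f q.2) (r, v) := by
      funext r
      rw [← integral_indicator (measurable_prodMk_left hs)]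
      rfl
    rw [this]
    exact (((hf.comp measurable_snd).indicator hs).stronglyMeasurable.integral_prod_right').measurable
  have h1 := h {q | q.1 < q.2 ∧ q.2 ≤ b} ((measurableSet_lt measurable_fst measurable_snd).inter
    (measurableSet_le measurable_snd measurable_const))
  have h2 := h {q | b < q.2 ∧ q.2 ≤ q.1} ((measurableSet_lt measurable_const measurable_snd).inter
    (measurableSet_le measurable_snd measurable_fst))
  exact h1.sub h2

section
variable {Ω : Type*} [MeasurableSpace Ω] {M : Network Ω} {p : Params} {P : Measure Ω}
  [IsProbabilityMeasure P]

theorem Network.IsModel.measureReal_visibleEvent (hM : M.IsModel p P) (hp : p.Valid) :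
    P.real (M.visibleEvent p) = p.visibleProb := by
  have hV := hM.isMeasurable.visibleEvent hp
  -- the generating functional at `0` is the probability that the product is empty
  have h := hM.integral_prod_visible hp .satUser (g := fun _ => 0) measurable_const
    fun _ _ => by simp
  have h1 : ∀ ω, ∏ i ∈ M.visible p .satUser ω, (0 : ℝ) =
      (M.visibleEvent p)ᶜ.indicator (fun _ => 1) ω := by
    intro ω
    by_cases hω : ω ∈ M.visibleEvent p
    · rw [Set.indicator_of_notMem (Set.notMem_compl_iff.2 hω)]
      exact Finset.prod_eq_zero (Network.serving_spec hω).1 rfl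
    · have he : M.visible p .satUser ω = ∅ := Finset.not_nonempty_iff_eq_empty.1 hω
      rw [Set.indicator_of_mem (Set.mem_compl hω), he, Finset.prod_empty]
  simp_rw [h1] at h
  rw [integral_indicator hV.compl, setIntegral_const, smul_eq_mul, mul_one,
    probReal_compl_eq_one_sub hV] at h
  have e : P.real (M.visibleEvent p) = 1 - (1 - P.real (M.visibleEvent p)) := by ring
  rw [e, h, Params.visibleProb]
  congr 3
  simp only [sub_zero, one_mul, integral_id]
  ring

theorem Params.Valid.visibleProb_pos (hp : p.Valid) : 0 < p.visibleProb := by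
  have hl := hp.planarDensity_pos .satUser
  have h1 := hp.rMin_pos .satUser
  have h2 := hp.rMin_lt_rMax .satUser
  have h3 := Real.pi_pos
  rw [Params.visibleProb, sub_pos, Real.exp_lt_one_iff, neg_lt_zero]
  have : p.rMin .satUser ^ 2 < p.rMax .satUser ^ 2 := pow_lt_pow_left₀ h2 h1.le two_ne_zero
  have := sub_pos.2 this
  positivity

theorem Params.nearestPDF_eq (p : Params) (r : ℝ) :
    p.nearestPDF r = p.nearestWeight r / p.visibleProb := by
  rw [Params.nearestPDF, Params.nearestWeight, mul_sub, neg_sub, sub_eq_add_neg, Real.exp_add]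
  ring_nf

theorem Network.IsModel.map_servingDist (hM : M.IsModel p P) (hp : p.Valid) :
    (P.restrict (M.visibleEvent p)).map (M.servingDist p) =
      (volume.restrict (Set.Icc (p.rMin .satUser) (p.rMax .satUser))).withDensity fun r =>
        ENNReal.ofReal (p.nearestWeight r) := by
  simpa using hM.map_servingDist_weighted hp (h := fun _ => 1) measurable_const
    continuousOn_const fun _ _ => by simp

theorem Network.IsModel.map_servingDist_cond (hM : M.IsModel p P) (hp : p.Valid) :
    (ProbabilityTheory.cond P (M.visibleEvent p)).map (M.servingDist p) =
      (volume.restrict (Set.Icc (p.rMin .satUser) (p.rMax .satUser))).withDensity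
        (fun r => ENNReal.ofReal (p.nearestPDF r)) := by
  have hpos := hp.visibleProb_pos
  have hPV : (P (M.visibleEvent p))⁻¹ = ENNReal.ofReal (p.visibleProb⁻¹) := by
    rw [ENNReal.ofReal_inv_of_pos hpos, ← hM.measureReal_visibleEvent hp, ofReal_measureReal]
  rw [ProbabilityTheory.cond, Measure.map_smul, hM.map_servingDist hp, hPV,
    ← withDensity_smul _ (p.continuous_nearestWeight.measurable.ennreal_ofReal)]
  refine withDensity_congr_ae (.of_forall fun r => ?_)
  simp only [Pi.smul_apply, smul_eq_mul]
  rw [← ENNReal.ofReal_mul (inv_nonneg.2 hpos.le), p.nearestPDF_eq, div_eq_inv_mul]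

/-- The generating functional of the satellite users other than the nearest one: given the distance
`r` of the nearest one, they form a Poisson process beyond `r`. The factor of the nearest one is
divided out of the weighted law of its distance. -/
theorem Network.IsModel.lintegral_prod_erase (hM : M.IsModel p P) (hp : p.Valid)
    {h : ℝ → ℝ} (hm : Measurable h) (hc : ContinuousOn h (Set.Ioi 0))
    (h01 : ∀ v, 0 < v → h v ∈ Set.Ioc (0 : ℝ) 1) {B : Set ℝ} (hB : MeasurableSet B) :
    ∫⁻ ω in M.visibleEvent p ∩ M.servingDist p ⁻¹' B, ENNReal.ofReal
        (∏ i ∈ (M.visible p .satUser ω).erase (M.serving p ω), h (M.distTo p .satUser i ω)) ∂P =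
      ∫⁻ r in B ∩ Set.Icc (p.rMin .satUser) (p.rMax .satUser),
        ENNReal.ofReal (p.nearestWeight r * Real.exp (-(2 * Real.pi * p.planarDensity .satUser *
            ∫ v in r..(p.rMax .satUser), (1 - h v) * v))) := by
  have hMm := hM.isMeasurable
  have hV := hMm.visibleEvent hp
  have hD := hMm.servingDist hp
  have hmin := hp.rMin_pos .satUser
  have hkey := hM.map_servingDist_weighted hp hm hc h01
  have hTm : Measurable fun ω => ENNReal.ofReal
      (∏ i ∈ M.visible p .satUser ω, h (M.distTo p .satUser i ω)) :=
    (hMm.prod_visible hp _ hm).ennreal_ofReal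
  have hinv : Measurable fun r => ENNReal.ofReal (h r)⁻¹ := hm.inv.ennreal_ofReal
  have hE : Measurable fun r => ∫ v in r..(p.rMax .satUser), (1 - h v) * v :=
    measurable_intervalIntegral_left ((measurable_const.sub hm).mul measurable_id) _
  have hdm : Measurable fun r => ENNReal.ofReal (p.nearestWeight r * h r *
          Real.exp (-(2 * Real.pi * p.planarDensity .satUser *
            ∫ v in r..(p.rMax .satUser), (1 - h v) * v))) :=
    ((p.continuous_nearestWeight.measurable.mul hm).mul
      (hE.const_mul _).neg.exp).ennreal_ofReal
  have h1 : ∫⁻ ω in M.visibleEvent p ∩ M.servingDist p ⁻¹' B, ENNReal.ofReal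
        (∏ i ∈ (M.visible p .satUser ω).erase (M.serving p ω), h (M.distTo p .satUser i ω)) ∂P =
      ∫⁻ r in B, ENNReal.ofReal (h r)⁻¹ ∂(((P.restrict (M.visibleEvent p)).withDensity
        fun ω => ENNReal.ofReal (∏ i ∈ M.visible p .satUser ω,
          h (M.distTo p .satUser i ω))).map (M.servingDist p)) := by
    rw [setLIntegral_map hB hinv hD]
    refine Eq.trans ?_ (setLIntegral_withDensity_eq_setLIntegral_mul _ hTm
      (hinv.comp hD) (hD hB)).symm
    rw [Measure.restrict_restrict (hD hB), Set.inter_comm]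
    refine setLIntegral_congr_fun ((hD hB).inter hV) fun ω hω => ?_
    have hs := (Network.serving_spec hω.2).1
    have h0 := h01 (M.servingDist p ω) (hmin.trans_le (Network.servingDist_mem hp hω.2).1)
    have hprod := Finset.mul_prod_erase (M.visible p .satUser ω)
      (fun i => h (M.distTo p .satUser i ω)) hs
    simp only [Pi.mul_apply, Function.comp_apply]
    rw [← hprod, mul_comm, ← ENNReal.ofReal_mul (inv_nonneg.2 h0.1.le)]
    congr 1
    change _ = (h (M.servingDist p ω))⁻¹ * (h (M.servingDist p ω) * _)
    rw [← mul_assoc, inv_mul_cancel₀ h0.1.ne', one_mul]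
  rw [h1, hkey, setLIntegral_withDensity_eq_setLIntegral_mul _ hdm hinv hB,
    Measure.restrict_restrict hB]
  refine setLIntegral_congr_fun (hB.inter measurableSet_Icc) fun r hr => ?_
  have h0 := h01 r (hmin.trans_le hr.2.1)
  simp only [Pi.mul_apply]
  rw [mul_comm, ← ENNReal.ofReal_mul (inv_nonneg.2 h0.1.le)]
  congr 1
  field_simp [h0.1.ne']

/-- The generating functional of the visible satellite users beyond distance `r`. -/
theorem Network.IsModel.integral_prod_beyond (hM : M.IsModel p P) (hp : p.Valid)
    {h : ℝ → ℝ} (hm : Measurable h) (hc : ContinuousOn h (Set.Ioi 0))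
    (h01 : ∀ v, 0 < v → h v ∈ Set.Ioc (0 : ℝ) 1) {r : ℝ}
    (hr : r ∈ Set.Icc (p.rMin .satUser) (p.rMax .satUser)) :
    ∫ ω, ∏ i ∈ M.beyond p r ω, h (M.distTo p .satUser i ω) ∂P =
      Real.exp (-(2 * Real.pi * p.planarDensity .satUser *
            ∫ v in r..(p.rMax .satUser), (1 - h v) * v)) := by
  classical
  have hmin := hp.rMin_pos .satUser
  have hr0 := hmin.trans_le hr.1
  have h1 : ∀ ω, ∏ i ∈ M.beyond p r ω, h (M.distTo p .satUser i ω) =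
      ∏ i ∈ M.visible p .satUser ω,
        (fun v => if r < v then h v else 1) (M.distTo p .satUser i ω) := by
    intro ω
    rw [Network.beyond, Finset.prod_filter]
  simp_rw [h1]
  rw [hM.integral_prod_visible hp _ (Measurable.ite measurableSet_Ioi hm measurable_const)]
  · congr 3
    have i1 : IntervalIntegrable (fun v => (1 - if r < v then h v else 1) * v) volume
        (p.rMin .satUser) r := by
      refine (intervalIntegrable_const (c := (0 : ℝ))).congr fun v hv => ?_
      rw [Set.uIoc_of_le hr.1] at hv
      simp [not_lt.2 hv.2]
    have i2 : IntervalIntegrable (fun v => (1 - if r < v then h v else 1) * v) volume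
        r (p.rMax .satUser) := by
      have : IntervalIntegrable (fun v => (1 - h v) * v) volume r (p.rMax .satUser) := by
        refine ContinuousOn.intervalIntegrable
          (((continuousOn_const.sub hc).mul continuousOn_id).mono fun v hv => ?_)
        rw [Set.uIcc_of_le hr.2] at hv
        exact hr0.trans_le hv.1
      refine this.congr fun v hv => ?_
      rw [Set.uIoc_of_le hr.2] at hv
      simp [hv.1]
    rw [← intervalIntegral.integral_add_adjacent_intervals i1 i2]
    have e1 : ∫ v in (p.rMin .satUser)..r, (1 - if r < v then h v else 1) * v = 0 := by
      rw [← intervalIntegral.integral_zero (a := p.rMin .satUser) (b := r) (μ := volume)]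
      refine intervalIntegral.integral_congr fun v hv => ?_
      rw [Set.uIcc_of_le hr.1] at hv
      simp [not_lt.2 hv.2]
    rw [e1, zero_add]
    refine intervalIntegral.integral_congr_ae (.of_forall fun v hv => ?_)
    rw [Set.uIoc_of_le hr.2] at hv
    simp [hv.1]
  · intro v hv
    by_cases hvr : r < v
    · simp only [if_pos hvr]
      exact Set.Ioc_subset_Icc_self (h01 v (hr0.trans hvr))
    · simp [if_neg hvr]

end

/-! ### Laplace transforms of the interference -/

section
variable {p : Params}

/-- Effective gain of a visible interferer, as a function of its distance. -/
noncomputable def Params.radialGain (p : Params) : Node → ℝ → ℝ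
  | .satUser, _ => p.gUser
  | .bs, v => p.gSatSide * (if v < p.rPsi then p.gBsLow else p.gBsHigh) * p.pathFactor
  | .terUser, _ => p.gSatSide * p.gTerSide * p.pathFactor

theorem gain_eq_radialGain (hp : p.Valid) {o : Node} {y : E3} (hy : y ∈ p.cap o) :
    p.gain o y = p.radialGain o ‖y - p.sat‖ := by
  cases o
  · rfl
  · simp only [Params.gain, Params.radialGain]
    rw [bsGain_of_mem_cap hp hy]
  · rfl

theorem Params.Valid.pathFactor_pos (hp : p.Valid) : 0 < p.pathFactor := by
  have := hp.lightSpeed_pos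
  have := hp.fc_pos
  have := Real.pi_pos
  unfold Params.pathFactor
  positivity

theorem Params.Valid.radialGain_pos (hp : p.Valid) (o : Node) (v : ℝ) :
    0 < p.radialGain o v := by
  have h1 := hp.pathFactor_pos
  have h2 := hp.gSatSide_pos
  have h3 := hp.gUserSide_pos
  have h4 := hp.gTerSide_pos
  have h5 := hp.gBsLow_pos
  have h6 := hp.gBsHigh_pos
  cases o
  · simp only [Params.radialGain, Params.gUser]; positivity
  · simp only [Params.radialGain]; split_ifs <;> positivity
  · simp only [Params.radialGain]; positivity

theorem Params.measurable_radialGain (p : Params) (o : Node) : Measurable (p.radialGain o) := by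
  cases o
  · exact measurable_const
  · exact ((Measurable.ite measurableSet_Iio measurable_const measurable_const).const_mul _).mul_const _
  · exact measurable_const

theorem Params.measurable_lossTerm (p : Params) : Measurable p.lossTerm := by
  unfold Params.lossTerm
  fun_prop

theorem Params.Valid.continuousOn_lossTerm (hp : p.Valid) :
    ContinuousOn p.lossTerm (Set.Ici 0) := by
  refine continuousOn_const.sub (continuousOn_finsetSum _ fun z _ => ?_)
  refine continuousOn_const.div (by fun_prop) fun t ht => pow_ne_zero _ ?_
  have := hp.rate_pos
  rw [Params.rate] at this
  have ht' : (0 : ℝ) ≤ t := ht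
  positivity

theorem Params.Valid.continuousOn_lossTerm_comp (hp : p.Valid) {s g : ℝ} (hs : 0 ≤ s)
    (hg : 0 ≤ g) : ContinuousOn (fun v => p.lossTerm (s * g * v ^ (-p.alpha))) (Set.Ioi 0) := by
  refine hp.continuousOn_lossTerm.comp (continuousOn_const.mul fun v hv => ?_) fun v hv => ?_
  · exact (Real.continuousAt_rpow_const v _ (Or.inl (ne_of_gt hv))).continuousWithinAt
  · have : (0 : ℝ) < v := hv
    exact Set.mem_Ici.2 (by positivity)

/-- Laplace transform at `s` of the power received from a transmitter at distance `v`. -/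
noncomputable def Params.linkLaplace (p : Params) (o : Node) (s v : ℝ) : ℝ :=
  1 - p.lossTerm (s * (p.radialGain o v * p.power o) * v ^ (-p.alpha))

theorem Params.measurable_linkLaplace (p : Params) (o : Node) (s : ℝ) :
    Measurable (p.linkLaplace o s) :=
  measurable_const.sub (p.measurable_lossTerm.comp
    ((((p.measurable_radialGain o).mul_const _).const_mul s).mul (measurable_id.pow_const _)))

/-- Contribution of the terrestrial transmitters to minus the logarithm of the Laplace transform. -/
noncomputable def Params.terrestrialTerm (p : Params) : Sharing → ℝ → ℝ
  | .dn, s => p.ringTerm (p.planarDensity .bs) (p.gSatSide * p.gBsLow * p.pathFactor * p.power .bs)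
          (p.rMin .bs) p.rPsi s
      + p.ringTerm (p.planarDensity .bs) (p.gSatSide * p.gBsHigh * p.pathFactor * p.power .bs)
          p.rPsi (p.rMax .bs) s
  | .up, s => p.ringTerm (p.planarDensity .terUser)
      (p.gSatSide * p.gTerSide * p.pathFactor * p.power .terUser) (p.rMin .terUser) (p.rMax .terUser) s

theorem Params.laplace_eq (p : Params) (o : Sharing) (r s : ℝ) :
    p.laplace o r s = Real.exp (-(s * p.sigma ^ 2)) * Real.exp (-p.ringTerm
      (p.planarDensity .satUser) (p.gUser * p.power .satUser) r (p.rMax .satUser) s) *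
        Real.exp (-p.terrestrialTerm o s) := by
  rw [← Real.exp_add, ← Real.exp_add]
  cases o <;> simp only [Params.laplace, Params.terrestrialTerm] <;> ring_nf

theorem terrestrialTerm_eq (hp : p.Valid) (o : Sharing) {s : ℝ} (hs : 0 ≤ s) :
    2 * Real.pi * p.planarDensity o.node *
      ∫ v in (p.rMin o.node)..(p.rMax o.node), (1 - p.linkLaplace o.node s v) * v =
        p.terrestrialTerm o s := by
  have hcf := hp.pathFactor_pos
  have hss := hp.gSatSide_pos
  have hpw := hp.power_pos
  cases o
  · simp only [Params.terrestrialTerm, Sharing.node, Params.ringTerm, Params.linkLaplace,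
      sub_sub_cancel]
    rw [← mul_add]
    congr 1
    have hmin := hp.rMin_pos .bs
    have h1 := hp.rMin_le_rPsi
    have h2 := hp.rPsi_le_rMax
    have hpsi := hmin.trans_le h1
    have e1 : ∀ v < p.rPsi, p.lossTerm (s * (p.radialGain .bs v * p.power .bs) * v ^ (-p.alpha)) * v
        = p.lossTerm (s * (p.gSatSide * p.gBsLow * p.pathFactor * p.power .bs) *
          v ^ (-p.alpha)) * v := by
      intro v hv
      simp only [Params.radialGain, if_pos hv]
    have e2 : ∀ v, p.rPsi ≤ v → p.lossTerm (s * (p.radialGain .bs v * p.power .bs) *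
        v ^ (-p.alpha)) * v = p.lossTerm (s * (p.gSatSide * p.gBsHigh * p.pathFactor *
          p.power .bs) * v ^ (-p.alpha)) * v := by
      intro v hv
      simp only [Params.radialGain, if_neg hv.not_gt]
    have i1 : IntervalIntegrable (fun v => p.lossTerm (s * (p.gSatSide * p.gBsLow * p.pathFactor *
        p.power .bs) * v ^ (-p.alpha)) * v) volume (p.rMin .bs) p.rPsi := by
      have := hp.gBsLow_pos
      have := hpw .bs
      refine ContinuousOn.intervalIntegrable (((hp.continuousOn_lossTerm_comp hs
        (by positivity)).mul continuousOn_id).mono fun v hv => ?_)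
      rw [Set.uIcc_of_le h1] at hv
      exact hmin.trans_le hv.1
    have i2 : IntervalIntegrable (fun v => p.lossTerm (s * (p.gSatSide * p.gBsHigh * p.pathFactor *
        p.power .bs) * v ^ (-p.alpha)) * v) volume p.rPsi (p.rMax .bs) := by
      have := hp.gBsHigh_pos
      have := hpw .bs
      refine ContinuousOn.intervalIntegrable (((hp.continuousOn_lossTerm_comp hs
        (by positivity)).mul continuousOn_id).mono fun v hv => ?_)
      rw [Set.uIcc_of_le h2] at hv
      exact hpsi.trans_le hv.1
    -- the integrands agree off the single point `rPsi`
    have a1 : ∀ᵐ v ∂(volume : Measure ℝ), v ≠ p.rPsi := Measure.ae_ne volume p.rPsi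
    have i1' : IntervalIntegrable (fun v => p.lossTerm (s * (p.radialGain .bs v * p.power .bs) *
        v ^ (-p.alpha)) * v) volume (p.rMin .bs) p.rPsi := by
      refine i1.congr_ae ?_
      refine (ae_restrict_iff' measurableSet_uIoc).2 (a1.mono fun v hv hv' => ?_)
      rw [Set.uIoc_of_le h1] at hv'
      exact (e1 v (lt_of_le_of_ne hv'.2 hv)).symm
    have i2' : IntervalIntegrable (fun v => p.lossTerm (s * (p.radialGain .bs v * p.power .bs) *
        v ^ (-p.alpha)) * v) volume p.rPsi (p.rMax .bs) := by
      refine i2.congr fun v hv => ?_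
      rw [Set.uIoc_of_le h2] at hv
      exact (e2 v hv.1.le).symm
    rw [← intervalIntegral.integral_add_adjacent_intervals i1' i2']
    congr 1
    · refine intervalIntegral.integral_congr_ae (a1.mono fun v hv hv' => ?_)
      rw [Set.uIoc_of_le h1] at hv'
      exact e1 v (lt_of_le_of_ne hv'.2 hv)
    · refine intervalIntegral.integral_congr fun v hv => ?_
      rw [Set.uIcc_of_le h2] at hv
      exact e2 v hv.1
  · simp only [Params.terrestrialTerm, Sharing.node, Params.ringTerm, Params.linkLaplace,
      Params.radialGain, sub_sub_cancel]

end

section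
variable {Ω : Type*} [MeasurableSpace Ω] {M : Network Ω} {p : Params} {P : Measure Ω}

theorem Network.IsModel.map_fade (hM : M.IsModel p P) (hp : p.Valid) (o : Node) (i : ℕ) :
    P.map (M.fade o i) = (volume.restrict (Set.Ioi (0 : ℝ))).withDensity
      (fun h => ENNReal.ofReal (p.fadePDF h)) :=
  map_eq_of_map_sqrt hp (hM.measurable_fade o i) (hM.fade_law o i)

theorem Network.IsModel.ae_fade_pos (hM : M.IsModel p P) (hp : p.Valid) :
    ∀ᵐ ω ∂P, ∀ o i, 0 < M.fade o i ω := by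
  have h : ∀ o, ∀ᵐ ω ∂P, ∀ i, 0 < M.fade o i ω := fun o =>
    ae_all_iff.2 fun i => ae_pos_of_map_eq (hM.measurable_fade o i) (hM.map_fade hp o i)
  filter_upwards [h .satUser, h .bs, h .terUser] with ω h1 h2 h3 o
  cases o
  · exact h1
  · exact h2
  · exact h3

theorem Network.IsModel.one_sub_lossTerm_mem [IsProbabilityMeasure P] (hM : M.IsModel p P) (hp : p.Valid) {t : ℝ}
    (ht : 0 ≤ t) : 1 - p.lossTerm t ∈ Set.Ioc (0 : ℝ) 1 := by
  have hm := hM.measurable_fade .satUser 0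
  have hbd : ∀ᵐ ω ∂P, Real.exp (-(t * M.fade .satUser 0 ω)) ≤ 1 :=
    (hM.ae_fade_pos hp).mono fun ω hω => by
      rw [Real.exp_le_one_iff, neg_nonpos]
      exact mul_nonneg ht (hω _ _).le
  have hint : Integrable (fun ω => Real.exp (-(t * M.fade .satUser 0 ω))) P :=
    Integrable.of_bound (by fun_prop) 1 (hbd.mono fun ω hω => by
      rwa [Real.norm_of_nonneg (Real.exp_pos _).le])
  rw [← integral_exp_of_map_eq hp hm (hM.map_fade hp _ _) ht]
  refine ⟨integral_exp_pos hint, ?_⟩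
  refine (integral_mono_ae hint (integrable_const 1) hbd).trans_eq (by simp)

theorem Network.IsModel.linkLaplace_mem [IsProbabilityMeasure P] (hM : M.IsModel p P) (hp : p.Valid) (o : Node) {s v : ℝ}
    (hs : 0 ≤ s) (hv : 0 < v) : p.linkLaplace o s v ∈ Set.Ioc (0 : ℝ) 1 := by
  refine hM.one_sub_lossTerm_mem hp ?_
  have := hp.radialGain_pos o v
  have := hp.power_pos o
  positivity

theorem Network.IsModel.integral_exp_fades [IsProbabilityMeasure P] (hM : M.IsModel p P) (hp : p.Valid)
    (S : Finset (Node × ℕ)) {c : Node × ℕ → ℝ} (hc : ∀ q ∈ S, 0 ≤ c q) :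
    ∫ ω, Real.exp (-∑ q ∈ S, c q * M.fade q.1 q.2 ω) ∂P = ∏ q ∈ S, (1 - p.lossTerm (c q)) := by
  have hind := hM.indep_fades.precomp (g := fun q : S => (q : Node × ℕ)) Subtype.val_injective
  have h1 : ∀ ω, Real.exp (-∑ q ∈ S, c q * M.fade q.1 q.2 ω) =
      ∏ q : S, Real.exp (-(c q * M.fade (q : Node × ℕ).1 (q : Node × ℕ).2 ω)) := by
    intro ω
    rw [← Real.exp_sum, Finset.sum_neg_distrib,
      Finset.sum_coe_sort S fun q => c q * M.fade q.1 q.2 ω]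
  simp_rw [h1]
  rw [hind.integral_fun_prod_comp (f := fun (q : S) h => Real.exp (-(c q * h)))
    (fun q => (hM.measurable_fade _ _).aemeasurable) (fun q => by fun_prop),
    ← Finset.prod_coe_sort S fun q => 1 - p.lossTerm (c q)]
  exact Finset.prod_congr rfl fun q _ =>
    integral_exp_of_map_eq hp (hM.measurable_fade _ _) (hM.map_fade hp _ _) (hc q q.2)

/-- Averaging over the fading, for fixed locations. -/
theorem Network.IsModel.lintegral_exp_resample [IsProbabilityMeasure P] (hM : M.IsModel p P) (hp : p.Valid) (o : Sharing)
    {s : ℝ} (hs : 0 ≤ s) (ω : Ω) {A : Finset ℕ} (hA : A ⊆ M.visible p .satUser ω) :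
    ∫⁻ ω', ENNReal.ofReal
        (Real.exp (-(s * M.resample.interferenceOf p o A (ω, ω')))) ∂P =
      ENNReal.ofReal (Real.exp (-(s * p.sigma ^ 2))) *
        ENNReal.ofReal (∏ i ∈ A, p.linkLaplace .satUser s (M.distTo p .satUser i ω)) *
        ENNReal.ofReal (∏ i ∈ M.visible p o.node ω,
          p.linkLaplace o.node s (M.distTo p o.node i ω)) := by
  classical
  have hMm := hM.isMeasurable
  let e : Node → ℕ ↪ Node × ℕ := fun n => ⟨fun i => (n, i), fun i j h => congrArg Prod.snd h⟩
  let c : Node × ℕ → ℝ := fun q => s * (p.gain q.1 (M.pos q.1 q.2 ω) * p.power q.1) *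
    M.distTo p q.1 q.2 ω ^ (-p.alpha)
  set S := A.map (e .satUser) ∪ (M.visible p o.node ω).map (e o.node) with hS
  have hne : Node.satUser ≠ o.node := by cases o <;> simp [Sharing.node]
  have hdisj : Disjoint (A.map (e .satUser)) ((M.visible p o.node ω).map (e o.node)) := by
    rw [Finset.disjoint_left]
    intro q h1 h2
    obtain ⟨i, -, rfl⟩ := Finset.mem_map.1 h1
    obtain ⟨j, -, hj⟩ := Finset.mem_map.1 h2
    exact hne (congrArg Prod.fst hj).symm
  have hcv : ∀ n i, i ∈ M.visible p n ω → 1 - p.lossTerm (c (n, i)) =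
      p.linkLaplace n s (M.distTo p n i ω) ∧ 0 ≤ c (n, i) := by
    intro n i hi
    have hcap := (Network.mem_visible.1 hi).2
    have hd : 0 < M.distTo p n i ω := (hp.rMin_pos n).trans_le (Network.distTo_mem hp hi).1
    have h1 : c (n, i) = s * (p.radialGain n (M.distTo p n i ω) * p.power n) *
        M.distTo p n i ω ^ (-p.alpha) := by
      simp only [c]
      rw [gain_eq_radialGain hp hcap]
      rfl
    refine ⟨by rw [h1]; rfl, ?_⟩
    rw [h1]
    have := hp.radialGain_pos n (M.distTo p n i ω)
    have := hp.power_pos n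
    positivity
  have hexp : ∀ ω', Real.exp (-(s * M.resample.interferenceOf p o A (ω, ω'))) =
      Real.exp (-(s * p.sigma ^ 2)) * Real.exp (-∑ q ∈ S, c q * M.fade q.1 q.2 ω') := by
    intro ω'
    rw [← Real.exp_add, hS, Finset.sum_union hdisj, Finset.sum_map, Finset.sum_map]
    congr 1
    have h1 : ∀ n i, c (e n i) * M.fade (e n i).1 (e n i).2 ω' =
        s * M.resample.interferer p n i (ω, ω') := by
      intro n i
      simp only [c, e, Network.interferer]
      change s * (p.gain n (M.pos n i ω) * p.power n) * M.distTo p n i ω ^ (-p.alpha) *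
        M.fade n i ω' = s * (p.gain n (M.pos n i ω) * p.power n * M.fade n i ω' *
          M.distTo p n i ω ^ (-p.alpha))
      ring
    simp_rw [h1]
    rw [← Finset.mul_sum, ← Finset.mul_sum]
    change -(s * (∑ i ∈ A, M.resample.interferer p .satUser i (ω, ω') +
      ∑ i ∈ M.visible p o.node ω, M.resample.interferer p o.node i (ω, ω') + p.sigma ^ 2)) = _
    ring
  have hprod : ∫ ω', Real.exp (-∑ q ∈ S, c q * M.fade q.1 q.2 ω') ∂P =
      (∏ i ∈ A, p.linkLaplace .satUser s (M.distTo p .satUser i ω)) *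
        ∏ i ∈ M.visible p o.node ω, p.linkLaplace o.node s (M.distTo p o.node i ω) := by
    have hc : ∀ q ∈ S, 0 ≤ c q := by
      intro q hq
      rcases Finset.mem_union.1 hq with h | h
      · obtain ⟨i, hi, rfl⟩ := Finset.mem_map.1 h
        exact (hcv _ i (hA hi)).2
      · obtain ⟨i, hi, rfl⟩ := Finset.mem_map.1 h
        exact (hcv _ i hi).2
    rw [hM.integral_exp_fades hp S hc, hS, Finset.prod_union hdisj, Finset.prod_map,
      Finset.prod_map]
    exact congrArg₂ (· * ·) (Finset.prod_congr rfl fun i hi => (hcv _ i (hA hi)).1)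
      (Finset.prod_congr rfl fun i hi => (hcv _ i hi).1)
  have hpos : ∀ n (B : Finset ℕ), B ⊆ M.visible p n ω →
      0 < ∏ i ∈ B, p.linkLaplace n s (M.distTo p n i ω) := fun n B hB =>
    Finset.prod_pos fun i hi => (hM.linkLaplace_mem hp n hs
      ((hp.rMin_pos n).trans_le (Network.distTo_mem hp (hB hi)).1)).1
  -- a Bochner integral with nonzero value is integrable
  have hint : Integrable (fun ω' => Real.exp (-∑ q ∈ S, c q * M.fade q.1 q.2 ω')) P := by
    by_contra h
    have h0 := integral_undef h
    rw [hprod] at h0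
    exact absurd h0 (mul_pos (hpos _ A hA) (hpos _ _ subset_rfl)).ne'
  simp_rw [hexp]
  rw [← ofReal_integral_eq_lintegral_ofReal (hint.const_mul _)
    (.of_forall fun _ => by positivity), integral_const_mul, hprod,
    ENNReal.ofReal_mul (Real.exp_pos _).le, ENNReal.ofReal_mul (hpos _ A hA).le, mul_assoc]

/-- Functionals of the locations of satellite users and of terrestrial transmitters are
independent. A functional of one type of location is evaluated on a configuration all of whose
location components are equal. -/
theorem Network.IsModel.lintegral_mul_locations (hM : M.IsModel p P) (o : Sharing)
    {F G : Config → ENNReal} (hF : Measurable F) (hG : Measurable G) :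
    ∫⁻ ω, F (fun _ => (M.num .satUser ω, fun i => M.pos .satUser i ω), fun _ => 0) *
        G (fun _ => (M.num o.node ω, fun i => M.pos o.node i ω), fun _ => 0) ∂P =
      (∫⁻ ω, F (fun _ => (M.num .satUser ω, fun i => M.pos .satUser i ω), fun _ => 0) ∂P) *
        ∫⁻ ω, G (fun _ => (M.num o.node ω, fun i => M.pos o.node i ω), fun _ => 0) ∂P := by
  have hne : Node.satUser ≠ o.node := by cases o <;> simp [Sharing.node]
  have hind := hM.indep_locations.indepFun hne
  have hloc : ∀ n, Measurable fun ω => (M.num n ω, fun i => M.pos n i ω) := fun n =>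
    (hM.isMeasurable.num n).prodMk (measurable_pi_lambda _ fun i => hM.isMeasurable.pos n i)
  have hcst : Measurable fun l : ℕ × (ℕ → E3) =>
      (((fun _ => l), fun _ => 0) : Config) :=
    (measurable_pi_lambda _ fun _ => measurable_id).prodMk measurable_const
  exact lintegral_mul_eq_lintegral_mul_lintegral_of_indepFun ((hF.comp hcst).comp (hloc _))
    ((hG.comp hcst).comp (hloc _)) (hind.comp (hF.comp hcst) (hG.comp hcst))

end

section
variable {Ω : Type*} [MeasurableSpace Ω] {M : Network Ω} {p : Params} {P : Measure Ω}
  [IsProbabilityMeasure P]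

/-- Laplace transform of the interference when the interfering satellite users are selected by a
rule `A` on an event `E`, both of which depend on the locations of the satellite users alone. -/
theorem Network.IsModel.lintegral_exp_interferenceOf (hM : M.IsModel p P) (hp : p.Valid)
    (o : Sharing) {s : ℝ} (hs : 0 ≤ s) {E : Set Config} (hE : MeasurableSet E)
    {A : Config → Finset ℕ} (hA : ∀ i, MeasurableSet {c | i ∈ A c})
    (hsub : ∀ c, A c ⊆ canonicalNetwork.visible p .satUser c)
    (hEc : ∀ c, c ∈ E ↔ (fun _ => c.1 .satUser, fun _ => 0) ∈ E)
    (hAc : ∀ c, A c = A (fun _ => c.1 .satUser, fun _ => 0)) :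
    ∫⁻ ω in M.config ⁻¹' E, ENNReal.ofReal
        (Real.exp (-(s * M.interferenceOf p o (A (M.config ω)) ω))) ∂P =
      ENNReal.ofReal (Real.exp (-(s * p.sigma ^ 2))) *
        (∫⁻ ω in M.config ⁻¹' E, ENNReal.ofReal
          (∏ i ∈ A (M.config ω), p.linkLaplace .satUser s (M.distTo p .satUser i ω)) ∂P) *
        ENNReal.ofReal (Real.exp (-p.terrestrialTerm o s)) := by
  classical
  have hMm := hM.isMeasurable
  have hC := isMeasurable_canonicalNetwork
  have hEm : MeasurableSet (M.config ⁻¹' E) := hMm.config hE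
  let F₀ : Config → ENNReal := E.indicator fun c => ENNReal.ofReal
    (Real.exp (-(s * canonicalNetwork.interferenceOf p o (A c) c)))
  let F : Config → ENNReal := E.indicator fun c => ENNReal.ofReal
    (∏ i ∈ A c, p.linkLaplace .satUser s (canonicalNetwork.distTo p .satUser i c))
  let G : Config → ENNReal := fun c => ENNReal.ofReal
    (∏ i ∈ canonicalNetwork.visible p o.node c,
      p.linkLaplace o.node s (canonicalNetwork.distTo p o.node i c))
  have hF₀ : Measurable F₀ := by
    refine Measurable.indicator ?_ hE
    exact (Real.measurable_exp.comp
      (((hC.interferenceOf hp o hA hsub).const_mul s).neg)).ennreal_ofReal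
  have hF : Measurable F := by
    refine Measurable.indicator (Measurable.ennreal_ofReal ?_) hE
    exact measurable_prod_of_mem (fun i => (p.measurable_linkLaplace _ s).comp (hC.distTo _ i))
      (hC.num .satUser) hA fun c => (hsub c).trans (canonicalNetwork.visible_subset p _ c)
  have hG : Measurable G := (hC.prod_visible hp _ (p.measurable_linkLaplace _ s)).ennreal_ofReal
  have hsat : ∀ ω, F (fun _ => (M.num .satUser ω, fun i => M.pos .satUser i ω), fun _ => 0) =
      (M.config ⁻¹' E).indicator (fun ω => ENNReal.ofReal (∏ i ∈ A (M.config ω),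
        p.linkLaplace .satUser s (M.distTo p .satUser i ω))) ω := by
    intro ω
    have h2 := hAc (M.config ω)
    by_cases h : M.config ω ∈ E
    · rw [Set.indicator_of_mem (s := M.config ⁻¹' E) h]
      refine (Set.indicator_of_mem ((hEc (M.config ω)).1 h) _).trans ?_
      rw [h2]
      rfl
    · rw [Set.indicator_of_notMem (s := M.config ⁻¹' E) h]
      exact Set.indicator_of_notMem (fun h' => h ((hEc (M.config ω)).2 h')) _
  have hinner : ∀ ω, ∫⁻ ω', F₀ (M.resample.config (ω, ω')) ∂P =
      ENNReal.ofReal (Real.exp (-(s * p.sigma ^ 2))) *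
        (F (fun _ => (M.num .satUser ω, fun i => M.pos .satUser i ω), fun _ => 0) *
          G (fun _ => (M.num o.node ω, fun i => M.pos o.node i ω), fun _ => 0)) := by
    intro ω
    have h1 : ∀ ω', M.resample.config (ω, ω') ∈ E ↔ M.config ω ∈ E := fun ω' =>
      (hEc _).trans (hEc (M.config ω)).symm
    have h2 : ∀ ω', A (M.resample.config (ω, ω')) = A (M.config ω) := fun ω' =>
      (hAc _).trans (hAc (M.config ω)).symm
    rw [hsat]
    by_cases h : M.config ω ∈ E
    · rw [Set.indicator_of_mem (s := M.config ⁻¹' E) h]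
      have h3 : ∀ ω', F₀ (M.resample.config (ω, ω')) = ENNReal.ofReal
          (Real.exp (-(s * M.resample.interferenceOf p o (A (M.config ω)) (ω, ω')))) := by
        intro ω'
        simp only [F₀]
        rw [Set.indicator_of_mem ((h1 ω').2 h), h2]
        rfl
      simp_rw [h3]
      rw [hM.lintegral_exp_resample hp o hs ω (hsub (M.config ω)), mul_assoc]
      rfl
    · rw [Set.indicator_of_notMem (s := M.config ⁻¹' E) h, zero_mul, mul_zero]
      have h3 : ∀ ω', F₀ (M.resample.config (ω, ω')) = 0 := fun ω' =>
        Set.indicator_of_notMem (fun h' => h ((h1 ω').1 h')) _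
      simp [h3]
  have hG' : ∫⁻ ω, G (fun _ => (M.num o.node ω, fun i => M.pos o.node i ω), fun _ => 0) ∂P =
      ENNReal.ofReal (Real.exp (-p.terrestrialTerm o s)) := by
    have h01 : ∀ v ∈ Set.Icc (p.rMin o.node) (p.rMax o.node),
        p.linkLaplace o.node s v ∈ Set.Icc (0 : ℝ) 1 := fun v hv =>
      Set.Ioc_subset_Icc_self (hM.linkLaplace_mem hp _ hs ((hp.rMin_pos _).trans_le hv.1))
    rw [← terrestrialTerm_eq hp o hs,
      ← hM.integral_prod_visible hp o.node (p.measurable_linkLaplace _ s) h01,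
      ofReal_integral_eq_lintegral_ofReal
        (integrable_of_mem_Icc (hMm.prod_visible hp _ (p.measurable_linkLaplace _ s))
          (Network.prod_visible_mem hp h01))
        (.of_forall fun ω => (Network.prod_visible_mem hp h01 ω).1)]
    rfl
  rw [← lintegral_indicator hEm, ← lintegral_indicator hEm]
  calc _ = ∫⁻ ω, F₀ (M.config ω) ∂P := rfl
    _ = _ := by
      rw [hM.lintegral_resample hF₀]
      simp_rw [hinner]
      rw [lintegral_const_mul' _ _ ENNReal.ofReal_ne_top, hM.lintegral_mul_locations o hF hG, hG',
        mul_assoc]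
      simp_rw [hsat]

end

/-- The interference that remains when the nearest satellite user is at distance `r`. -/
noncomputable def Network.interferenceBeyond {Ω : Type*} (M : Network Ω) (p : Params) (o : Sharing)
    (r : ℝ) (ω : Ω) : ℝ :=
  M.interferenceOf p o (M.beyond p r ω) ω

section
variable {Ω : Type*} [MeasurableSpace Ω] {M : Network Ω} {p : Params} {P : Measure Ω}

theorem Params.Valid.continuousOn_linkLaplace_satUser (hp : p.Valid) {s : ℝ} (hs : 0 ≤ s) :
    ContinuousOn (p.linkLaplace .satUser s) (Set.Ioi 0) := by
  have h : p.linkLaplace .satUser s =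
      fun v => 1 - p.lossTerm (s * (p.gUser * p.power .satUser) * v ^ (-p.alpha)) := rfl
  rw [h]
  exact continuousOn_const.sub (hp.continuousOn_lossTerm_comp hs
    (mul_pos (hp.radialGain_pos .satUser 0) (hp.power_pos .satUser)).le)

/-- The interference, jointly with the distance of the nearest satellite user, has the conditional
Laplace transform `laplace`. -/
theorem Network.IsModel.lintegral_exp_interference [IsProbabilityMeasure P] (hM : M.IsModel p P) (hp : p.Valid)
    (o : Sharing) {s : ℝ} (hs : 0 ≤ s) {B : Set ℝ} (hB : MeasurableSet B) :
    ∫⁻ ω in M.visibleEvent p ∩ M.servingDist p ⁻¹' B,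
        ENNReal.ofReal (Real.exp (-(s * M.interference p o ω))) ∂P =
      ∫⁻ r in B ∩ Set.Icc (p.rMin .satUser) (p.rMax .satUser),
        ENNReal.ofReal (p.nearestWeight r * p.laplace o r s) := by
  have hC := isMeasurable_canonicalNetwork
  have h := hM.lintegral_exp_interferenceOf hp o hs
    (E := canonicalNetwork.visibleEvent p ∩ canonicalNetwork.servingDist p ⁻¹' B)
    ((hC.visibleEvent hp).inter (hC.servingDist hp hB))
    (A := fun c => (canonicalNetwork.visible p .satUser c).erase (canonicalNetwork.serving p c))
    (fun i => hC.measurableSet_mem_erase hp i) (fun c => Finset.erase_subset _ _)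
    (fun c => Iff.rfl) (fun c => rfl)
  have hE : M.config ⁻¹' (canonicalNetwork.visibleEvent p ∩ canonicalNetwork.servingDist p ⁻¹' B) =
      M.visibleEvent p ∩ M.servingDist p ⁻¹' B := rfl
  have hI : ∀ ω, M.interferenceOf p o ((canonicalNetwork.visible p .satUser (M.config ω)).erase
      (canonicalNetwork.serving p (M.config ω))) ω = M.interference p o ω := fun ω => rfl
  have hV : ∀ ω, (canonicalNetwork.visible p .satUser (M.config ω)).erase
      (canonicalNetwork.serving p (M.config ω)) =
        (M.visible p .satUser ω).erase (M.serving p ω) := fun ω => rfl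
  simp only [hE, hI] at h
  simp only [hV] at h
  have h2 := hM.lintegral_prod_erase hp (p.measurable_linkLaplace .satUser s)
    (hp.continuousOn_linkLaplace_satUser hs)
    (fun v hv => hM.linkLaplace_mem hp _ hs hv) hB
  rw [h, h2, ← lintegral_const_mul' _ _ ENNReal.ofReal_ne_top,
    ← lintegral_mul_const' _ _ ENNReal.ofReal_ne_top]
  refine lintegral_congr fun r => ?_
  rw [← ENNReal.ofReal_mul (Real.exp_pos _).le, ← ENNReal.ofReal_mul' (Real.exp_pos _).le,
    p.laplace_eq]
  simp only [Params.linkLaplace, sub_sub_cancel, Params.ringTerm, Params.radialGain]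
  ring_nf

theorem Network.IsModel.lintegral_exp_interferenceBeyond [IsProbabilityMeasure P] (hM : M.IsModel p P) (hp : p.Valid)
    (o : Sharing) {s : ℝ} (hs : 0 ≤ s) {r : ℝ}
    (hr : r ∈ Set.Icc (p.rMin .satUser) (p.rMax .satUser)) :
    ∫⁻ ω, ENNReal.ofReal (Real.exp (-(s * M.interferenceBeyond p o r ω))) ∂P =
      ENNReal.ofReal (p.laplace o r s) := by
  have hC := isMeasurable_canonicalNetwork
  have hA : ∀ i, MeasurableSet {c | i ∈ canonicalNetwork.beyond p r c} := by
    intro i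
    have : {c | i ∈ canonicalNetwork.beyond p r c} =
        {c | i ∈ canonicalNetwork.visible p .satUser c} ∩
          {c | r < canonicalNetwork.distTo p .satUser i c} := by
      ext c
      exact Network.mem_beyond
    rw [this]
    exact (hC.measurableSet_mem_visible hp _ i).inter
      (measurableSet_lt measurable_const (hC.distTo _ i))
  have h := hM.lintegral_exp_interferenceOf hp o hs (E := Set.univ) MeasurableSet.univ hA
    (fun c => Finset.filter_subset _ _) (fun c => Iff.rfl) (fun c => rfl)
  have hI : ∀ ω, M.interferenceOf p o (canonicalNetwork.beyond p r (M.config ω)) ω =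
      M.interferenceBeyond p o r ω := fun ω => rfl
  have hV : ∀ ω, canonicalNetwork.beyond p r (M.config ω) = M.beyond p r ω := fun ω => rfl
  simp only [Set.preimage_univ, Measure.restrict_univ, hI] at h
  simp only [hV] at h
  have hpos : ∀ ω i, i ∈ M.beyond p r ω → 0 < M.distTo p .satUser i ω := fun ω i hi =>
    (hp.rMin_pos _).trans_le (Network.distTo_mem hp (Network.mem_beyond.1 hi).1).1
  have h01 : ∀ ω, ∏ i ∈ M.beyond p r ω, p.linkLaplace .satUser s (M.distTo p .satUser i ω) ∈
      Set.Icc (0 : ℝ) 1 := fun ω =>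
    ⟨Finset.prod_nonneg fun i hi => (hM.linkLaplace_mem hp _ hs (hpos ω i hi)).1.le,
      Finset.prod_le_one (fun i hi => (hM.linkLaplace_mem hp _ hs (hpos ω i hi)).1.le)
        fun i hi => (hM.linkLaplace_mem hp _ hs (hpos ω i hi)).2⟩
  have hm : Measurable fun ω =>
      ∏ i ∈ M.beyond p r ω, p.linkLaplace .satUser s (M.distTo p .satUser i ω) :=
    measurable_prod_of_mem (fun i => (p.measurable_linkLaplace _ s).comp
      (hM.isMeasurable.distTo _ i)) (hM.isMeasurable.num .satUser)
      (fun i => hM.isMeasurable.config (hA i))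
      fun ω => (Finset.filter_subset _ _).trans (M.visible_subset p _ ω)
  have h2 := hM.integral_prod_beyond hp (p.measurable_linkLaplace .satUser s)
    (hp.continuousOn_linkLaplace_satUser hs)
    (fun v hv => hM.linkLaplace_mem hp _ hs hv) hr
  have h3 : ∫⁻ ω, ENNReal.ofReal
      (∏ i ∈ M.beyond p r ω, p.linkLaplace .satUser s (M.distTo p .satUser i ω)) ∂P =
      ENNReal.ofReal (Real.exp (-(2 * Real.pi * p.planarDensity .satUser *
        ∫ v in r..(p.rMax .satUser), (1 - p.linkLaplace .satUser s v) * v))) := by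
    rw [← h2, ofReal_integral_eq_lintegral_ofReal (integrable_of_mem_Icc hm h01)
      (.of_forall fun ω => (h01 ω).1)]
  rw [h, h3, ← ENNReal.ofReal_mul (Real.exp_pos _).le, ← ENNReal.ofReal_mul' (Real.exp_pos _).le,
    p.laplace_eq]
  simp only [Params.linkLaplace, sub_sub_cancel, Params.ringTerm, Params.radialGain]

theorem Network.IsMeasurable.interferenceBeyond (hM : M.IsMeasurable) (hp : p.Valid) (o : Sharing) :
    Measurable fun q : ℝ × Ω => M.interferenceBeyond p o q.1 q.2 :=
  hM.interferenceOf_beyond hp o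

end

/-! ### Uniqueness of Laplace transforms and the joint law of distance and interference -/

/-- Finite measures on the half-line are determined by their Laplace transforms at the natural
numbers: the polynomials in `exp (-x)` form a separating algebra. -/
theorem ext_of_integral_exp_nnreal {μ ν : Measure NNReal} [IsFiniteMeasure μ] [IsFiniteMeasure ν]
    (h : ∀ n : ℕ, ∫ x : NNReal, Real.exp (-(n * x)) ∂μ = ∫ x : NNReal, Real.exp (-(n * x)) ∂ν) :
    μ = ν := by
  let f : BoundedContinuousFunction NNReal ℝ :=
    BoundedContinuousFunction.ofNormedAddCommGroup (fun x => Real.exp (-(x : ℝ)))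
      (by fun_prop) 1 fun x => by
        rw [Real.norm_of_nonneg (Real.exp_pos _).le, Real.exp_le_one_iff, neg_nonpos]
        exact x.2
  have hpow : ∀ (n : ℕ) (x : NNReal), (f ^ n) x = Real.exp (-(n * x)) := by
    intro n x
    rw [BoundedContinuousFunction.pow_apply, ← mul_neg, Real.exp_nat_mul]
    rfl
  refine ext_of_forall_mem_subalgebra_integral_eq_of_polish (𝕜 := ℝ)
    (A := StarAlgebra.adjoin ℝ {f}) ?_ ?_
  · intro x y hxy
    refine ⟨f, ⟨f.toContinuousMap, ⟨f, StarAlgebra.subset_adjoin ℝ _ rfl, rfl⟩, rfl⟩, ?_⟩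
    intro hf
    have hf' : Real.exp (-(x : ℝ)) = Real.exp (-(y : ℝ)) := hf
    rw [Real.exp_eq_exp, neg_inj] at hf'
    exact hxy (NNReal.coe_injective hf')
  · intro g hg
    have hstar : star f = f := by ext x; rfl
    have hg' : g ∈ Algebra.adjoin ℝ ({f} : Set (BoundedContinuousFunction NNReal ℝ)) := by
      have : g ∈ (StarAlgebra.adjoin ℝ {f}).toSubalgebra := hg
      rwa [StarAlgebra.adjoin_toSubalgebra, Set.star_singleton, hstar, Set.union_self] at this
    rw [Algebra.adjoin_singleton_eq_range_aeval] at hg'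
    obtain ⟨q, rfl⟩ := hg'
    have hq : ∀ x, (Polynomial.aeval f q : BoundedContinuousFunction NNReal ℝ) x =
        ∑ n ∈ Finset.range (q.natDegree + 1), q.coeff n * Real.exp (-(n * x)) := by
      intro x
      rw [Polynomial.aeval_eq_sum_range, BoundedContinuousFunction.coe_sum, Finset.sum_apply]
      refine Finset.sum_congr rfl fun n _ => ?_
      change q.coeff n * (f ^ n) x = _
      rw [hpow]
    have hint : ∀ (κ : Measure NNReal) [IsFiniteMeasure κ] (n : ℕ),
        Integrable (fun x : NNReal => q.coeff n * Real.exp (-(n * x))) κ := by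
      intro κ _ n
      refine Integrable.const_mul (Integrable.of_bound (by fun_prop) 1
        (.of_forall fun x => ?_)) _
      rw [Real.norm_of_nonneg (Real.exp_pos _).le, Real.exp_le_one_iff, neg_nonpos]
      positivity
    change ∫ x, (Polynomial.aeval f q : BoundedContinuousFunction NNReal ℝ) x ∂μ =
      ∫ x, (Polynomial.aeval f q : BoundedContinuousFunction NNReal ℝ) x ∂ν
    simp_rw [hq]
    rw [integral_finsetSum _ fun n _ => hint μ n, integral_finsetSum _ fun n _ => hint ν n]
    simp_rw [integral_const_mul, h]

theorem ext_of_lintegral_exp {μ ν : Measure ℝ} [IsFiniteMeasure μ] [IsFiniteMeasure ν]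
    (hμ : ∀ᵐ x ∂μ, 0 ≤ x) (hν : ∀ᵐ x ∂ν, 0 ≤ x)
    (h : ∀ s : ℝ, 0 ≤ s → ∫⁻ x, ENNReal.ofReal (Real.exp (-(s * x))) ∂μ =
      ∫⁻ x, ENNReal.ofReal (Real.exp (-(s * x))) ∂ν) : μ = ν := by
  have key : ∀ κ : Measure ℝ, (∀ᵐ x ∂κ, 0 ≤ x) →
      (κ.map Real.toNNReal).map ((↑) : NNReal → ℝ) = κ := by
    intro κ hκ
    rw [Measure.map_map measurable_coe_nnreal_real measurable_real_toNNReal]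
    refine (Measure.map_congr (g := id) (hκ.mono fun x hx => ?_)).trans Measure.map_id
    exact Real.coe_toNNReal x hx
  have hint : ∀ κ : Measure ℝ, (∀ᵐ x ∂κ, 0 ≤ x) → ∀ n : ℕ,
      ∫ x : NNReal, Real.exp (-(n * x)) ∂(κ.map Real.toNNReal) =
        (∫⁻ x, ENNReal.ofReal (Real.exp (-(n * x))) ∂κ).toReal := by
    intro κ hκ n
    rw [integral_map measurable_real_toNNReal.aemeasurable (by fun_prop),
      integral_eq_lintegral_of_nonneg_ae (.of_forall fun _ => (Real.exp_pos _).le) (by fun_prop)]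
    refine congrArg _ (lintegral_congr_ae (hκ.mono fun x hx => ?_))
    simp only [Real.coe_toNNReal x hx]
  rw [← key μ hμ, ← key ν hν]
  congr 1
  refine ext_of_integral_exp_nnreal fun n => ?_
  rw [hint μ hμ, hint ν hν, h n n.cast_nonneg]

section
variable {Ω : Type*} {M : Network Ω} {p : Params}

theorem Network.sq_le_interferenceOf (hp : p.Valid) {o : Sharing} {ω : Ω}
    (hω : ∀ n i, 0 < M.fade n i ω) {A : Finset ℕ} (hA : A ⊆ M.visible p .satUser ω) :
    p.sigma ^ 2 ≤ M.interferenceOf p o A ω := by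
  have h : ∀ n, ∀ i ∈ M.visible p n ω, 0 ≤ M.interferer p n i ω := by
    intro n i hi
    have hd : 0 < M.distTo p n i ω := (hp.rMin_pos n).trans_le (Network.distTo_mem hp hi).1
    have hg : 0 < p.gain n (M.pos n i ω) := by
      rw [gain_eq_radialGain hp (Network.mem_visible.1 hi).2]
      exact hp.radialGain_pos _ _
    have := hp.power_pos n
    have := hω n i
    unfold Network.interferer
    positivity
  have h1 := Finset.sum_nonneg fun i hi => h .satUser i (hA hi)
  have h2 := Finset.sum_nonneg (h o.node)
  unfold Network.interferenceOf
  linarith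

variable [MeasurableSpace Ω] {P : Measure Ω}

theorem Network.IsModel.ae_sq_le_interference (hM : M.IsModel p P) (hp : p.Valid) (o : Sharing) :
    ∀ᵐ ω ∂P, p.sigma ^ 2 ≤ M.interference p o ω :=
  (hM.ae_fade_pos hp).mono fun _ hω => Network.sq_le_interferenceOf hp hω (Finset.erase_subset _ _)

theorem Network.IsModel.ae_sq_le_interferenceBeyond (hM : M.IsModel p P) (hp : p.Valid)
    (o : Sharing) : ∀ᵐ ω ∂P, ∀ r, p.sigma ^ 2 ≤ M.interferenceBeyond p o r ω :=
  (hM.ae_fade_pos hp).mono fun _ hω _ =>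
    Network.sq_le_interferenceOf hp hω (Finset.filter_subset _ _)

theorem Network.IsModel.measurable_interferenceBeyond (hM : M.IsModel p P) (hp : p.Valid)
    (o : Sharing) (r : ℝ) : Measurable (M.interferenceBeyond p o r) := by
  have h : M.interferenceBeyond p o r =
      (fun q : ℝ × Ω => M.interferenceBeyond p o q.1 q.2) ∘ Prod.mk r := rfl
  rw [h]
  exact (hM.isMeasurable.interferenceBeyond hp o).comp measurable_prodMk_left

/-- The joint law of the distance `r` of the nearest satellite user and the interference: given `r`,
the interference has the law of the interference from beyond `r`. -/
theorem Network.IsModel.map_servingDist_interference [IsProbabilityMeasure P]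
    (hM : M.IsModel p P) (hp : p.Valid) (o : Sharing) :
    (P.restrict (M.visibleEvent p)).map (fun ω => (M.servingDist p ω, M.interference p o ω)) =
      (((volume.restrict (Set.Icc (p.rMin .satUser) (p.rMax .satUser))).withDensity fun r =>
        ENNReal.ofReal (p.nearestWeight r)).prod P).map
          fun q => (q.1, M.interferenceBeyond p o q.1 q.2) := by
  have hMm := hM.isMeasurable
  have hD := hMm.servingDist hp
  have hI := hMm.interference hp o
  have hIb := hMm.interferenceBeyond hp o
  have hV := hMm.visibleEvent hp
  have hσ := sq_nonneg p.sigma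
  set τ := (volume.restrict (Set.Icc (p.rMin .satUser) (p.rMax .satUser))).withDensity fun r =>
    ENNReal.ofReal (p.nearestWeight r) with hτ
  have hτD : (P.restrict (M.visibleEvent p)).map (M.servingDist p) = τ := hM.map_servingDist hp
  have hτfin : IsFiniteMeasure τ := hτD ▸ inferInstance
  refine Measure.ext_prod fun {B C} hB hC => ?_
  have hVB : MeasurableSet (M.visibleEvent p ∩ M.servingDist p ⁻¹' B) := hV.inter (hD hB)
  have key : (P.restrict (M.visibleEvent p ∩ M.servingDist p ⁻¹' B)).map (M.interference p o) =
      ((τ.restrict B).prod P).map fun q => M.interferenceBeyond p o q.1 q.2 := by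
    refine ext_of_lintegral_exp ?_ ?_ fun s hs => ?_
    · rw [ae_map_iff hI.aemeasurable measurableSet_Ici]
      exact ae_restrict_of_ae ((hM.ae_sq_le_interference hp o).mono fun _ h => hσ.trans h)
    · rw [ae_map_iff hIb.aemeasurable measurableSet_Ici]
      have h := (Measure.quasiMeasurePreserving_snd (μ := τ.restrict B) (ν := P)).ae
        (hM.ae_sq_le_interferenceBeyond hp o)
      exact h.mono fun q hq => hσ.trans (hq q.1)
    · have hexp : Measurable fun x : ℝ => ENNReal.ofReal (Real.exp (-(s * x))) := by fun_prop
      have hexpI : Measurable fun q : ℝ × Ω =>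
          ENNReal.ofReal (Real.exp (-(s * M.interferenceBeyond p o q.1 q.2))) := hexp.comp hIb
      rw [lintegral_map hexp hI, lintegral_map hexp hIb, hM.lintegral_exp_interference hp o hs hB,
        lintegral_prod _ hexpI.aemeasurable, hτ,
        restrict_withDensity hB, Measure.restrict_restrict hB,
        lintegral_withDensity_eq_lintegral_mul _
          p.continuous_nearestWeight.measurable.ennreal_ofReal
          hexpI.lintegral_prod_right']
      refine setLIntegral_congr_fun (hB.inter measurableSet_Icc) fun r hr => ?_
      simp only [Pi.mul_apply]
      rw [hM.lintegral_exp_interferenceBeyond hp o hs hr.2,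
        ENNReal.ofReal_mul (hp.nearestWeight_nonneg ((hp.rMin_pos _).le.trans hr.2.1))]
  have key' := congrArg (fun μ => μ C) key
  rw [Measure.map_apply hI hC, Measure.map_apply hIb hC, Measure.restrict_apply (hI hC)] at key'
  rw [Measure.map_apply (hD.prodMk hI) (hB.prod hC), Measure.map_apply
    (measurable_fst.prodMk hIb) (hB.prod hC), Measure.restrict_apply ((hD.prodMk hI) (hB.prod hC))]
  have h1 : (fun ω => (M.servingDist p ω, M.interference p o ω)) ⁻¹' B ×ˢ C ∩ M.visibleEvent p =
      M.interference p o ⁻¹' C ∩ (M.visibleEvent p ∩ M.servingDist p ⁻¹' B) := by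
    ext ω
    simp only [Set.mem_inter_iff, Set.mem_preimage, Set.mem_prod]
    tauto
  have h2 : (fun q : ℝ × Ω => (q.1, M.interferenceBeyond p o q.1 q.2)) ⁻¹' B ×ˢ C =
      (fun q : ℝ × Ω => M.interferenceBeyond p o q.1 q.2) ⁻¹' C ∩ B ×ˢ Set.univ := by
    ext q
    simp only [Set.mem_inter_iff, Set.mem_preimage, Set.mem_prod, Set.mem_univ, and_true]
    tauto
  rw [h1, h2, key', ← Measure.restrict_apply (hIb hC), ← Measure.prod_restrict,
    Measure.restrict_univ]

end

/-! ### Conditional Laplace transform and its derivatives -/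

theorem Params.measurable_laplace (p : Params) (o : Sharing) (s : ℝ) :
    Measurable fun r => p.laplace o r s := by
  simp_rw [p.laplace_eq o _ s]
  refine (Real.measurable_exp.comp ?_).const_mul _ |>.mul_const _
  refine ((measurable_intervalIntegral_left ?_ _).const_mul _).neg
  exact (p.measurable_lossTerm.comp ((measurable_id.pow_const _).const_mul _)).mul measurable_id

theorem Params.laplace_pos (p : Params) (o : Sharing) (r s : ℝ) : 0 < p.laplace o r s := by
  rw [p.laplace_eq]
  positivity

section
variable {Ω : Type*} [MeasurableSpace Ω] {M : Network Ω} {p : Params} {P : Measure Ω}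
  [IsProbabilityMeasure P]

theorem Network.IsModel.setIntegral_exp_interference (hM : M.IsModel p P) (hp : p.Valid)
    (o : Sharing) {s : ℝ} (hs : 0 ≤ s) {B : Set ℝ} (hB : MeasurableSet B) :
    ∫ ω in M.visibleEvent p ∩ M.servingDist p ⁻¹' B, Real.exp (-(s * M.interference p o ω)) ∂P =
      ∫ ω in M.visibleEvent p ∩ M.servingDist p ⁻¹' B, p.laplace o (M.servingDist p ω) s ∂P := by
  have hMm := hM.isMeasurable
  have hD := hMm.servingDist hp
  have hI := hMm.interference hp o
  have hL := p.measurable_laplace o s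
  have hE : Measurable fun ω => Real.exp (-(s * M.interference p o ω)) :=
    Real.measurable_exp.comp (hI.const_mul s).neg
  rw [integral_eq_lintegral_of_nonneg_ae (.of_forall fun _ => (Real.exp_pos _).le)
      hE.aestronglyMeasurable,
    integral_eq_lintegral_of_nonneg_ae (.of_forall fun _ => (p.laplace_pos _ _ _).le)
      (hL.comp hD).aestronglyMeasurable, hM.lintegral_exp_interference hp o hs hB]
  congr 1
  have h1 : ∫⁻ ω in M.visibleEvent p ∩ M.servingDist p ⁻¹' B,
      ENNReal.ofReal (p.laplace o (M.servingDist p ω) s) ∂P =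
      ∫⁻ r in B, ENNReal.ofReal (p.laplace o r s)
        ∂((P.restrict (M.visibleEvent p)).map (M.servingDist p)) := by
    rw [setLIntegral_map hB hL.ennreal_ofReal hD, Measure.restrict_restrict (hD hB),
      Set.inter_comm]
  rw [h1, hM.map_servingDist hp, restrict_withDensity hB, Measure.restrict_restrict hB,
    lintegral_withDensity_eq_lintegral_mul _ p.continuous_nearestWeight.measurable.ennreal_ofReal
      hL.ennreal_ofReal]
  refine setLIntegral_congr_fun (hB.inter measurableSet_Icc) fun r hr => ?_
  simp only [Pi.mul_apply]
  rw [ENNReal.ofReal_mul (hp.nearestWeight_nonneg ((hp.rMin_pos _).le.trans hr.2.1))]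

theorem Network.IsModel.mgf_interferenceBeyond (hM : M.IsModel p P) (hp : p.Valid)
    (o : Sharing) {s : ℝ} (hs : 0 ≤ s) {r : ℝ}
    (hr : r ∈ Set.Icc (p.rMin .satUser) (p.rMax .satUser)) :
    mgf (M.interferenceBeyond p o r) P (-s) = p.laplace o r s := by
  have hI := hM.measurable_interferenceBeyond hp o r
  rw [mgf, integral_eq_lintegral_of_nonneg_ae (.of_forall fun _ => (Real.exp_pos _).le)
    (Real.measurable_exp.comp (hI.const_mul _)).aestronglyMeasurable]
  simp_rw [neg_mul]
  rw [hM.lintegral_exp_interferenceBeyond hp o hs hr,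
    ENNReal.toReal_ofReal (p.laplace_pos _ _ _).le]

theorem Network.IsModel.neg_mem_interior_integrableExpSet (hM : M.IsModel p P) (hp : p.Valid)
    (o : Sharing) {s : ℝ} (hs : 0 < s) (r : ℝ) :
    -s ∈ interior (integrableExpSet (M.interferenceBeyond p o r) P) := by
  have hI := hM.measurable_interferenceBeyond hp o r
  refine mem_interior.2 ⟨Set.Iio 0, fun t ht => ?_, isOpen_Iio, neg_lt_zero.2 hs⟩
  have ht' : t < 0 := ht
  refine Integrable.of_bound (Real.measurable_exp.comp (hI.const_mul t)).aestronglyMeasurable 1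
    ((hM.ae_sq_le_interferenceBeyond hp o).mono fun ω hω => ?_)
  rw [Real.norm_of_nonneg (Real.exp_pos _).le, Real.exp_le_one_iff]
  exact mul_nonpos_of_nonpos_of_nonneg ht'.le ((sq_nonneg _).trans (hω r))

theorem Network.IsModel.integral_pow_mul_exp_interferenceBeyond (hM : M.IsModel p P)
    (hp : p.Valid) (o : Sharing) {s : ℝ} (hs : 0 < s) {r : ℝ}
    (hr : r ∈ Set.Icc (p.rMin .satUser) (p.rMax .satUser)) (v : ℕ) :
    ∫ ω, M.interferenceBeyond p o r ω ^ v * Real.exp (-(s * M.interferenceBeyond p o r ω)) ∂P =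
      (-1) ^ v * iteratedDeriv v (fun s => p.laplace o r s) s := by
  have h1 : (fun s => p.laplace o r s) =ᶠ[nhds s]
      fun t => mgf (M.interferenceBeyond p o r) P (-t) :=
    (lt_mem_nhds hs).mono fun t ht => (hM.mgf_interferenceBeyond hp o ht.le hr).symm
  rw [h1.iteratedDeriv_eq, iteratedDeriv_comp_neg, iteratedDeriv_mgf
    (hM.neg_mem_interior_integrableExpSet hp o hs r), smul_eq_mul, ← mul_assoc, ← mul_pow]
  simp only [neg_mul, mul_neg, one_mul, neg_neg, one_pow]

/-- Level that the fading of a serving user at distance `r` has to exceed for the SINR to exceed `γ`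
when interference plus noise equals `x`. -/
noncomputable def Params.fadeLevel (p : Params) (γ r x : ℝ) : ℝ :=
  γ * r ^ p.alpha * x / (p.gServing * p.power .satUser)

theorem Params.Valid.gServing_mul_power_pos (hp : p.Valid) :
    0 < p.gServing * p.power .satUser := by
  have := hp.pathFactor_pos
  have := hp.gSatMain_pos
  have := hp.gUserMain_pos
  have := hp.power_pos .satUser
  unfold Params.gServing
  positivity

/-- The derivatives of the Laplace transform in `coverage` assemble to the mean of the fading tail
at the level given by the interference from beyond `r`. -/
theorem Network.IsModel.coverage_eq (hM : M.IsModel p P) (hp : p.Valid) (o : Sharing)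
    {γ : ℝ} (hγ : 0 < γ) {r : ℝ} (hr : r ∈ Set.Icc (p.rMin .satUser) (p.rMax .satUser)) :
    p.coverage o γ r = ∫ ω, p.ccdf (p.fadeLevel γ r (M.interferenceBeyond p o r ω)) ∂P := by
  have hr0 : 0 < r := (hp.rMin_pos _).trans_le hr.1
  have hG := hp.gServing_mul_power_pos
  have ha := hp.rate_pos
  have hs : 0 < p.sPoint γ r := by
    have : 0 < p.beta - p.cc := ha
    unfold Params.sPoint
    positivity
  have hone : ∑ z ∈ Finset.range p.m, p.zeta z * (z.factorial / p.rate ^ (z + 1)) = 1 := by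
    have := ccdf_zero_of_map_eq hp (hM.measurable_fade .satUser 0) (hM.map_fade hp .satUser 0)
    rw [Params.ccdf] at this
    simpa only [gammaTail_zero] using this
  set I := M.interferenceBeyond p o r with hI
  have hint : ∀ v : ℕ, Integrable (fun ω => I ω ^ v * Real.exp (-(p.sPoint γ r * I ω))) P := by
    intro v
    have := integrable_pow_mul_exp_of_mem_interior_integrableExpSet
      (hM.neg_mem_interior_integrableExpSet hp o hs r) v
    simpa only [neg_mul] using this
  have hlev : ∀ ω, p.rate * p.fadeLevel γ r (I ω) = p.sPoint γ r * I ω := by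
    intro ω
    simp only [Params.fadeLevel, Params.sPoint, Params.rate]
    ring
  have htail : ∀ ω, p.ccdf (p.fadeLevel γ r (I ω)) = ∑ z ∈ Finset.range p.m,
      ∑ v ∈ Finset.range (z + 1), p.zeta z * (z.factorial / p.rate ^ (z + 1)) *
        (p.sPoint γ r ^ v / v.factorial) * (I ω ^ v * Real.exp (-(p.sPoint γ r * I ω))) := by
    intro ω
    simp only [Params.ccdf, gammaTail, hlev]
    refine Finset.sum_congr rfl fun z _ => ?_
    rw [Finset.mul_sum, Finset.mul_sum, Finset.mul_sum]
    refine Finset.sum_congr rfl fun v _ => ?_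
    rw [mul_pow]
    ring
  simp_rw [htail]
  rw [integral_finsetSum _ fun z _ => integrable_finsetSum _ fun v _ => (hint v).const_mul _]
  have hR : ∀ z ∈ Finset.range p.m,
      ∫ ω, ∑ v ∈ Finset.range (z + 1), p.zeta z * (z.factorial / p.rate ^ (z + 1)) *
        (p.sPoint γ r ^ v / v.factorial) * (I ω ^ v * Real.exp (-(p.sPoint γ r * I ω))) ∂P =
      p.zeta z * (z.factorial / p.rate ^ (z + 1)) - p.zeta z * Real.Gamma ((z : ℝ) + 1) /
        (p.beta - p.cc) ^ (z + 1) *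
        (1 - ∑ v ∈ Finset.range (z + 1), ((p.beta - p.cc) * γ * r ^ p.alpha) ^ v /
            ((p.gServing * p.power .satUser) ^ v * (v.factorial : ℝ)) *
          (-1) ^ v * iteratedDeriv v (fun s => p.laplace o r s) (p.sPoint γ r)) := by
    intro z _
    rw [integral_finsetSum _ fun v _ => (hint v).const_mul _, Real.Gamma_nat_eq_factorial,
      mul_sub, mul_one, mul_div_assoc, Params.rate, sub_sub_cancel, Finset.mul_sum]
    refine Finset.sum_congr rfl fun v _ => ?_
    rw [integral_const_mul, hI, hM.integral_pow_mul_exp_interferenceBeyond hp o hs hr]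
    have : p.sPoint γ r ^ v / (v.factorial : ℝ) = ((p.beta - p.cc) * γ * r ^ p.alpha) ^ v /
        ((p.gServing * p.power .satUser) ^ v * (v.factorial : ℝ)) := by
      rw [Params.sPoint, div_pow, div_div]
    rw [this]
    ring
  rw [Finset.sum_congr rfl hR, Finset.sum_sub_distrib, hone, Params.coverage]

end

/-! ### Tail of the SINR -/

theorem iIndepFun_indepFun_sum {Ω ι : Type*} [MeasurableSpace Ω] {P : Measure Ω}
    {X : ι → Ω → ℝ} (hX : iIndepFun X P) (hm : ∀ i, Measurable (X i)) (c : ι → ℝ) {S : Finset ι}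
    {k : ι} (hk : k ∉ S) : IndepFun (fun ω => ∑ q ∈ S, c q * X q ω) (X k) P := by
  classical
  -- the coefficient at `k` does not enter the sum and may be taken to be `1`
  have h := (hX.comp (fun q x => (if q = k then 1 else c q) * x)
    fun q => measurable_const_mul _).indepFun_finsetSum_of_notMem
      (fun q => (measurable_const_mul _).comp (hm q)) hk
  refine h.congr (.of_forall fun ω => ?_) (.of_forall fun ω => ?_)
  · rw [Finset.sum_apply]
    refine Finset.sum_congr rfl fun q hq => ?_
    have : q ≠ k := fun h => hk (h ▸ hq)
    simp [this]
  · simp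

/-- For fixed locations, the interference is an affine function of the fading of the interferers. -/
theorem Network.exists_interferenceOf_resample {Ω : Type*} (M : Network Ω) (p : Params)
    (o : Sharing) (A : Finset ℕ) (ω : Ω) : ∃ (S : Finset (Node × ℕ)) (c : Node × ℕ → ℝ),
      (∀ i, (Node.satUser, i) ∈ S → i ∈ A) ∧ ∀ ω', M.resample.interferenceOf p o A (ω, ω') =
        (∑ q ∈ S, c q * M.fade q.1 q.2 ω') + p.sigma ^ 2 := by
  classical
  have hne : Node.satUser ≠ o.node := by cases o <;> simp [Sharing.node]
  refine ⟨({Node.satUser} ×ˢ A) ∪ ({o.node} ×ˢ M.visible p o.node ω),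
    fun q => p.gain q.1 (M.pos q.1 q.2 ω) * p.power q.1 * M.distTo p q.1 q.2 ω ^ (-p.alpha),
    fun i hi => ?_, fun ω' => ?_⟩
  · simpa [hne, hne.symm] using hi
  · rw [Finset.sum_union, Finset.sum_product, Finset.sum_product, Finset.sum_singleton,
      Finset.sum_singleton]
    · have h1 : ∀ n i, p.gain n (M.pos n i ω) * p.power n * M.distTo p n i ω ^ (-p.alpha) *
          M.fade n i ω' = M.resample.interferer p n i (ω, ω') := by
        intro n i
        change _ = p.gain n (M.pos n i ω) * p.power n * M.fade n i ω' *
          M.distTo p n i ω ^ (-p.alpha)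
        ring
      simp_rw [h1]
      rfl
    · rw [Finset.disjoint_left]
      rintro ⟨n, i⟩ h1 h2
      simp only [Finset.mem_product, Finset.mem_singleton] at h1 h2
      exact hne (h1.1.symm.trans h2.1)

theorem measure_lt_of_indepFun {Ω : Type*} [MeasurableSpace Ω] {P : Measure Ω}
    [IsProbabilityMeasure P] {Y H : Ω → ℝ} (hY : Measurable Y) (hH : Measurable H)
    (h : IndepFun Y H P) : P {ω | Y ω < H ω} = ∫⁻ ω, P {ω' | Y ω < H ω'} ∂P := by
  have hs : MeasurableSet {q : ℝ × ℝ | q.1 < q.2} := measurableSet_lt measurable_fst measurable_snd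
  have h1 := (indepFun_iff_map_prod_eq_prod_map_map hY.aemeasurable hH.aemeasurable).1 h
  have h2 : P {ω | Y ω < H ω} = P.map (fun ω => (Y ω, H ω)) {q : ℝ × ℝ | q.1 < q.2} := by
    rw [Measure.map_apply (hY.prodMk hH) hs]
    rfl
  have hp : IsProbabilityMeasure (P.map H) := Measure.isProbabilityMeasure_map hH.aemeasurable
  rw [h2, h1, Measure.prod_apply hs, lintegral_map (measurable_measure_prodMk_left hs) hY]
  refine lintegral_congr fun ω => ?_
  rw [Measure.map_apply hH (measurable_prodMk_left hs)]
  rfl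

section
variable {Ω : Type*} [MeasurableSpace Ω] {M : Network Ω} {p : Params} {P : Measure Ω}

theorem Params.Valid.ccdf_antitoneOn (hp : p.Valid) : AntitoneOn p.ccdf (Set.Ici 0) := by
  intro x hx y hy hxy
  rw [← integral_fadePDF hp hx, ← integral_fadePDF hp hy]
  refine setIntegral_mono_set (integrableOn_fadePDF hp hx) ?_
    (Set.Ioi_subset_Ioi hxy).eventuallyLE
  exact (ae_restrict_iff' measurableSet_Ioi).2 (.of_forall fun v hv =>
    hp.fadePDF_nonneg (le_trans hx (le_of_lt hv)))

theorem Params.Valid.ccdf_nonneg (hp : p.Valid) {x : ℝ} (hx : 0 ≤ x) : 0 ≤ p.ccdf x := by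
  rw [← integral_fadePDF hp hx]
  exact setIntegral_nonneg measurableSet_Ioi fun v hv => hp.fadePDF_nonneg (hx.trans (le_of_lt hv))

theorem Params.Valid.fadeLevel_nonneg (hp : p.Valid) {γ r x : ℝ} (hγ : 0 ≤ γ) (hr : 0 ≤ r)
    (hx : 0 ≤ x) : 0 ≤ p.fadeLevel γ r x := by
  have := hp.gServing_mul_power_pos
  unfold Params.fadeLevel
  positivity

theorem Params.Valid.lt_sinr_iff (hp : p.Valid) {γ r x h : ℝ} (hr : 0 < r) (hx : 0 < x) :
    γ < p.gServing * p.power .satUser * h * r ^ (-p.alpha) / x ↔ p.fadeLevel γ r x < h := by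
  have hG := hp.gServing_mul_power_pos
  have hrα : 0 < r ^ p.alpha := Real.rpow_pos_of_pos hr _
  rw [Params.fadeLevel, Real.rpow_neg hr.le, lt_div_iff₀ hx, div_lt_iff₀ hG,
    ← div_eq_mul_inv, lt_div_iff₀ hrα]
  constructor <;> intro h' <;> linarith

theorem Network.IsModel.measure_fade_gt (hM : M.IsModel p P) (hp : p.Valid) (n : Node) (i : ℕ)
    {x : ℝ} (hx : 0 ≤ x) : P {ω | x < M.fade n i ω} = ENNReal.ofReal (p.ccdf x) :=
  measure_lt_of_map_eq hp (hM.measurable_fade n i) (hM.map_fade hp n i) hx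

/-- For fixed locations, the fading of the serving user is independent of the interference. -/
theorem Network.IsModel.measure_lt_sinr (hM : M.IsModel p P) [IsProbabilityMeasure P]
    (hp : p.Valid) (o : Sharing) {γ : ℝ} (hγ : 0 ≤ γ) :
    P {ω | γ < M.sinr p o ω} = ∫⁻ ω in M.visibleEvent p,
      ENNReal.ofReal (p.ccdf (p.fadeLevel γ (M.servingDist p ω) (M.interference p o ω))) ∂P := by
  classical
  have hMm := hM.isMeasurable
  have hC := isMeasurable_canonicalNetwork
  have hσ := pow_pos hp.sigma_pos 2
  have hV := hMm.visibleEvent hp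
  have hlev : Measurable fun c => p.fadeLevel γ (canonicalNetwork.servingDist p c)
      (canonicalNetwork.interference p o c) :=
    ((((hC.servingDist hp).pow_const _).const_mul γ).mul (hC.interference hp o)).div_const _
  let F : Config → ENNReal := {c | γ < canonicalNetwork.sinr p o c}.indicator fun _ => 1
  let G : Config → ENNReal := (canonicalNetwork.visibleEvent p).indicator fun c =>
    ENNReal.ofReal (p.ccdf (p.fadeLevel γ (canonicalNetwork.servingDist p c)
      (canonicalNetwork.interference p o c)))
  have hsC : MeasurableSet {c | γ < canonicalNetwork.sinr p o c} :=
    measurableSet_lt measurable_const (hC.sinr hp o)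
  have hF : Measurable F := measurable_const.indicator hsC
  have hG : Measurable G :=
    ((p.continuous_ccdf.measurable.comp hlev).ennreal_ofReal).indicator (hC.visibleEvent hp)
  have hs : MeasurableSet {ω | γ < M.sinr p o ω} := measurableSet_lt measurable_const (hMm.sinr hp o)
  rw [← lintegral_indicator_one hs, ← lintegral_indicator hV]
  change ∫⁻ ω, F (M.config ω) ∂P = ∫⁻ ω, G (M.config ω) ∂P
  rw [hM.lintegral_resample hF, hM.lintegral_resample hG]
  refine lintegral_congr fun ω => ?_
  have hVr : ∀ ω', M.resample.config (ω, ω') ∈ canonicalNetwork.visibleEvent p ↔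
      ω ∈ M.visibleEvent p := fun ω' => Iff.rfl
  by_cases hω : ω ∈ M.visibleEvent p
  · set k := M.serving p ω with hk
    set r := M.servingDist p ω with hr
    have hr0 : 0 < r := (hp.rMin_pos _).trans_le (Network.servingDist_mem hp hω).1
    set A := (M.visible p .satUser ω).erase k with hA
    set J : Ω → ℝ := fun ω' => M.resample.interferenceOf p o A (ω, ω') with hJ
    obtain ⟨S, c, hSA, hS⟩ := M.exists_interferenceOf_resample p o A ω
    have hJσ : ∀ᵐ ω' ∂P, p.sigma ^ 2 ≤ J ω' := (hM.ae_fade_pos hp).mono fun ω' hω' =>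
      Network.sq_le_interferenceOf (M := M.resample) (ω := (ω, ω')) hp hω'
        (Finset.erase_subset _ _)
    have hJm : Measurable J := by
      have : J = fun ω' => (∑ q ∈ S, c q * M.fade q.1 q.2 ω') + p.sigma ^ 2 := funext hS
      rw [this]
      exact (Finset.measurable_sum _ fun q _ => (hMm.fade _ _).const_mul _).add_const _
    have hind : IndepFun (fun ω' => p.fadeLevel γ r (J ω')) (M.fade .satUser k) P := by
      have h := iIndepFun_indepFun_sum hM.indep_fades (fun q => hMm.fade q.1 q.2) c
        (k := (Node.satUser, k)) fun h => Finset.notMem_erase k _ (hSA k h)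
      have h' := h.comp (φ := fun x => p.fadeLevel γ r (x + p.sigma ^ 2)) (ψ := id)
        (by unfold Params.fadeLevel; fun_prop) measurable_id
      refine h'.congr (.of_forall fun ω' => ?_) (.of_forall fun _ => rfl)
      simp only [hJ, hS, Function.comp_apply]
    have hYm : Measurable fun ω' => p.fadeLevel γ r (J ω') :=
      (hJm.const_mul _).div_const _
    have h1 : ∫⁻ ω', F (M.resample.config (ω, ω')) ∂P =
        P {ω' | p.fadeLevel γ r (J ω') < M.fade .satUser k ω'} := by
      rw [← lintegral_indicator_one (measurableSet_lt hYm (hMm.fade _ _))]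
      refine lintegral_congr_ae (hJσ.mono fun ω' hω' => ?_)
      have hsinr : canonicalNetwork.sinr p o (M.resample.config (ω, ω')) =
          p.gServing * p.power .satUser * M.fade .satUser k ω' * r ^ (-p.alpha) / J ω' :=
        if_pos ((hVr ω').2 hω)
      have hiff := hp.lt_sinr_iff (γ := γ) (h := M.fade .satUser k ω') hr0 (hσ.trans_le hω')
      rw [← hsinr] at hiff
      have hmem : M.resample.config (ω, ω') ∈ {c | γ < canonicalNetwork.sinr p o c} ↔
          ω' ∈ {ω' | p.fadeLevel γ r (J ω') < M.fade .satUser k ω'} := hiff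
      by_cases h : ω' ∈ {ω' | p.fadeLevel γ r (J ω') < M.fade .satUser k ω'}
      · exact (Set.indicator_of_mem (hmem.2 h) _).trans (Set.indicator_of_mem h (1 : Ω → ENNReal)).symm
      · exact (Set.indicator_of_notMem (fun h' => h (hmem.1 h')) _).trans
          (Set.indicator_of_notMem h (1 : Ω → ENNReal)).symm
    rw [h1, measure_lt_of_indepFun hYm (hMm.fade _ _) hind]
    refine lintegral_congr_ae (hJσ.mono fun ω' hω' => ?_)
    have h2 : G (M.resample.config (ω, ω')) = ENNReal.ofReal (p.ccdf (p.fadeLevel γ r (J ω'))) :=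
      Set.indicator_of_mem ((hVr ω').2 hω) _
    exact (hM.measure_fade_gt hp _ _
      (hp.fadeLevel_nonneg hγ hr0.le (hσ.le.trans hω'))).trans h2.symm
  · have h1 : ∀ ω', F (M.resample.config (ω, ω')) = 0 := by
      intro ω'
      have hsinr : canonicalNetwork.sinr p o (M.resample.config (ω, ω')) = 0 :=
        if_neg fun h => hω ((hVr ω').1 h)
      refine Set.indicator_of_notMem (s := {c | γ < canonicalNetwork.sinr p o c}) ?_ _
      intro h
      have h' : γ < canonicalNetwork.sinr p o (M.resample.config (ω, ω')) := h
      rw [hsinr] at h'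
      exact absurd h' hγ.not_gt
    have h2 : ∀ ω', G (M.resample.config (ω, ω')) = 0 := fun ω' =>
      Set.indicator_of_notMem (fun h => hω ((hVr ω').1 h)) _
    simp_rw [h1, h2]

end

/-! ### Coverage probability and spectral efficiency -/

section
variable {Ω : Type*} [MeasurableSpace Ω] {M : Network Ω} {p : Params} {P : Measure Ω}

theorem Network.IsModel.ccdf_fadeLevel_mem [IsProbabilityMeasure P] (hM : M.IsModel p P) (hp : p.Valid) (o : Sharing)
    {γ : ℝ} (hγ : 0 ≤ γ) {r : ℝ} (hr : 0 ≤ r) :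
    ∀ᵐ ω ∂P, p.ccdf (p.fadeLevel γ r (M.interferenceBeyond p o r ω)) ∈ Set.Icc (0 : ℝ) 1 := by
  refine (hM.ae_sq_le_interferenceBeyond hp o).mono fun ω hω => ?_
  have h := hp.fadeLevel_nonneg hγ hr ((sq_nonneg _).trans (hω r))
  refine ⟨hp.ccdf_nonneg h, ?_⟩
  rw [← ccdf_zero_of_map_eq hp (hM.measurable_fade .satUser 0) (hM.map_fade hp .satUser 0)]
  exact hp.ccdf_antitoneOn Set.self_mem_Ici h h

theorem Network.IsModel.measurable_ccdf_fadeLevel (hM : M.IsModel p P) (hp : p.Valid)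
    (o : Sharing) (γ : ℝ) : Measurable fun q : ℝ × Ω =>
      p.ccdf (p.fadeLevel γ q.1 (M.interferenceBeyond p o q.1 q.2)) :=
  p.continuous_ccdf.measurable.comp
    ((((measurable_fst.pow_const _).const_mul γ).mul
      (hM.isMeasurable.interferenceBeyond hp o)).div_const _)

theorem Network.IsModel.integrable_ccdf_fadeLevel [IsProbabilityMeasure P] (hM : M.IsModel p P) (hp : p.Valid)
    (o : Sharing) {γ : ℝ} (hγ : 0 ≤ γ) {r : ℝ} (hr : 0 ≤ r) :
    Integrable (fun ω => p.ccdf (p.fadeLevel γ r (M.interferenceBeyond p o r ω))) P := by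
  have h : (fun ω => p.ccdf (p.fadeLevel γ r (M.interferenceBeyond p o r ω))) =
      (fun q : ℝ × Ω => p.ccdf (p.fadeLevel γ q.1 (M.interferenceBeyond p o q.1 q.2))) ∘
        Prod.mk r := rfl
  refine Integrable.of_bound (C := 1) ?_ ((hM.ccdf_fadeLevel_mem hp o hγ hr).mono fun ω hω => ?_)
  · rw [h]
    exact ((hM.measurable_ccdf_fadeLevel hp o γ).comp measurable_prodMk_left).aestronglyMeasurable
  · rw [Real.norm_of_nonneg hω.1]
    exact hω.2

theorem Network.IsModel.coverage_mem [IsProbabilityMeasure P] (hM : M.IsModel p P) (hp : p.Valid) (o : Sharing)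
    {γ : ℝ} (hγ : 0 < γ) {r : ℝ} (hr : r ∈ Set.Icc (p.rMin .satUser) (p.rMax .satUser)) :
    p.coverage o γ r ∈ Set.Icc (0 : ℝ) 1 := by
  have hr0 := (hp.rMin_pos _).le.trans hr.1
  have h01 := hM.ccdf_fadeLevel_mem hp o hγ.le hr0
  rw [hM.coverage_eq hp o hγ hr]
  refine ⟨integral_nonneg_of_ae (h01.mono fun ω hω => hω.1), ?_⟩
  refine (integral_mono_ae (hM.integrable_ccdf_fadeLevel hp o hγ.le hr0) (integrable_const 1)
    (h01.mono fun ω hω => hω.2)).trans_eq (by simp)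

theorem Network.IsModel.integrableOn_nearestWeight_mul_coverage [IsProbabilityMeasure P] (hM : M.IsModel p P)
    (hp : p.Valid) (o : Sharing) {γ : ℝ} (hγ : 0 < γ) :
    IntegrableOn (fun r => p.nearestWeight r * p.coverage o γ r)
      (Set.Icc (p.rMin .satUser) (p.rMax .satUser)) := by
  refine Integrable.mul_bdd (c := 1)
    (p.continuous_nearestWeight.continuousOn.integrableOn_Icc) ?_ ?_
  · refine ((hM.measurable_ccdf_fadeLevel hp o γ).stronglyMeasurable.integral_prod_right'
      (ν := P)).aestronglyMeasurable.congr ?_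
    exact (ae_restrict_iff' measurableSet_Icc).2
      (.of_forall fun r hr => (hM.coverage_eq hp o hγ hr).symm)
  · refine (ae_restrict_iff' measurableSet_Icc).2 (.of_forall fun r hr => ?_)
    have h := hM.coverage_mem hp o hγ hr
    rw [Real.norm_of_nonneg h.1]
    exact h.2

/-- The tail of the SINR is the mean of the conditional coverage probability. -/
theorem Network.IsModel.measureReal_lt_sinr [IsProbabilityMeasure P] (hM : M.IsModel p P) (hp : p.Valid) (o : Sharing)
    {γ : ℝ} (hγ : 0 < γ) :
    P.real {ω | γ < M.sinr p o ω} =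
      ∫ r in (p.rMin .satUser)..(p.rMax .satUser), p.nearestWeight r * p.coverage o γ r := by
  have hMm := hM.isMeasurable
  have hD := hMm.servingDist hp
  have hI := hMm.interference hp o
  have hIb := hMm.interferenceBeyond hp o
  have hΦ : Measurable fun q : ℝ × ℝ => ENNReal.ofReal (p.ccdf (p.fadeLevel γ q.1 q.2)) := by
    have : Measurable fun q : ℝ × ℝ => p.fadeLevel γ q.1 q.2 :=
      (((measurable_fst.pow_const _).const_mul γ).mul measurable_snd).div_const _
    exact (p.continuous_ccdf.measurable.comp this).ennreal_ofReal
  have hΨ := (hM.measurable_ccdf_fadeLevel hp o γ).ennreal_ofReal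
  have h1 : P {ω | γ < M.sinr p o ω} =
      ∫⁻ r in Set.Icc (p.rMin .satUser) (p.rMax .satUser),
        ENNReal.ofReal (p.nearestWeight r * p.coverage o γ r) := by
    rw [hM.measure_lt_sinr hp o hγ.le]
    calc _ = ∫⁻ q, ENNReal.ofReal (p.ccdf (p.fadeLevel γ q.1 q.2))
          ∂((P.restrict (M.visibleEvent p)).map
            fun ω => (M.servingDist p ω, M.interference p o ω)) :=
          (lintegral_map hΦ (hD.prodMk hI)).symm
      _ = ∫⁻ r in Set.Icc (p.rMin .satUser) (p.rMax .satUser), ENNReal.ofReal (p.nearestWeight r) *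
          ∫⁻ ω, ENNReal.ofReal
            (p.ccdf (p.fadeLevel γ r (M.interferenceBeyond p o r ω))) ∂P := by
          rw [hM.map_servingDist_interference hp o, lintegral_map hΦ (measurable_fst.prodMk hIb),
            lintegral_prod _ hΨ.aemeasurable, lintegral_withDensity_eq_lintegral_mul _
              p.continuous_nearestWeight.measurable.ennreal_ofReal hΨ.lintegral_prod_right']
          rfl
      _ = _ := by
          refine setLIntegral_congr_fun measurableSet_Icc fun r hr => ?_
          have hr0 := (hp.rMin_pos _).le.trans hr.1
          rw [ENNReal.ofReal_mul (hp.nearestWeight_nonneg hr0), hM.coverage_eq hp o hγ hr,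
            ofReal_integral_eq_lintegral_ofReal (hM.integrable_ccdf_fadeLevel hp o hγ.le hr0)
              ((hM.ccdf_fadeLevel_mem hp o hγ.le hr0).mono fun ω hω => hω.1)]
  have h0 : 0 ≤ᵐ[volume.restrict (Set.Icc (p.rMin .satUser) (p.rMax .satUser))]
      fun r => p.nearestWeight r * p.coverage o γ r :=
    (ae_restrict_iff' measurableSet_Icc).2 (.of_forall fun r hr =>
      mul_nonneg (hp.nearestWeight_nonneg ((hp.rMin_pos _).le.trans hr.1))
        (hM.coverage_mem hp o hγ hr).1)
  have hint := hM.integrableOn_nearestWeight_mul_coverage hp o hγ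
  rw [intervalIntegral.integral_of_le (hp.rMin_lt_rMax .satUser).le,
    ← integral_Icc_eq_integral_Ioc, measureReal_def, h1,
    ← ofReal_integral_eq_lintegral_ofReal hint h0, ENNReal.toReal_ofReal (integral_nonneg_of_ae h0)]

theorem Params.integrand_eq (p : Params) (o : Sharing) (γ r : ℝ) : p.integrand o γ r =
    (Real.logb 2 (Real.exp 1) / (1 + γ) / p.visibleProb) *
      (p.nearestWeight r * p.coverage o γ r) := by
  rw [Params.integrand, p.nearestPDF_eq]
  ring

theorem Network.IsModel.intervalIntegrable_integrand [IsProbabilityMeasure P] (hM : M.IsModel p P) (hp : p.Valid)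
    (o : Sharing) {γ : ℝ} (hγ : 0 < γ) :
    IntervalIntegrable (fun r => p.integrand o γ r) volume (p.rMin .satUser)
      (p.rMax .satUser) := by
  simp_rw [p.integrand_eq]
  refine IntervalIntegrable.const_mul ?_ _
  rw [intervalIntegrable_iff_integrableOn_Icc_of_le (hp.rMin_lt_rMax .satUser).le]
  exact hM.integrableOn_nearestWeight_mul_coverage hp o hγ

theorem Network.IsModel.integral_integrand [IsProbabilityMeasure P] (hM : M.IsModel p P) (hp : p.Valid) (o : Sharing)
    {γ : ℝ} (hγ : 0 < γ) :
    ∫ r in (p.rMin .satUser)..(p.rMax .satUser), p.integrand o γ r =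
      (p.visibleProb)⁻¹ *
        (P.real {ω | γ < M.sinr p o ω} * (Real.logb 2 (Real.exp 1) / (1 + γ))) := by
  simp_rw [p.integrand_eq]
  rw [intervalIntegral.integral_const_mul, hM.measureReal_lt_sinr hp o hγ]
  ring

/-- The SINR is largest for a serving user at distance `rMin` that is disturbed by noise alone. Even
then the fading level required is proportional to `γ`. -/
theorem Network.IsModel.measureReal_lt_sinr_le [IsProbabilityMeasure P] (hM : M.IsModel p P) (hp : p.Valid) (o : Sharing)
    {γ : ℝ} (hγ : 0 ≤ γ) : P.real {ω | γ < M.sinr p o ω} ≤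
      p.ccdf (p.fadeLevel 1 (p.rMin .satUser) (p.sigma ^ 2) * γ) := by
  have hG := hp.gServing_mul_power_pos
  have hmin := (hp.rMin_pos .satUser).le
  have hσ := sq_nonneg p.sigma
  have h0 := mul_nonneg (hp.fadeLevel_nonneg zero_le_one hmin hσ) hγ
  refine ENNReal.toReal_le_of_le_ofReal (hp.ccdf_nonneg h0) ?_
  rw [hM.measure_lt_sinr hp o hγ]
  have hV := hM.isMeasurable.visibleEvent hp
  calc _ ≤ ∫⁻ ω in M.visibleEvent p, ENNReal.ofReal
        (p.ccdf (p.fadeLevel 1 (p.rMin .satUser) (p.sigma ^ 2) * γ)) ∂P := by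
        refine lintegral_mono_ae ((ae_restrict_iff' hV).2
          ((hM.ae_sq_le_interference hp o).mono fun ω hω hωV => ENNReal.ofReal_le_ofReal ?_))
        have hr := (Network.servingDist_mem hp hωV).1
        have hα := Real.rpow_le_rpow hmin hr hp.alpha_pos.le
        have hle : p.fadeLevel 1 (p.rMin .satUser) (p.sigma ^ 2) * γ ≤
            p.fadeLevel γ (M.servingDist p ω) (M.interference p o ω) := by
          have : p.fadeLevel 1 (p.rMin .satUser) (p.sigma ^ 2) * γ =
              p.fadeLevel γ (p.rMin .satUser) (p.sigma ^ 2) := by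
            simp only [Params.fadeLevel]
            ring
          rw [this, Params.fadeLevel, Params.fadeLevel]
          have := mul_nonneg hγ ((Real.rpow_nonneg hmin p.alpha).trans hα)
          gcongr
        exact hp.ccdf_antitoneOn (Set.mem_Ici.2 h0) (Set.mem_Ici.2 (h0.trans hle)) hle
    _ ≤ _ := by
        rw [setLIntegral_const]
        exact mul_le_of_le_one_right' prob_le_one

theorem Network.IsModel.integrableOn_measureReal_lt_sinr [IsProbabilityMeasure P] (hM : M.IsModel p P) (hp : p.Valid)
    (o : Sharing) : IntegrableOn (fun γ => P.real {ω | γ < M.sinr p o ω} *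
      (Real.logb 2 (Real.exp 1) / (1 + γ))) (Set.Ioi 0) := by
  have hG := hp.gServing_mul_power_pos
  have hK : 0 < p.fadeLevel 1 (p.rMin .satUser) (p.sigma ^ 2) := by
    have := hp.rMin_pos .satUser
    have := hp.sigma_pos
    unfold Params.fadeLevel
    positivity
  have hL : 0 ≤ Real.logb 2 (Real.exp 1) := Real.logb_nonneg one_lt_two (Real.one_le_exp zero_le_one)
  have hanti : Antitone fun γ => P.real {ω | γ < M.sinr p o ω} := fun a b hab =>
    measureReal_mono fun ω (hω : b < _) => lt_of_le_of_lt hab hω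
  have hdom : IntegrableOn (fun γ => p.ccdf (p.fadeLevel 1 (p.rMin .satUser) (p.sigma ^ 2) * γ) *
      Real.logb 2 (Real.exp 1)) (Set.Ioi 0) := by
    have := (integrableOn_Ioi_comp_mul_left_iff p.ccdf 0 hK).2
      (by rw [mul_zero]; exact integrableOn_ccdf hp)
    exact this.mul_const _
  refine hdom.mono' ?_ ((ae_restrict_iff' measurableSet_Ioi).2 (.of_forall fun γ hγ => ?_))
  · exact (hanti.measurable.mul (measurable_const.div
      (measurable_const.add measurable_id))).aestronglyMeasurable
  · have hγ' : 0 < γ := hγ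
    rw [Real.norm_of_nonneg (by positivity)]
    refine mul_le_mul (hM.measureReal_lt_sinr_le hp o hγ'.le) ?_ (by positivity)
      (hp.ccdf_nonneg (by positivity))
    exact div_le_self hL (by linarith)

theorem Network.IsModel.ae_sinr_nonneg (hM : M.IsModel p P) (hp : p.Valid) (o : Sharing) :
    0 ≤ᵐ[P] M.sinr p o := by
  filter_upwards [hM.ae_fade_pos hp, hM.ae_sq_le_interference hp o] with ω h1 h2
  simp only [Pi.zero_apply, Network.sinr]
  split_ifs with h
  · have hG := hp.gServing_mul_power_pos
    have := (h1 .satUser (M.serving p ω)).le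
    have := (hp.rMin_pos _).le.trans (Network.servingDist_mem hp h).1
    have := (sq_nonneg _).trans h2
    positivity
  · exact le_rfl

theorem integral_logb_exp_div {x : ℝ} (hx : 0 ≤ x) :
    ∫ t in (0 : ℝ)..x, Real.logb 2 (Real.exp 1) / (1 + t) = Real.logb 2 (1 + x) := by
  simp_rw [div_eq_mul_inv]
  rw [intervalIntegral.integral_const_mul,
    intervalIntegral.integral_comp_add_left (fun t => t⁻¹) 1, add_zero,
    integral_inv_of_pos one_pos (by linarith), div_one, Real.logb, Real.logb, Real.log_exp]
  ring

/-- The layer-cake formula for the spectral efficiency. -/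
theorem Network.IsModel.lintegral_logb [IsProbabilityMeasure P] (hM : M.IsModel p P) (hp : p.Valid) (o : Sharing) :
    ∫⁻ ω, ENNReal.ofReal (Real.logb 2 (1 + M.sinr p o ω)) ∂P =
      ENNReal.ofReal (∫ γ in Set.Ioi (0 : ℝ), P.real {ω | γ < M.sinr p o ω} *
        (Real.logb 2 (Real.exp 1) / (1 + γ))) := by
  have hL : 0 ≤ Real.logb 2 (Real.exp 1) := Real.logb_nonneg one_lt_two (Real.one_le_exp zero_le_one)
  have h0 := hM.ae_sinr_nonneg hp o
  have hg : ∀ γ ∈ Set.Ioi (0 : ℝ), 0 ≤ Real.logb 2 (Real.exp 1) / (1 + γ) := fun γ hγ => by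
    have : 0 < γ := hγ
    positivity
  rw [ofReal_integral_eq_lintegral_ofReal (hM.integrableOn_measureReal_lt_sinr hp o)
    ((ae_restrict_iff' measurableSet_Ioi).2 (.of_forall fun γ hγ =>
      mul_nonneg measureReal_nonneg (hg γ hγ)))]
  have h := lintegral_comp_eq_lintegral_meas_lt_mul P h0
    (hM.isMeasurable.sinr hp o).aemeasurable
    (g := fun t => Real.logb 2 (Real.exp 1) / (1 + t)) (fun t ht => ?_)
    ((ae_restrict_iff' measurableSet_Ioi).2 (.of_forall hg))
  · have h1 : ∫⁻ ω, ENNReal.ofReal (Real.logb 2 (1 + M.sinr p o ω)) ∂P =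
        ∫⁻ ω, ENNReal.ofReal
          (∫ t in (0 : ℝ)..(M.sinr p o ω), Real.logb 2 (Real.exp 1) / (1 + t)) ∂P :=
      lintegral_congr_ae (h0.mono fun ω hω => by
        simp only [integral_logb_exp_div hω])
    rw [h1, h]
    refine lintegral_congr fun γ => ?_
    rw [ENNReal.ofReal_mul measureReal_nonneg, ofReal_measureReal]
  · refine ContinuousOn.intervalIntegrable (continuousOn_const.div (by fun_prop) fun x hx => ?_)
    rw [Set.uIcc_of_le (le_of_lt ht)] at hx
    linarith [hx.1]

theorem Network.IsModel.integrable_logb [IsProbabilityMeasure P] (hM : M.IsModel p P) (hp : p.Valid) (o : Sharing) :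
    Integrable (fun ω => Real.logb 2 (1 + M.sinr p o ω)) P := by
  have hm : Measurable fun ω => Real.logb 2 (1 + M.sinr p o ω) :=
    (Real.measurable_log.comp ((hM.isMeasurable.sinr hp o).const_add 1)).div_const _
  refine ⟨hm.aestronglyMeasurable, ?_⟩
  rw [hasFiniteIntegral_iff_ofReal ((hM.ae_sinr_nonneg hp o).mono fun ω hω => ?_),
    hM.lintegral_logb hp o]
  · exact ENNReal.ofReal_lt_top
  · have : 0 ≤ M.sinr p o ω := hω
    exact Real.logb_nonneg one_lt_two (by linarith)

theorem Network.IsModel.spectralEfficiency_eq [IsProbabilityMeasure P] (hM : M.IsModel p P) (hp : p.Valid)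
    (o : Sharing) : M.spectralEfficiency p P o =
      ∫ γ in Set.Ioi (0 : ℝ), P.real {ω | γ < M.sinr p o ω} *
        (Real.logb 2 (Real.exp 1) / (1 + γ)) := by
  have hL : 0 ≤ Real.logb 2 (Real.exp 1) := Real.logb_nonneg one_lt_two (Real.one_le_exp zero_le_one)
  rw [Network.spectralEfficiency, integral_eq_lintegral_of_nonneg_ae
    ((hM.ae_sinr_nonneg hp o).mono fun ω hω => ?_)
    (hM.integrable_logb hp o).aestronglyMeasurable, hM.lintegral_logb hp o,
    ENNReal.toReal_ofReal]
  · refine setIntegral_nonneg measurableSet_Ioi fun γ hγ => ?_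
    have : 0 < γ := hγ
    positivity
  · have : 0 ≤ M.sinr p o ω := hω
    exact Real.logb_nonneg one_lt_two (by linarith)

end

end SatUplink

theorem theorem1 {Ω : Type*} [MeasurableSpace Ω] (P : Measure Ω) [IsProbabilityMeasure P]
    (p : SatUplink.Params) (hp : p.Valid)
    (M : SatUplink.Network Ω) (hM : M.IsModel p P) (o : SatUplink.Sharing) :
    -- the probability that some satellite user is visible
    (P (M.visibleEvent p)).toReal = p.visibleProb ∧
    -- the law of the nearest satellite user's distance, given that some satellite user is visible
    (ProbabilityTheory.cond P (M.visibleEvent p)).map (M.servingDist p) =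
      (volume.restrict (Set.Icc (p.rMin .satUser) (p.rMax .satUser))).withDensity
        (fun r => ENNReal.ofReal (p.nearestPDF r)) ∧
    -- the conditional Laplace transform of interference plus noise, given visibility and distance
    (∀ s : ℝ, 0 ≤ s → ∀ B : Set ℝ, MeasurableSet B →
      ∫ ω in M.visibleEvent p ∩ M.servingDist p ⁻¹' B, Real.exp (-(s * M.interference p o ω)) ∂P =
        ∫ ω in M.visibleEvent p ∩ M.servingDist p ⁻¹' B, p.laplace o (M.servingDist p ω) s ∂P) ∧
    -- the ergodic spectral efficiency is a convergent expectation
    Integrable (fun ω => Real.logb 2 (1 + M.sinr p o ω)) P ∧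
    -- the double integral converges
    (∀ γ : ℝ, 0 < γ →
      IntervalIntegrable (fun r => p.integrand o γ r) volume (p.rMin .satUser) (p.rMax .satUser)) ∧
    IntegrableOn
      (fun γ => ∫ r in (p.rMin .satUser)..(p.rMax .satUser), p.integrand o γ r) (Set.Ioi 0) ∧
    -- the exact expression
    M.spectralEfficiency p P o =
      p.visibleProb *
        ∫ γ in Set.Ioi (0 : ℝ),
          ∫ r in (p.rMin .satUser)..(p.rMax .satUser), p.integrand o γ r := by
  have hpv := hp.visibleProb_pos
  refine ⟨hM.measureReal_visibleEvent hp, hM.map_servingDist_cond hp,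
    fun s hs B hB => hM.setIntegral_exp_interference hp o hs hB, hM.integrable_logb hp o,
    fun γ hγ => hM.intervalIntegrable_integrand hp o hγ, ?_, ?_⟩
  · have h := (hM.integrableOn_measureReal_lt_sinr hp o).const_mul (p.visibleProb)⁻¹
    exact IntegrableOn.congr_fun h
      (fun γ hγ => (hM.integral_integrand hp o hγ).symm) measurableSet_Ioi
  · rw [hM.spectralEfficiency_eq hp o, setIntegral_congr_fun measurableSet_Ioi
      fun γ hγ => hM.integral_integrand hp o hγ, integral_const_mul, mul_inv_cancel_left₀ hpv.ne']
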